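/- **Setting.** Let $d,\nu\ge 1$, $\mathbb L=\mathbb Z^d$ with Euclidean distance $|\ell-\ell'|$, $\beta>0$, $m>0$, $a>0$. Let $S_\beta$ be the circle of length $\beta$ with Lebesgue measure ${\rm d}\tau$ and distance $|\tau-\tau'|_\beta=\min\{|\tau-\tau'|;\beta-|\tau-\tau'|\}$, let $C_\beta=C(S_\beta\to\mathbb R^\nu)$ with the supremum norm, $L^2_\beta=L^2(S_\beta\to\mathbb R^\nu,{\rm d}\tau)$, and, for $\sigma\in(0,1)$, $$|\omega|_{C^\sigma_\beta}=|\omega|_{C_\beta}+\sup_{\tau\ne\tau'}\frac{|\omega(\tau)-\omega(\tau')|}{|\tau-\tau'|_\beta^\sigma}\in[0,\infty].$$ Let $A=(-m\,{\rm d}^2/{\rm d}\tau^2+a)\otimes\mathbf I$ on $L^2_\beta$, whose eigenvalues are $m(2\pi k/\beta)^2+a$, $k\in\mathbb Z$, and let $\chi$ be the Gaussian probability measure on $C_\beta$ with $\int e^{i(\phi,\upsilon)_{L^2_\beta}}\chi({\rm d}\upsilon)=e^{-\frac12(A^{-1}\phi,\phi)_{L^2_\beta}}$ for all $\phi\in L^2_\beta$.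 Let $J_{\ell\ell'}\in\mathbb R$ satisfy $J_{\ell\ell}=0$, $J_{\ell\ell'}=J_{\ell'\ell}$, $\sup_\ell\sum_{\ell'}|J_{\ell\ell'}|<\infty$, and let $V_\ell:\mathbb R^\nu\to\mathbb R$, $\ell\in\mathbb L$, be continuous with $V_\ell(0)=0$ and $A_V|x|^{2r}+B_V\le V_\ell(x)\le V(x)$ for all $\ell,x$, with some $r>1$, $A_V>0$, $B_V\in\mathbb R$ and a continuous $V$ with $V(0)=0$, all independent of $\ell$. Assume one of two cases. Case 1: $\sup_\ell\sum_{\ell'}|J_{\ell\ell'}|e^{\alpha|\ell-\ell'|}<\infty$ for some $\alpha>0$; then $\overline\alpha\in(0,\infty]$ is the supremum of these $\alpha$, $\mathcal I=(0,\overline\alpha)$ and $w_\alpha(\ell,\ell')=e^{-\alpha|\ell-\ell'|}$. Case 2: this fails for every $\alpha>0$, but $\sup_\ell\sum_{\ell'}|J_{\ell\ell'}|(1+|\ell-\ell'|)^{\alpha d}<\infty$ for some $\alpha>1$; then $\overline\alpha\in(1,\infty]$ is the supremum of these $\alpha$, $\mathcal I=(1,\overline\alpha)$ and $w_\alpha(\ell,\ell')=(1+\varepsilon|\ell-\ell'|)^{-\alpha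 d}$ with a fixed $\varepsilon>0$. Let $\Omega=(C_\beta)^{\mathbb L}$ with the product Borel $\sigma$-algebra and $\Omega^{\rm t}=\{\omega\in\Omega:\sum_\ell|\omega_\ell|^2_{L^2_\beta}w_\alpha(0,\ell)<\infty\ \forall\alpha\in\mathcal I\}$. For a non-empty finite $\Lambda\subset\mathbb L$ put $$I_\Lambda(\omega|\xi)=-\tfrac12\sum_{\ell,\ell'\in\Lambda}J_{\ell\ell'}(\omega_\ell,\omega_{\ell'})_{L^2_\beta}+\sum_{\ell\in\Lambda}\int_0^\beta V_\ell(\omega_\ell(\tau)){\rm d}\tau-\sum_{\ell\in\Lambda,\,\ell'\in\Lambda^c}J_{\ell\ell'}(\omega_\ell,\xi_{\ell'})_{L^2_\beta}.$$ For $\xi\in\Omega^{\rm t}$ let $$\pi_\Lambda(B|\xi)=\frac1{Z_\Lambda(\xi)}\int e^{-I_\Lambda(\omega_\Lambda\times0_{\Lambda^c}|\xi)}\,\mathbb I_B(\omega_\Lambda\times\xi_{\Lambda^c})\prod_{\ell\in\Lambda}\chi({\rm d}\omega_\ell),$$ with $Z_\Lambda(\xi)$ the normalizing constant, and let $\pi_\Lambda(\cdot|\xi)=0$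 for $\xi\notin\Omega^{\rm t}$. Let $\mathcal G^{\rm t}$ be the set of probability measures $\mu$ on $\Omega$ with $\int\pi_\Lambda(B|\omega)\mu({\rm d}\omega)=\mu(B)$ for all such $\Lambda$ and all measurable $B$. **Theorem.** Let $\sigma\in(0,1/2)$. There exists $\lambda_\sigma>0$ such that $$\int\exp\left(\lambda_\sigma|\upsilon|^2_{C^\sigma_\beta}\right)\chi({\rm d}\upsilon)<\infty,\qquad(*)$$ and for every $\lambda_\sigma>0$ that satisfies $(*)$ and every $\varkappa>0$ there is a constant $C>0$ such that, for all $\ell\in\mathbb L$ and all $\mu\in\mathcal G^{\rm t}$, $$\int_\Omega\exp\left(\lambda_\sigma|\omega_\ell|^2_{C^\sigma_\beta}+\varkappa|\omega_\ell|^2_{L^2_\beta}\right)\mu({\rm d}\omega)\le C.$$ -/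

import Mathlib

open MeasureTheory
open scoped ENNReal NNReal

noncomputable section

namespace QuantumCrystal

/-! ### Lattice, loop spaces, configurations -/

/-- The lattice `𝕃 = ℤ^d`. -/
abbrev Site (d : ℕ) : Type := Fin d → ℤ

/-- The Euclidean distance `|ℓ - ℓ'|` of two lattice sites. -/
def siteDist {d : ℕ} (ℓ ℓ' : Site d) : ℝ :=
  Real.sqrt (∑ i, ((ℓ i : ℝ) - (ℓ' i : ℝ)) ^ 2)

/-- The space `C_β` of temperature loops: continuous maps from the circle `S_β` of length `β` to
`ℝ^ν`, with the supremum norm. The metric of `AddCircle β` is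
`min {|τ - τ'|, β - |τ - τ'|}` and its `volume` is Lebesgue measure, of total mass `β`. -/
abbrev Loop (β : ℝ) (ν : ℕ) : Type := C(AddCircle β, EuclideanSpace ℝ (Fin ν))

/-- `C_β` carries its Borel `σ`-algebra. -/
instance instMeasurableSpaceLoop (β : ℝ) (ν : ℕ) : MeasurableSpace (Loop β ν) := borel _

instance instBorelSpaceLoop (β : ℝ) (ν : ℕ) : BorelSpace (Loop β ν) := ⟨rfl⟩

/-- The configuration space `Ω = (C_β)^𝕃`, with the product `σ`-algebra. As `𝕃` is countable and
`C_β` is Polish, this is the Borel `σ`-algebra of the product topology. -/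
abbrev Config (d ν : ℕ) (β : ℝ) : Type := Site d → Loop β ν

/-- The Hilbert space `L²_β = L²(S_β → ℝ^ν, dτ)`. -/
abbrev LoopL2 (β : ℝ) (ν : ℕ) [Fact (0 < β)] : Type :=
  Lp (EuclideanSpace ℝ (Fin ν)) 2 (volume : Measure (AddCircle β))

/-- The embedding `C_β ↪ L²_β`. -/
def toL2 {β : ℝ} {ν : ℕ} [Fact (0 < β)] : Loop β ν →L[ℝ] LoopL2 β ν :=
  ContinuousMap.toLp 2 (volume : Measure (AddCircle β)) ℝ

/-- The Hölder norm `|ω|_{C_β^σ} = |ω|_{C_β} + sup_{τ ≠ τ'} |ω(τ) - ω(τ')| / |τ - τ'|_β^σ`,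
with the value `∞` if `ω` is not `σ`-Hölder continuous. -/
def holderENorm {β : ℝ} {ν : ℕ} [Fact (0 < β)] (σ : ℝ≥0) (ω : Loop β ν) : ℝ≥0∞ :=
  ‖ω‖ₑ + eHolderNorm σ (ω : AddCircle β → EuclideanSpace ℝ (Fin ν))

/-! ### The Gaussian path measure of the harmonic oscillator -/

/-- The eigenvalues `λ_k = m (2πk/β)² + a`, `k ∈ ℤ`, of the operator
`A = (-m d²/dτ² + a) ⊗ I` on `L²_β`. -/
def eigenvalue (m a β : ℝ) (k : ℤ) : ℝ := m * (2 * Real.pi * k / β) ^ 2 + a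

/-- The quadratic form `(A⁻¹ φ, φ)_{L²_β}`. In the Fourier basis `A` is multiplication by `λ_k`;
the factor `β` appears because Mathlib's Fourier coefficients
`β⁻¹ ∫ exp(-2πikτ/β) φ_j(τ) dτ` are taken with respect to the normalized measure `dτ/β`. -/
def invForm (m a : ℝ) {β : ℝ} {ν : ℕ} [Fact (0 < β)] (φ : LoopL2 β ν) : ℝ :=
  β * ∑' k : ℤ, (eigenvalue m a β k)⁻¹ *
    ∑ j : Fin ν, ‖fourierCoeff (fun τ : AddCircle β => ((φ τ j : ℝ) : ℂ)) k‖ ^ 2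

/-- `χ` is the law on `C_β` of the `β`-periodic Ornstein-Uhlenbeck velocity process: the
probability measure with Fourier transform
`∫ exp(i (φ, υ)_{L²_β}) χ(dυ) = exp(-(A⁻¹ φ, φ)_{L²_β} / 2)`, `φ ∈ L²_β`. -/
def IsOscillatorMeasure (m a : ℝ) {β : ℝ} {ν : ℕ} [Fact (0 < β)]
    (χ : Measure (Loop β ν)) : Prop :=
  IsProbabilityMeasure χ ∧ ∀ φ : LoopL2 β ν,
    ∫ υ, Complex.exp (Complex.I * ((inner ℝ φ (toL2 υ) : ℝ) : ℂ)) ∂χ =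
      Complex.exp (((-(1 / 2) * invForm m a φ : ℝ)) : ℂ)

open Classical in
/-- The Gaussian measure `χ` on `C_β`. For `m, a > 0` there is exactly one measure with the
defining property, so the second branch is never taken. -/
def oscillatorMeasure (m a β : ℝ) (ν : ℕ) [Fact (0 < β)] : Measure (Loop β ν) :=
  if h : ∃ χ : Measure (Loop β ν), IsOscillatorMeasure m a χ then h.choose else 0

/-- `∫ exp(c |υ|²_{C_β^σ}) χ(dυ) < ∞`. -/
def HasHolderExpMoment (m a β : ℝ) (ν : ℕ) [Fact (0 < β)] (σ : ℝ≥0) (c : ℝ) : Prop :=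
  ∫⁻ υ, EReal.exp ((ENNReal.ofReal c * holderENorm σ υ ^ 2 : ℝ≥0∞) : EReal)
    ∂(oscillatorMeasure m a β ν) < ⊤

/-! ### The model -/

/-- `sup_ℓ ∑_ℓ' |J_ℓℓ'| exp(α |ℓ - ℓ'|) < ∞`. -/
def ExpDecay {d : ℕ} (J : Site d → Site d → ℝ) (α : ℝ) : Prop :=
  (⨆ ℓ, ∑' ℓ', ENNReal.ofReal (|J ℓ ℓ'| * Real.exp (α * siteDist ℓ ℓ'))) < ⊤

/-- `sup_ℓ ∑_ℓ' |J_ℓℓ'| (1 + |ℓ - ℓ'|)^{αd} < ∞`. -/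
def PolyDecay {d : ℕ} (J : Site d → Site d → ℝ) (α : ℝ) : Prop :=
  (⨆ ℓ, ∑' ℓ', ENNReal.ofReal (|J ℓ ℓ'| * (1 + siteDist ℓ ℓ') ^ (α * d))) < ⊤

/-- The data of a quantum anharmonic crystal on `ℤ^d` with `ν`-dimensional oscillators, with the
standing assumptions on them. -/
structure Model (d ν : ℕ) where
  /-- the mass -/
  m : ℝ
  /-- the rigidity -/
  a : ℝ
  /-- the dynamical matrix -/
  J : Site d → Site d → ℝ
  /-- the self-interaction potentials -/
  V : Site d → EuclideanSpace ℝ (Fin ν) → ℝ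
  m_pos : 0 < m
  a_pos : 0 < a
  J_diag : ∀ ℓ, J ℓ ℓ = 0
  J_symm : ∀ ℓ ℓ', J ℓ ℓ' = J ℓ' ℓ
  J_bdd : (⨆ ℓ, ∑' ℓ', ENNReal.ofReal |J ℓ ℓ'|) < ⊤
  /-- one of the two cases for the decay of the interaction -/
  J_decay : (∃ α > 0, ExpDecay J α) ∨ (∃ α > 1, PolyDecay J α)
  V_cont : ∀ ℓ, Continuous (V ℓ)
  V_zero : ∀ ℓ, V ℓ 0 = 0
  V_lower : ∃ r > (1 : ℝ), ∃ A > (0 : ℝ), ∃ B : ℝ, ∀ ℓ x, A * ‖x‖ ^ (2 * r) + B ≤ V ℓ x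
  V_upper : ∃ U : EuclideanSpace ℝ (Fin ν) → ℝ, Continuous U ∧ U 0 = 0 ∧ ∀ ℓ x, V ℓ x ≤ U x

namespace Model

variable {d ν : ℕ} (M : Model d ν)

/-! ### Weights and tempered configurations -/

open Classical in
/-- The interval `𝓘` of the indices `α`: `(0, ᾱ)` with `ᾱ` the supremum of the `α` for which the
exponential condition holds, if it holds for some `α > 0`, and otherwise `(1, ᾱ)` with `ᾱ` the
supremum of the `α` for which the polynomial condition holds; `ᾱ = +∞` is allowed. -/
def index : Set ℝ :=
  if ∃ α > 0, ExpDecay M.J α then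
    {α | 0 < α ∧ (α : EReal) < sSup ((fun t : ℝ => (t : EReal)) '' {t | ExpDecay M.J t})}
  else
    {α | 1 < α ∧ (α : EReal) < sSup ((fun t : ℝ => (t : EReal)) '' {t | PolyDecay M.J t})}

open Classical in
/-- The weights: `w_α(ℓ, ℓ') = exp(-α |ℓ - ℓ'|)` in the first case and
`w_α(ℓ, ℓ') = (1 + ε |ℓ - ℓ'|)^{-αd}` in the second case. -/
def weight (ε α : ℝ) (ℓ ℓ' : Site d) : ℝ :=
  if ∃ α > 0, ExpDecay M.J α then Real.exp (-(α * siteDist ℓ ℓ'))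
  else (1 + ε * siteDist ℓ ℓ') ^ (-(α * d))

variable (β : ℝ) [Fact (0 < β)]

/-- The set `Ωᵗ` of tempered configurations: those with
`∑_ℓ |ω_ℓ|²_{L²_β} w_α(0, ℓ) < ∞` for all `α ∈ 𝓘`. -/
def tempered (ε : ℝ) : Set (Config d ν β) :=
  {ω | ∀ α ∈ M.index, Summable fun ℓ => ‖toL2 (ω ℓ)‖ ^ 2 * M.weight ε α 0 ℓ}

/-! ### Local Gibbs specification and Gibbs measures -/

variable {β}

/-- The energy `I_Λ(ω | ξ)` of the loops in `Λ` with the configuration `ξ` outside `Λ`. -/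
def energy (Λ : Finset (Site d)) (ω ξ : Config d ν β) : ℝ :=
  -(1 / 2) * (∑ ℓ ∈ Λ, ∑ ℓ' ∈ Λ, M.J ℓ ℓ' * inner ℝ (toL2 (ω ℓ)) (toL2 (ω ℓ')))
    + (∑ ℓ ∈ Λ, ∫ τ : AddCircle β, M.V ℓ (ω ℓ τ))
    - ∑ ℓ ∈ Λ, ∑' ℓ' : {x : Site d // x ∉ Λ},
        M.J ℓ ℓ' * inner ℝ (toL2 (ω ℓ)) (toL2 (ξ ℓ'))

open Classical in
/-- The configuration `ω_Λ × ξ_{Λᶜ}`. -/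
def glue (Λ : Finset (Site d)) (ω : Λ → Loop β ν) (ξ : Config d ν β) : Config d ν β :=
  fun ℓ => if h : ℓ ∈ Λ then ω ⟨ℓ, h⟩ else ξ ℓ

/-- The free measure `χ_Λ = ∏_{ℓ ∈ Λ} χ` on `Ω_Λ`. -/
def freeMeasure (Λ : Finset (Site d)) : Measure (Λ → Loop β ν) :=
  Measure.pi fun _ => oscillatorMeasure M.m M.a β ν

/-- The density `exp(-I_Λ(ω_Λ × 0_{Λᶜ} | ξ))`. -/
def boltzmann (Λ : Finset (Site d)) (ω : Λ → Loop β ν) (ξ : Config d ν β) : ℝ≥0∞ :=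
  ENNReal.ofReal (Real.exp (-M.energy Λ (glue Λ ω 0) ξ))

/-- The partition function `Z_Λ(ξ)`. -/
def partition (Λ : Finset (Site d)) (ξ : Config d ν β) : ℝ≥0∞ :=
  ∫⁻ ω, M.boltzmann Λ ω ξ ∂(M.freeMeasure Λ)

open Classical in
/-- The local Gibbs specification `π_Λ(B | ξ)`; it is `0` for `ξ ∉ Ωᵗ`. -/
def spec (ε : ℝ) (Λ : Finset (Site d)) (B : Set (Config d ν β)) (ξ : Config d ν β) : ℝ≥0∞ :=
  if ξ ∈ M.tempered β ε then
    (M.partition Λ ξ)⁻¹ *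
      ∫⁻ ω, M.boltzmann Λ ω ξ * B.indicator 1 (glue Λ ω ξ) ∂(M.freeMeasure Λ)
  else 0

variable (β)

/-- The set `𝒢ᵗ` of tempered Euclidean Gibbs measures at inverse temperature `β`: the probability
measures on `Ω` that solve the Dobrushin-Lanford-Ruelle equation. -/
def gibbs (ε : ℝ) : Set (Measure (Config d ν β)) :=
  {μ | IsProbabilityMeasure μ ∧ ∀ Λ : Finset (Site d), Λ.Nonempty →
    ∀ B : Set (Config d ν β), MeasurableSet B → ∫⁻ ω, M.spec ε Λ B ω ∂μ = μ B}

end Model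

end QuantumCrystal

end

/-!
The Gibbs measures of the model are controlled through two independent facts: the exponential
integrability of the Gaussian measure `χ`, and a closed inequality for moments in finite volumes
that follows from the Dobrushin-Lanford-Ruelle equation for single sites alone.

*The Gaussian measure.* The measure `χ` exists: it is the law of the random Fourier series with
independent Gaussian coefficients of variance `1 / (β λ_k)`, which converges in `L¹` with values in
the loops, by a uniform bound on the moments of its finite sections
(`exists_isOscillatorMeasure`). From the Fourier transform alone, tested against differences of
normalized indicators of shrinking arcs, one reads off that the coordinates of `υ(τ) - υ(τ')` are
Gaussian with variance at most a multiple of `|τ - τ'|^{2s}` for every `s < 1/2`, since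
`∑_k |k|^{2s} / λ_k` converges. Dyadic chaining turns these bounds for pairs of points into an
exponential moment of the square of the `σ`-Hölder norm, `σ < s`
(`exists_lintegral_exp_holder_le_of_gaussian`, `IsOscillatorMeasure.exists_exp_holder`).

*One site.* The potential grows faster than quadratically, so it absorbs `κ |ω_ℓ|²` and the
interaction, apart from an arbitrarily small multiple `θ` of the boundary strength
`∑_k |J_{ℓk}| |ξ_k|²`. Hence the one-site conditional expectation of
`exp (c |ω_ℓ|²_{C^σ} + κ |ω_ℓ|²_{L²})` is at most `exp (D + θ ∑_k |J_{ℓk}| |ξ_k|²)`, where `D` does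
not depend on the site; this remains true when `ω_ℓ` is conditioned to lie in a large ball of `L²`
(`Model.IsAdmissible.exists_site_estimate`).

*All sites.* Nothing guarantees at first that the right-hand side is integrable. The moments are
therefore taken with every `|ω_k|_{L²}`, `k ∈ Λ`, cut off at level `N`, which makes those of
`exp (κ |ω_k|²)` finite, and damped by the factor `exp (-κ ∑_{k ∉ Λ} w(ℓ, k) |ω_k|²)`, which controls
the influence of the configuration outside `Λ`. Indeed, by the convolution inequality
`∑_k |J_{ℓk}| w(k, j) ≤ C w(ℓ, j)` for the weights of tempered configurations, the damping exponent is
a supersolution of the recursion (`Model.IsAdmissible.boundary_sub_tail_le`). For small `θ` the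
convexity of the exponential then bounds the largest of the finitely many moments of
`exp (κ |ω_k|²)`, `k ∈ Λ`, by a constant plus half of itself, and with it the full moments
(`Model.IsAdmissible.lintegral_cutoff_le`). The bound depends neither on `N` nor on `Λ`. Letting
`N → ∞` and then `Λ ↑ 𝕃`, where the damping disappears, Fatou's lemma gives the theorem
(`Model.IsAdmissible.lintegral_le`).
-/

noncomputable section

namespace QuantumCrystal

open Filter Topology

/-! ### Dyadic chaining -/

section chaining

lemma floor_dyadic_succ (x : ℝ) (n : ℕ) :
    ⌊x * 2 ^ (n + 1)⌋ = 2 * ⌊x * 2 ^ n⌋ ∨ ⌊x * 2 ^ (n + 1)⌋ = 2 * ⌊x * 2 ^ n⌋ + 1 := by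
  have h1 := Int.floor_le (x * 2 ^ n)
  have h2 := Int.lt_floor_add_one (x * 2 ^ n)
  have h3 := Int.floor_le (x * 2 ^ (n + 1))
  have h4 := Int.lt_floor_add_one (x * 2 ^ (n + 1))
  rw [pow_succ, ← mul_assoc] at h3 h4 ⊢
  have h5 : 2 * ⌊x * 2 ^ n⌋ < ⌊x * 2 ^ n * 2⌋ + 1 := by
    have : (2 * ⌊x * 2 ^ n⌋ : ℝ) < ⌊x * 2 ^ n * 2⌋ + 1 := by linarith
    exact_mod_cast this
  have h6 : ⌊x * 2 ^ n * 2⌋ < 2 * ⌊x * 2 ^ n⌋ + 2 := by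
    have : (⌊x * 2 ^ n * 2⌋ : ℝ) < 2 * ⌊x * 2 ^ n⌋ + 2 := by linarith
    exact_mod_cast this
  omega

lemma tendsto_floor_dyadic (x : ℝ) :
    Tendsto (fun n : ℕ => (⌊x * 2 ^ n⌋ : ℝ) / 2 ^ n) atTop (𝓝 x) := by
  have h0 : Tendsto (fun n : ℕ => x - (1 / 2 : ℝ) ^ n) atTop (𝓝 x) := by
    have := tendsto_pow_atTop_nhds_zero_of_lt_one (r := (1 / 2 : ℝ)) (by norm_num) (by norm_num)
    simpa using tendsto_const_nhds.sub this
  refine tendsto_of_tendsto_of_tendsto_of_le_of_le h0 tendsto_const_nhds (fun n => ?_) fun n => ?_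
  · have := Int.lt_floor_add_one (x * 2 ^ n)
    have h2 : (0 : ℝ) < 2 ^ n := by positivity
    simp only [one_div, inv_pow]
    rw [le_div_iff₀ h2, sub_mul, inv_mul_cancel₀ h2.ne']
    linarith
  · have := Int.floor_le (x * 2 ^ n)
    have h2 : (0 : ℝ) < 2 ^ n := by positivity
    simpa using (div_le_iff₀ h2).2 this

variable {E : Type*} [NormedAddCommGroup E]

/-- Telescoping along the dyadic approximations of two points: if the increments of `f` over the
dyadic intervals of length `2⁻ⁿ` are at most `M qⁿ`, the same holds up to a constant for the
increments over all intervals of length at most `2⁻ⁿ`. -/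
lemma dist_le_of_dyadic_increments {f : ℝ → E} (hf : Continuous f) {M q : ℝ} (hM : 0 ≤ M)
    (hq0 : 0 < q) (hq1 : q < 1)
    (h : ∀ (n : ℕ) (k : ℤ), dist (f ((k : ℝ) / 2 ^ n)) (f ((k + 1 : ℝ) / 2 ^ n)) ≤ M * q ^ n)
    {n : ℕ} {x y : ℝ} (hxy : |x - y| ≤ (1 / 2) ^ n) :
    dist (f x) (f y) ≤ (1 + 2 / (1 - q)) * (M * q ^ n) := by
  have step : ∀ (z : ℝ), dist (f ((⌊z * 2 ^ n⌋ : ℝ) / 2 ^ n)) (f z) ≤ M * q ^ n / (1 - q) := by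
    intro z
    refine dist_le_of_le_geometric_of_tendsto q M hq1
      (f := fun n : ℕ => f ((⌊z * 2 ^ n⌋ : ℝ) / 2 ^ n)) (fun n => ?_)
      ((hf.tendsto z).comp (tendsto_floor_dyadic z)) n
    have e : ((⌊z * 2 ^ n⌋ : ℝ) / 2 ^ n) = ((2 * ⌊z * 2 ^ n⌋ : ℤ) : ℝ) / 2 ^ (n + 1) := by
      push_cast
      rw [pow_succ]
      field_simp
    have hle : M * q ^ (n + 1) ≤ M * q ^ n := by
      rw [pow_succ, ← mul_assoc]
      exact mul_le_of_le_one_right (by positivity) hq1.le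
    rcases floor_dyadic_succ z n with h' | h'
    · simp only [e, h', dist_self]; positivity
    · refine le_trans ?_ hle
      have := h (n + 1) (2 * ⌊z * 2 ^ n⌋)
      simp only [e, h']
      push_cast at this ⊢
      exact this
  have mid : dist (f ((⌊x * 2 ^ n⌋ : ℝ) / 2 ^ n)) (f ((⌊y * 2 ^ n⌋ : ℝ) / 2 ^ n)) ≤ M * q ^ n := by
    have h2 : (0 : ℝ) < 2 ^ n := by positivity
    have hd : |x * 2 ^ n - y * 2 ^ n| ≤ 1 := by
      rw [← sub_mul, abs_mul, abs_of_pos h2]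
      calc _ ≤ (1 / 2 : ℝ) ^ n * 2 ^ n := by gcongr
        _ = 1 := by rw [← mul_pow]; norm_num
    have h1 := Int.floor_le (x * 2 ^ n)
    have h2 := Int.lt_floor_add_one (x * 2 ^ n)
    have h3 := Int.floor_le (y * 2 ^ n)
    have h4 := Int.lt_floor_add_one (y * 2 ^ n)
    rw [abs_le] at hd
    have h5 : ⌊x * 2 ^ n⌋ < ⌊y * 2 ^ n⌋ + 2 := by
      have : (⌊x * 2 ^ n⌋ : ℝ) < ⌊y * 2 ^ n⌋ + 2 := by linarith
      exact_mod_cast this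
    have h6 : ⌊y * 2 ^ n⌋ < ⌊x * 2 ^ n⌋ + 2 := by
      have : (⌊y * 2 ^ n⌋ : ℝ) < ⌊x * 2 ^ n⌋ + 2 := by linarith
      exact_mod_cast this
    have h7 : ⌊x * 2 ^ n⌋ = ⌊y * 2 ^ n⌋ ∨ ⌊x * 2 ^ n⌋ = ⌊y * 2 ^ n⌋ + 1 ∨
        ⌊y * 2 ^ n⌋ = ⌊x * 2 ^ n⌋ + 1 := by omega
    rcases h7 with h7 | h7 | h7
    · rw [h7, dist_self]; positivity
    · rw [h7, dist_comm]; push_cast; exact h n _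
    · rw [h7]; push_cast; exact h n _
  have sx := step x
  have sy := step y
  rw [dist_comm] at sx
  calc dist (f x) (f y) ≤ _ := dist_triangle4 _ _ _ _
    _ ≤ M * q ^ n / (1 - q) + M * q ^ n + M * q ^ n / (1 - q) := by gcongr
    _ = _ := by ring

variable {β : ℝ}

/-- Two points of the circle have representatives at the same distance. -/
lemma exists_real_of_circle (τ τ' : AddCircle β) :
    ∃ t t' : ℝ, (t : AddCircle β) = τ ∧ (t' : AddCircle β) = τ' ∧ |t - t'| = dist τ τ' := by
  obtain ⟨t, rfl⟩ := QuotientAddGroup.mk_surjective τ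
  obtain ⟨t', rfl⟩ := QuotientAddGroup.mk_surjective τ'
  refine ⟨t, t' + round (β⁻¹ * (t - t')) * β, rfl, ?_, ?_⟩
  · rw [AddCircle.coe_add, ← zsmul_eq_mul, AddCircle.coe_zsmul, AddCircle.coe_period, smul_zero,
      add_zero]
  · rw [dist_eq_norm]
    change _ = ‖((t : AddCircle β) - (t' : AddCircle β))‖
    rw [← AddCircle.coe_sub, AddCircle.norm_eq, ← sub_sub]

lemma dist_circle_le [hβ : Fact (0 < β)] (τ τ' : AddCircle β) : dist τ τ' ≤ β := by
  rw [dist_eq_norm]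
  have := AddCircle.norm_le_half_period β (x := τ - τ') hβ.out.ne'
  rw [abs_of_pos hβ.out] at this
  linarith [hβ.out]

/-- The Hölder constant produced by dyadic chaining on the circle. -/
def chainConst (β σ : ℝ) : ℝ := (1 + 2 / (1 - 2 ^ (-σ))) * 2 ^ σ / β ^ σ

lemma two_rpow_neg_lt_one {σ : ℝ} (hσ : 0 < σ) : (2 : ℝ) ^ (-σ) < 1 :=
  Real.rpow_lt_one_of_one_lt_of_neg (by norm_num) (by linarith)

lemma chainConst_nonneg (hβ0 : 0 < β) {σ : ℝ} (hσ : 0 < σ) : 0 ≤ chainConst β σ := by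
  have := two_rpow_neg_lt_one hσ
  have h : 0 < 1 - (2 : ℝ) ^ (-σ) := by linarith
  unfold chainConst
  positivity

/-- A continuous function on the circle is Hölder continuous as soon as its increments over the
dyadic arcs are. -/
lemma dist_le_of_dyadic_arcs [hβ : Fact (0 < β)] {f : AddCircle β → E} (hf : Continuous f)
    {M σ : ℝ} (hM : 0 ≤ M) (hσ : 0 < σ)
    (h : ∀ (n k : ℕ), k < 2 ^ n → dist (f ((β * ((k : ℝ) / 2 ^ n) : ℝ) : AddCircle β))
      (f ((β * ((k + 1 : ℝ) / 2 ^ n) : ℝ) : AddCircle β)) ≤ M * ((2 : ℝ) ^ (-σ)) ^ n)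
    (τ τ' : AddCircle β) : dist (f τ) (f τ') ≤ chainConst β σ * M * dist τ τ' ^ σ := by
  have hβ0 : 0 < β := hβ.out
  have hq1 := two_rpow_neg_lt_one hσ
  set q : ℝ := (2 : ℝ) ^ (-σ) with hq
  have hq0 : 0 < q := by positivity
  obtain ⟨t, t', rfl, rfl, hd⟩ := exists_real_of_circle τ τ'
  rcases eq_or_ne t t' with rfl | hne
  · rw [dist_self]
    have := chainConst_nonneg hβ0 hσ
    positivity
  set g : ℝ → E := fun x => f ((β * x : ℝ) : AddCircle β) with hg
  have hgc : Continuous g := by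
    refine hf.comp ((AddCircle.continuous_mk' β).comp (continuous_const.mul continuous_id))
  have hper : ∀ (x : ℝ) (m : ℤ), g (x + m) = g x := by
    intro x m
    simp only [hg]
    congr 1
    rw [mul_add, AddCircle.coe_add, mul_comm β (m : ℝ), ← zsmul_eq_mul, AddCircle.coe_zsmul,
      AddCircle.coe_period, smul_zero, add_zero]
  -- By periodicity the dyadic intervals in `[0, 1)` suffice.
  have hall : ∀ (n : ℕ) (k : ℤ),
      dist (g ((k : ℝ) / 2 ^ n)) (g ((k + 1 : ℝ) / 2 ^ n)) ≤ M * q ^ n := by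
    intro n k
    have h2 : (0 : ℤ) < 2 ^ n := by positivity
    obtain ⟨j, hj⟩ := Int.eq_ofNat_of_zero_le (Int.emod_nonneg k h2.ne')
    have hjlt : j < 2 ^ n := by
      have := Int.emod_lt_of_pos k h2
      rw [hj] at this
      exact_mod_cast this
    have hk : (k : ℝ) = j + 2 ^ n * ((k / 2 ^ n : ℤ) : ℝ) := by
      have := Int.emod_add_mul_ediv k (2 ^ n)
      rw [hj] at this
      exact_mod_cast this.symm
    have e1 : (k : ℝ) / 2 ^ n = (j : ℝ) / 2 ^ n + ((k / 2 ^ n : ℤ) : ℝ) := by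
      rw [hk]; field_simp
    have e2 : (k + 1 : ℝ) / 2 ^ n = (j + 1 : ℝ) / 2 ^ n + ((k / 2 ^ n : ℤ) : ℝ) := by
      rw [add_div, e1]; ring
    rw [e1, e2, hper, hper]
    exact h n j hjlt
  have hx0 : 0 < |t - t'| / β := div_pos (abs_pos.2 (sub_ne_zero.2 hne)) hβ0
  have hx1 : |t - t'| / β ≤ 1 := by
    rw [hd, div_le_one hβ0]
    exact dist_circle_le _ _
  -- The dyadic scale of the pair: `2⁻⁽ⁿ⁺¹⁾ < |t - t'| / β ≤ 2⁻ⁿ`.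
  obtain ⟨n, hn1, hn2⟩ := exists_nat_pow_near_of_lt_one hx0 hx1 (y := (1 / 2 : ℝ)) (by norm_num)
    (by norm_num)
  have key := dist_le_of_dyadic_increments hgc hM hq0 hq1 hall (n := n) (x := t / β) (y := t' / β)
    (by rw [← sub_div, abs_div, abs_of_pos hβ0]; exact hn2)
  have ht : ∀ s : ℝ, g (s / β) = f (s : AddCircle β) := by
    intro s
    simp only [hg]
    rw [mul_div_cancel₀ _ hβ0.ne']
  rw [ht, ht] at key
  have hqn : q ^ n ≤ 2 ^ σ * (|t - t'| / β) ^ σ := by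
    have e : q ^ n = 2 ^ σ * ((1 / 2 : ℝ) ^ (n + 1)) ^ σ := by
      rw [hq, ← Real.rpow_natCast, ← Real.rpow_mul (by norm_num), one_div, inv_pow,
        ← Real.rpow_natCast, ← Real.rpow_neg (by norm_num), ← Real.rpow_mul (by norm_num),
        ← Real.rpow_add (by norm_num)]
      congr 1
      push_cast
      ring
    rw [e]
    gcongr
  have h1q : 0 < 1 - q := by linarith
  calc _ ≤ _ := key
    _ ≤ (1 + 2 / (1 - q)) * (M * (2 ^ σ * (|t - t'| / β) ^ σ)) := by gcongr
    _ = _ := by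
      rw [hd, Real.div_rpow dist_nonneg hβ0.le, chainConst]
      ring

end chaining

/-! ### Exponential moments of Hölder norms -/

section moments

variable {β : ℝ} [hβ : Fact (0 < β)] {ν : ℕ}

lemma exp_coe_ofReal {x : ℝ} (hx : 0 ≤ x) :
    EReal.exp ((ENNReal.ofReal x : ℝ≥0∞) : EReal) = ENNReal.ofReal (Real.exp x) := by
  rw [EReal.coe_ennreal_ofReal, max_eq_left hx, EReal.exp_coe]

lemma exp_mul_holder_sq_le_of_le {c : ℝ} (hc : 0 ≤ c) {σ : ℝ≥0} {ω : Loop β ν} {x : ℝ}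
    (hx : 0 ≤ x) (h : holderENorm σ ω ≤ ENNReal.ofReal x) :
    EReal.exp ((ENNReal.ofReal c * holderENorm σ ω ^ 2 : ℝ≥0∞) : EReal) ≤
      ENNReal.ofReal (Real.exp (c * x ^ 2)) := by
  rw [← exp_coe_ofReal (by positivity)]
  apply EReal.exp_monotone
  rw [EReal.coe_ennreal_le_coe_ennreal_iff, ENNReal.ofReal_mul hc, ENNReal.ofReal_pow hx]
  gcongr

/-- The constant by which dyadic chaining controls the full Hölder norm. -/
def holderConst (β σ : ℝ) : ℝ := chainConst β σ * (1 + β ^ σ)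

/-- The Hölder norm of a loop is controlled by its value at one point and its dyadic
increments. -/
lemma holderENorm_le_of_dyadic_arcs {σ : ℝ≥0} (hσ : 0 < σ) {ω : Loop β ν} {M : ℝ} (hM : 0 ≤ M)
    (h : ∀ (n k : ℕ), k < 2 ^ n → dist (ω ((β * ((k : ℝ) / 2 ^ n) : ℝ) : AddCircle β))
      (ω ((β * ((k + 1 : ℝ) / 2 ^ n) : ℝ) : AddCircle β)) ≤ M * ((2 : ℝ) ^ (-(σ : ℝ))) ^ n) :
    holderENorm σ ω ≤ ENNReal.ofReal (‖ω 0‖ + holderConst β σ * M) := by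
  have hσ' : (0 : ℝ) < σ := by exact_mod_cast hσ
  have hβ0 := hβ.out
  have hC := chainConst_nonneg hβ0 hσ'
  have key := dist_le_of_dyadic_arcs (f := ω) ω.continuous hM hσ' h
  have h1 : ‖ω‖ ≤ ‖ω 0‖ + chainConst β σ * M * β ^ (σ : ℝ) := by
    rw [ContinuousMap.norm_le _ (by positivity)]
    intro τ
    have h2 := key τ 0
    have h3 : dist τ 0 ^ (σ : ℝ) ≤ β ^ (σ : ℝ) := by
      gcongr
      exact dist_circle_le _ _
    have h4 : ‖ω τ‖ ≤ ‖ω 0‖ + dist (ω τ) (ω 0) := by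
      rw [dist_eq_norm]; exact norm_le_norm_add_norm_sub' _ _
    calc _ ≤ _ := h4
      _ ≤ ‖ω 0‖ + chainConst β σ * M * dist τ 0 ^ (σ : ℝ) := by gcongr
      _ ≤ _ := by gcongr
  have h2 : eHolderNorm σ (ω : AddCircle β → EuclideanSpace ℝ (Fin ν)) ≤
      ENNReal.ofReal (chainConst β σ * M) := by
    refine HolderWith.eHolderNorm_le (C := (chainConst β σ * M).toNNReal) fun τ τ' => ?_
    change _ ≤ ENNReal.ofReal _ * _
    rw [edist_dist, edist_dist, ENNReal.ofReal_rpow_of_nonneg dist_nonneg hσ'.le,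
      ← ENNReal.ofReal_mul (by positivity)]
    exact ENNReal.ofReal_le_ofReal (key τ τ')
  calc holderENorm σ ω ≤ ENNReal.ofReal (‖ω 0‖ + chainConst β σ * M * β ^ (σ : ℝ)) +
        ENNReal.ofReal (chainConst β σ * M) := by
        unfold holderENorm
        rw [← ofReal_norm]
        gcongr
    _ = _ := by
        rw [← ENNReal.ofReal_add (by positivity) (by positivity), holderConst]
        congr 1
        ring

/-- The dyadic functional whose expectation bounds the exponential moment of the Hölder norm. The
exponent of each dyadic increment at level `n` is normalized by its variance scale `2^{-2sn}`, and
the small prefactors outweigh the number `2ⁿ` of the increments. -/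
def dyadicSum {β : ℝ} (σ s θ : ℝ) (ω : Loop β ν) : ℝ≥0∞ :=
  ENNReal.ofReal (Real.exp (θ / 2)) + ∑' n : ℕ, ∑ k ∈ Finset.range (2 ^ n),
    ENNReal.ofReal (Real.exp (-(θ / 2 * ((2 : ℝ) ^ (2 * (s - σ))) ^ n))) *
      ENNReal.ofReal (Real.exp (θ * ((2 : ℝ) ^ (2 * s)) ^ n *
        ‖ω ((β * ((k : ℝ) / 2 ^ n) : ℝ) : AddCircle β) -
          ω ((β * ((k + 1 : ℝ) / 2 ^ n) : ℝ) : AddCircle β)‖ ^ 2))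

lemma measurable_dyadicSum {β : ℝ} (σ s θ : ℝ) :
    Measurable (dyadicSum σ s θ : Loop β ν → ℝ≥0∞) := by
  unfold dyadicSum
  have h : ∀ n k : ℕ, Measurable fun ω : Loop β ν =>
      ENNReal.ofReal (Real.exp (-(θ / 2 * ((2 : ℝ) ^ (2 * (s - σ))) ^ n))) *
      ENNReal.ofReal (Real.exp (θ * ((2 : ℝ) ^ (2 * s)) ^ n *
        ‖ω ((β * ((k : ℝ) / 2 ^ n) : ℝ) : AddCircle β) -
          ω ((β * ((k + 1 : ℝ) / 2 ^ n) : ℝ) : AddCircle β)‖ ^ 2)) := fun n k =>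
    measurable_const.mul (ENNReal.measurable_ofReal.comp (Continuous.measurable (by fun_prop)))
  exact measurable_const.add (Measurable.tsum fun n => Finset.measurable_sum _ fun k _ => h n k)

/-- `exp (c z)` is split according to whether `z ≤ 1`; for `z > 1` a large exponential moment of
`z` produces a small prefactor. -/
lemma exp_half_le (θ ρ z : ℝ) (hθ : 0 ≤ θ) (hρ : 1 ≤ ρ) :
    Real.exp (θ / 2 * z) ≤
      max (Real.exp (θ / 2)) (Real.exp (-(θ / 2 * ρ)) * Real.exp (θ * (ρ * z))) := by
  rcases le_total z 1 with hz | hz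
  · exact le_max_of_le_left (Real.exp_le_exp.2 (by nlinarith))
  · refine le_max_of_le_right ?_
    rw [← Real.exp_add]
    refine Real.exp_le_exp.2 ?_
    nlinarith [mul_nonneg hθ (sub_nonneg.2 hz), mul_nonneg (mul_nonneg hθ (sub_nonneg.2 hz))
      (sub_nonneg.2 hρ), mul_nonneg hθ (sub_nonneg.2 hρ)]

lemma exp_increment_le_dyadicSum {β : ℝ} {σ s θ : ℝ} (hσs : σ ≤ s) (hθ : 0 ≤ θ) (ω : Loop β ν)
    {n k : ℕ} (hk : k < 2 ^ n) :
    ENNReal.ofReal (Real.exp (θ / 2 * (((2 : ℝ) ^ (2 * σ)) ^ n *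
        ‖ω ((β * ((k : ℝ) / 2 ^ n) : ℝ) : AddCircle β) -
          ω ((β * ((k + 1 : ℝ) / 2 ^ n) : ℝ) : AddCircle β)‖ ^ 2))) ≤ dyadicSum σ s θ ω := by
  set z := ‖ω ((β * ((k : ℝ) / 2 ^ n) : ℝ) : AddCircle β) -
          ω ((β * ((k + 1 : ℝ) / 2 ^ n) : ℝ) : AddCircle β)‖ ^ 2 with hz
  have hρ : (1 : ℝ) ≤ ((2 : ℝ) ^ (2 * (s - σ))) ^ n :=
    one_le_pow₀ (Real.one_le_rpow (by norm_num) (by linarith))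
  refine (ENNReal.ofReal_le_ofReal (exp_half_le θ _ _ hθ hρ)).trans ?_
  rw [ENNReal.ofReal_max]
  refine max_le le_self_add (le_add_left ?_)
  refine le_trans ?_ (ENNReal.le_tsum n)
  refine le_trans (le_of_eq ?_) (Finset.single_le_sum (fun _ _ => zero_le)
    (Finset.mem_range.2 hk))
  rw [ENNReal.ofReal_mul (Real.exp_nonneg _), ← hz]
  have e : (2 : ℝ) ^ (2 * s) = (2 : ℝ) ^ (2 * (s - σ)) * (2 : ℝ) ^ (2 * σ) := by
    rw [← Real.rpow_add (by norm_num)]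
    ring_nf
  rw [e, mul_pow]
  ring_nf

/-- The exponential of the squared Hölder norm is bounded by the dyadic functional `W` and the value
at one point: every dyadic increment is at most `M 2^{-σn}` with `θ M² / 2 = log W`, so chaining
bounds the Hölder norm by `‖ω 0‖` plus a constant multiple of `M`. -/
lemma exp_holder_le {σ : ℝ≥0} (hσ : 0 < σ) {s θ c : ℝ} (hσs : σ ≤ s) (hθ : 0 < θ) (hc : 0 ≤ c)
    {θ₀ : ℝ} (hc1 : 4 * c ≤ θ₀) (hc2 : 4 * c * holderConst β σ ^ 2 ≤ θ / 2) (ω : Loop β ν) :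
    EReal.exp ((ENNReal.ofReal c * holderENorm σ ω ^ 2 : ℝ≥0∞) : EReal) ≤
      ENNReal.ofReal (Real.exp (θ₀ * ‖ω 0‖ ^ 2)) + dyadicSum σ s θ ω := by
  by_cases hW : dyadicSum σ s θ ω = ⊤
  · simp [hW]
  have hσ' : (0 : ℝ) < σ := by exact_mod_cast hσ
  obtain ⟨W, hW0, hWe⟩ : ∃ W : ℝ, 0 ≤ W ∧ dyadicSum σ s θ ω = ENNReal.ofReal W :=
    ⟨_, ENNReal.toReal_nonneg, (ENNReal.ofReal_toReal hW).symm⟩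
  have hW1 : 1 < W := by
    have : ENNReal.ofReal (Real.exp (θ / 2)) ≤ ENNReal.ofReal W := by
      rw [← hWe]; exact le_self_add
    have := (ENNReal.ofReal_le_ofReal_iff hW0).1 this
    have h1 : 1 < Real.exp (θ / 2) := Real.one_lt_exp_iff.2 (by positivity)
    linarith
  have hL : 0 < Real.log W := Real.log_pos hW1
  set M := Real.sqrt (Real.log W / (θ / 2)) with hMdef
  have hM : 0 ≤ M := Real.sqrt_nonneg _
  have hM2 : θ / 2 * M ^ 2 = Real.log W := by
    rw [hMdef, Real.sq_sqrt (by positivity)]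
    field_simp
  have hdy : ∀ (n k : ℕ), k < 2 ^ n → dist (ω ((β * ((k : ℝ) / 2 ^ n) : ℝ) : AddCircle β))
      (ω ((β * ((k + 1 : ℝ) / 2 ^ n) : ℝ) : AddCircle β)) ≤ M * ((2 : ℝ) ^ (-(σ : ℝ))) ^ n := by
    intro n k hk
    have h1 := exp_increment_le_dyadicSum (σ := σ) hσs hθ.le ω hk
    rw [hWe, ENNReal.ofReal_le_ofReal_iff hW0, ← Real.le_log_iff_exp_le (by linarith), ← hM2] at h1
    have h2 := le_of_mul_le_mul_left h1 (by positivity : 0 < θ / 2)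
    rw [dist_eq_norm]
    refine le_of_sq_le_sq ?_ (by positivity)
    have e : ((2 : ℝ) ^ (2 * (σ : ℝ))) ^ n * (((2 : ℝ) ^ (-(σ : ℝ))) ^ n) ^ 2 = 1 := by
      rw [← pow_mul, mul_comm n 2, pow_mul, ← mul_pow, ← Real.rpow_natCast ((2:ℝ) ^ _) 2,
        ← Real.rpow_mul (by norm_num), ← Real.rpow_add (by norm_num)]
      have : 2 * (σ : ℝ) + -(σ : ℝ) * ((2 : ℕ) : ℝ) = 0 := by push_cast; ring
      rw [this]; simp
    set z := ‖ω ((β * ((k : ℝ) / 2 ^ n) : ℝ) : AddCircle β) -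
          ω ((β * ((k + 1 : ℝ) / 2 ^ n) : ℝ) : AddCircle β)‖ ^ 2 with hz
    calc z = (((2 : ℝ) ^ (2 * (σ : ℝ))) ^ n * (((2 : ℝ) ^ (-(σ : ℝ))) ^ n) ^ 2) * z := by
          rw [e, one_mul]
      _ = (((2 : ℝ) ^ (2 * (σ : ℝ))) ^ n * z) * (((2 : ℝ) ^ (-(σ : ℝ))) ^ n) ^ 2 := by ring
      _ ≤ M ^ 2 * (((2 : ℝ) ^ (-(σ : ℝ))) ^ n) ^ 2 := by gcongr
      _ = _ := by ring
  have hK : 0 ≤ holderConst β σ := by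
    have := chainConst_nonneg hβ.out hσ'
    have := hβ.out
    unfold holderConst
    positivity
  refine (exp_mul_holder_sq_le_of_le hc (by positivity)
    (holderENorm_le_of_dyadic_arcs hσ hM hdy)).trans ?_
  rw [hWe, ← ENNReal.ofReal_add (Real.exp_nonneg _) hW0]
  refine ENNReal.ofReal_le_ofReal ?_
  set u := ‖ω 0‖
  set v := holderConst β σ * M
  have h4 : 4 * c * v ^ 2 ≤ Real.log W := by
    calc 4 * c * v ^ 2 = 4 * c * holderConst β σ ^ 2 * M ^ 2 := by ring
      _ ≤ θ / 2 * M ^ 2 := by gcongr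
      _ = _ := hM2
  have h5 : 4 * c * u ^ 2 ≤ θ₀ * u ^ 2 := by gcongr
  rcases le_total u v with huv | huv
  · have : c * (u + v) ^ 2 ≤ Real.log W := by
      refine le_trans ?_ h4
      have : (u + v) ^ 2 ≤ (2 * v) ^ 2 := by gcongr; linarith
      nlinarith
    have := Real.exp_le_exp.2 this
    rw [Real.exp_log (by linarith)] at this
    linarith [Real.exp_nonneg (θ₀ * u ^ 2)]
  · have : c * (u + v) ^ 2 ≤ θ₀ * u ^ 2 := by
      refine le_trans ?_ h5
      have : (u + v) ^ 2 ≤ (2 * u) ^ 2 := by gcongr; linarith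
      nlinarith
    have := Real.exp_le_exp.2 this
    linarith

lemma summable_two_pow_mul_exp {κ ρ : ℝ} (hκ : 0 < κ) (hρ : 1 < ρ) :
    Summable fun n : ℕ => (2 : ℝ) ^ n * Real.exp (-(κ * ρ ^ n)) := by
  refine summable_of_ratio_test_tendsto_lt_one (l := 0) one_pos
    (Eventually.of_forall fun n => by positivity) ?_
  have h : (fun n : ℕ => ‖(2 : ℝ) ^ (n + 1) * Real.exp (-(κ * ρ ^ (n + 1)))‖ /
      ‖(2 : ℝ) ^ n * Real.exp (-(κ * ρ ^ n))‖) =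
      fun n : ℕ => 2 * Real.exp (-((κ * (ρ - 1)) * ρ ^ n)) := by
    ext n
    rw [Real.norm_of_nonneg (by positivity), Real.norm_of_nonneg (by positivity),
      div_eq_iff (by positivity), pow_succ]
    rw [show 2 * Real.exp (-(κ * (ρ - 1) * ρ ^ n)) * (2 ^ n * Real.exp (-(κ * ρ ^ n))) =
      2 ^ n * 2 * (Real.exp (-(κ * (ρ - 1) * ρ ^ n)) * Real.exp (-(κ * ρ ^ n))) by ring,
      ← Real.exp_add]
    congr 2
    ring
  rw [h]
  have h1 : Tendsto (fun n : ℕ => (κ * (ρ - 1)) * ρ ^ n) atTop atTop :=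
    (tendsto_pow_atTop_atTop_of_one_lt hρ).const_mul_atTop (mul_pos hκ (by linarith))
  simpa using (Real.tendsto_exp_neg_atTop_nhds_zero.comp h1).const_mul 2

/-- **Exponential integrability of the Hölder norm.** If the increments of a random loop satisfy
uniform Gaussian bounds at the scale `|τ - τ'|ˢ` with `s > σ`, then the square of its `σ`-Hölder
norm has an exponential moment, with constants that depend on these bounds only. -/
theorem exists_lintegral_exp_holder_le (β : ℝ) [hβ : Fact (0 < β)] (ν : ℕ) {σ : ℝ≥0} (hσ : 0 < σ)
    {s θ : ℝ} (hσs : σ < s) (hθ : 0 < θ) {K : ℝ≥0∞} (hK : K < ⊤) :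
    ∃ c : ℝ, 0 < c ∧ ∃ K' : ℝ≥0∞, K' < ⊤ ∧ ∀ {Ω : Type} [MeasurableSpace Ω] (P : Measure Ω)
      [IsProbabilityMeasure P] (X : Ω → Loop β ν), Measurable X →
      (∀ τ τ' : AddCircle β, ∀ b : ℝ, 0 ≤ b → b * dist τ τ' ^ (2 * s) ≤ θ →
        ∫⁻ x, ENNReal.ofReal (Real.exp (b * ‖X x τ - X x τ'‖ ^ 2)) ∂P ≤ K) →
      (∫⁻ x, ENNReal.ofReal (Real.exp (θ * ‖X x 0‖ ^ 2)) ∂P ≤ K) →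
      ∫⁻ x, EReal.exp ((ENNReal.ofReal c * holderENorm σ (X x) ^ 2 : ℝ≥0∞) : EReal) ∂P ≤ K' := by
  have hβ0 := hβ.out
  have hσ' : (0 : ℝ) < σ := by exact_mod_cast hσ
  have hs : 0 < s := by linarith
  -- The arcs at level `n` have length `β 2⁻ⁿ`, hence the rescaling of `θ` by `β^{2s}`.
  set θ' : ℝ := θ / β ^ (2 * s) with hθ'
  have hθ'0 : 0 < θ' := by positivity
  set ρ : ℝ := (2 : ℝ) ^ (2 * (s - σ)) with hρ
  have hρ1 : 1 < ρ := Real.one_lt_rpow (by norm_num) (by linarith)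
  obtain ⟨c, hc0, hc1, hc2⟩ : ∃ c : ℝ, 0 < c ∧ 4 * c ≤ θ ∧
      4 * c * holderConst β σ ^ 2 ≤ θ' / 2 := by
    refine ⟨min (θ / 4) (θ' / 2 / (4 * (holderConst β σ ^ 2 + 1))), by positivity, ?_, ?_⟩
    · have := min_le_left (θ / 4) (θ' / 2 / (4 * (holderConst β σ ^ 2 + 1)))
      linarith
    · have h := min_le_right (θ / 4) (θ' / 2 / (4 * (holderConst β σ ^ 2 + 1)))
      rw [le_div_iff₀ (by positivity)] at h
      have h0 : 0 ≤ min (θ / 4) (θ' / 2 / (4 * (holderConst β σ ^ 2 + 1))) := by positivity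
      nlinarith
  refine ⟨c, hc0, K + (ENNReal.ofReal (Real.exp (θ' / 2)) +
    ∑' n : ℕ, ENNReal.ofReal ((2 : ℝ) ^ n * Real.exp (-(θ' / 2 * ρ ^ n))) * K), ?_, ?_⟩
  · refine ENNReal.add_lt_top.2 ⟨hK, ENNReal.add_lt_top.2 ⟨ENNReal.ofReal_lt_top, ?_⟩⟩
    rw [ENNReal.tsum_mul_right]
    refine ENNReal.mul_lt_top ?_ hK
    exact (summable_two_pow_mul_exp (by positivity) hρ1).tsum_ofReal_lt_top
  intro Ω _ P _ X hX h1 h2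
  calc _ ≤ ∫⁻ x, (ENNReal.ofReal (Real.exp (θ * ‖X x 0‖ ^ 2)) + dyadicSum σ s θ' (X x)) ∂P :=
        lintegral_mono fun x => exp_holder_le hσ hσs.le hθ'0 hc0.le hc1 hc2 (X x)
    _ = ∫⁻ x, ENNReal.ofReal (Real.exp (θ * ‖X x 0‖ ^ 2)) ∂P + ∫⁻ x, dyadicSum σ s θ' (X x) ∂P :=
        lintegral_add_right _ ((measurable_dyadicSum _ _ _).comp hX)
    _ ≤ _ := by
        gcongr
        unfold dyadicSum
        rw [lintegral_add_left measurable_const, lintegral_const, measure_univ, mul_one]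
        gcongr
        have hm : ∀ b : ℝ, ∀ τ τ' : AddCircle β, Measurable fun x =>
            ENNReal.ofReal (Real.exp (b * ‖X x τ - X x τ'‖ ^ 2)) := by
          intro b τ τ'
          have : Measurable fun ω : Loop β ν =>
              ENNReal.ofReal (Real.exp (b * ‖ω τ - ω τ'‖ ^ 2)) :=
            ENNReal.measurable_ofReal.comp (Continuous.measurable (by fun_prop))
          exact this.comp hX
        have hm' : ∀ n k : ℕ, Measurable fun x =>
            ENNReal.ofReal (Real.exp (-(θ' / 2 * ρ ^ n))) *
            ENNReal.ofReal (Real.exp (θ' * ((2 : ℝ) ^ (2 * s)) ^ n *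
              ‖X x ((β * ((k : ℝ) / 2 ^ n) : ℝ) : AddCircle β) -
                X x ((β * ((k + 1 : ℝ) / 2 ^ n) : ℝ) : AddCircle β)‖ ^ 2)) :=
          fun n k => (hm _ _ _).const_mul _
        rw [lintegral_tsum fun n => (Finset.measurable_sum _ fun k _ => hm' n k).aemeasurable]
        refine ENNReal.tsum_le_tsum fun n => ?_
        rw [lintegral_finsetSum _ fun k _ => hm' n k]
        have hone : ∀ k ∈ Finset.range (2 ^ n), ∫⁻ x,
            ENNReal.ofReal (Real.exp (-(θ' / 2 * ρ ^ n))) *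
            ENNReal.ofReal (Real.exp (θ' * ((2 : ℝ) ^ (2 * s)) ^ n *
              ‖X x ((β * ((k : ℝ) / 2 ^ n) : ℝ) : AddCircle β) -
                X x ((β * ((k + 1 : ℝ) / 2 ^ n) : ℝ) : AddCircle β)‖ ^ 2)) ∂P ≤
            ENNReal.ofReal (Real.exp (-(θ' / 2 * ρ ^ n))) * K := by
          intro k _
          rw [lintegral_const_mul _ (hm _ _ _)]
          gcongr
          refine h1 _ _ _ (by positivity) ?_
          have hd : dist ((β * ((k : ℝ) / 2 ^ n) : ℝ) : AddCircle β)
              ((β * ((k + 1 : ℝ) / 2 ^ n) : ℝ) : AddCircle β) ≤ β / 2 ^ n := by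
            rw [dist_eq_norm, ← AddCircle.coe_sub]
            refine (QuotientAddGroup.norm_mk_le_norm).trans ?_
            rw [Real.norm_eq_abs]
            rw [show β * ((k : ℝ) / 2 ^ n) - β * ((k + 1 : ℝ) / 2 ^ n) = -(β / 2 ^ n) by ring,
              abs_neg, abs_of_nonneg (by positivity)]
          calc _ ≤ θ' * ((2 : ℝ) ^ (2 * s)) ^ n * (β / 2 ^ n) ^ (2 * s) := by gcongr
            _ = θ' * β ^ (2 * s) := by
              rw [Real.div_rpow hβ0.le (by positivity), ← Real.rpow_natCast,
                ← Real.rpow_mul (by norm_num), ← Real.rpow_natCast (2 : ℝ) n,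
                ← Real.rpow_mul (by norm_num), mul_comm (2 * s) (n : ℝ)]
              field_simp
            _ ≤ θ := by rw [hθ']; field_simp; exact le_rfl
        refine (Finset.sum_le_sum hone).trans (le_of_eq ?_)
        rw [Finset.sum_const, Finset.card_range, nsmul_eq_mul, ← mul_assoc,
          ENNReal.ofReal_mul (by positivity), ENNReal.ofReal_pow (by norm_num)]
        norm_num

end moments

/-! ### Centred Gaussian variables -/

lemma lintegral_exp_sq_standard_lt_top :
    ∫⁻ x, ENNReal.ofReal (Real.exp (1 / 4 * x ^ 2)) ∂(ProbabilityTheory.gaussianReal 0 1) < ⊤ := by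
  rw [ProbabilityTheory.gaussianReal_of_var_ne_zero 0 one_ne_zero,
    lintegral_withDensity_eq_lintegral_mul _ (ProbabilityTheory.measurable_gaussianPDF 0 1)
      (by fun_prop)]
  have h : ∀ x : ℝ, (ProbabilityTheory.gaussianPDF 0 1 *
      fun x => ENNReal.ofReal (Real.exp (1 / 4 * x ^ 2))) x =
      ENNReal.ofReal ((Real.sqrt (2 * Real.pi))⁻¹ * Real.exp (-(1 / 4) * x ^ 2)) := by
    intro x
    rw [Pi.mul_apply, ProbabilityTheory.gaussianPDF, ← ENNReal.ofReal_mul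
      (ProbabilityTheory.gaussianPDFReal_nonneg _ _ _), ProbabilityTheory.gaussianPDFReal, mul_assoc,
      ← Real.exp_add]
    simp only [NNReal.coe_one, mul_one, sub_zero]
    congr 3
    ring
  simp_rw [h]
  exact ((integrable_exp_neg_mul_sq (by norm_num)).const_mul _).lintegral_lt_top

/-- The exponential moment of order `1/4` of a squared standard normal variable. -/
def gaussConst : ℝ≥0∞ :=
  ∫⁻ x, ENNReal.ofReal (Real.exp (1 / 4 * x ^ 2)) ∂(ProbabilityTheory.gaussianReal 0 1)

lemma lintegral_exp_sq_gaussianReal_le {v : ℝ≥0} {b : ℝ} (hbv : b * v ≤ 1 / 4) :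
    ∫⁻ x, ENNReal.ofReal (Real.exp (b * x ^ 2)) ∂(ProbabilityTheory.gaussianReal 0 v) ≤
      gaussConst := by
  have h : ProbabilityTheory.gaussianReal 0 v =
      (ProbabilityTheory.gaussianReal 0 1).map (Real.sqrt v * ·) := by
    rw [ProbabilityTheory.gaussianReal_map_const_mul]
    congr 1
    · simp
    · ext; simp [Real.sq_sqrt]
  rw [h, lintegral_map (by fun_prop) (by fun_prop)]
  refine lintegral_mono fun x => ENNReal.ofReal_le_ofReal (Real.exp_le_exp.2 ?_)
  rw [mul_pow, Real.sq_sqrt v.coe_nonneg, ← mul_assoc]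
  gcongr

/-- A real variable with a centred Gaussian characteristic function satisfies Gaussian exponential
bounds. -/
lemma lintegral_exp_sq_le_of_charFun {Ω : Type*} [MeasurableSpace Ω] {P : Measure Ω}
    [IsProbabilityMeasure P] {Y : Ω → ℝ} (hY : Measurable Y) {v : ℝ} (hv : 0 ≤ v)
    (h : ∀ t : ℝ, ∫ x, Complex.exp (Complex.I * ((t * Y x : ℝ) : ℂ)) ∂P =
      Complex.exp (((-(1 / 2) * (t ^ 2 * v) : ℝ)) : ℂ)) {b : ℝ} (hb : b * v ≤ 1 / 4) :
    ∫⁻ x, ENNReal.ofReal (Real.exp (b * Y x ^ 2)) ∂P ≤ gaussConst := by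
  have hlaw : P.map Y = ProbabilityTheory.gaussianReal 0 v.toNNReal := by
    have := Measure.isProbabilityMeasure_map (μ := P) hY.aemeasurable
    refine Measure.ext_of_charFun (funext fun t => ?_)
    rw [ProbabilityTheory.charFun_gaussianReal, charFun_apply_real,
      integral_map hY.aemeasurable (by fun_prop)]
    have e : ∀ x, Complex.exp (t * Y x * Complex.I) =
        Complex.exp (Complex.I * ((t * Y x : ℝ) : ℂ)) := by
      intro x; congr 1; push_cast; ring
    simp_rw [e]
    rw [h t]
    congr 1
    rw [Real.coe_toNNReal v hv]
    push_cast
    ring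
  rw [← lintegral_map (f := fun y => ENNReal.ofReal (Real.exp (b * y ^ 2))) (by fun_prop) hY, hlaw]
  exact lintegral_exp_sq_gaussianReal_le (by rwa [Real.coe_toNNReal v hv])

/-- Passage from the coordinates to the Euclidean norm in Gaussian exponential bounds. -/
lemma lintegral_exp_norm_sq_le {Ω : Type*} [MeasurableSpace Ω] {P : Measure Ω} {ν : ℕ}
    (hν : 0 < ν) {Y : Ω → EuclideanSpace ℝ (Fin ν)} (hY : Measurable Y) {b : ℝ} (hb : 0 ≤ b)
    {K : ℝ≥0∞}
    (h : ∀ j, ∫⁻ x, ENNReal.ofReal (Real.exp (ν * b * Y x j ^ 2)) ∂P ≤ K) :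
    ∫⁻ x, ENNReal.ofReal (Real.exp (b * ‖Y x‖ ^ 2)) ∂P ≤ ν * K := by
  have hm : ∀ j, Measurable fun x => ENNReal.ofReal (Real.exp (ν * b * Y x j ^ 2)) := by
    intro j
    have : Measurable fun y : EuclideanSpace ℝ (Fin ν) =>
        ENNReal.ofReal (Real.exp (ν * b * y j ^ 2)) :=
      ENNReal.measurable_ofReal.comp (Continuous.measurable (by fun_prop))
    exact this.comp hY
  calc _ ≤ ∫⁻ x, ∑ j, ENNReal.ofReal (Real.exp (ν * b * Y x j ^ 2)) ∂P := by
        refine lintegral_mono fun x => ?_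
        have : Nonempty (Fin ν) := ⟨⟨0, hν⟩⟩
        obtain ⟨j, -, hj⟩ := Finset.exists_max_image Finset.univ (fun j => Y x j ^ 2)
          Finset.univ_nonempty
        refine le_trans ?_ (Finset.single_le_sum
          (f := fun j => ENNReal.ofReal (Real.exp (ν * b * Y x j ^ 2)))
          (fun _ _ => zero_le) (Finset.mem_univ j))
        refine ENNReal.ofReal_le_ofReal (Real.exp_le_exp.2 ?_)
        rw [EuclideanSpace.norm_sq_eq, mul_comm (ν : ℝ) b, mul_assoc]
        gcongr
        refine (Finset.sum_le_card_nsmul _ _ (Y x j ^ 2) fun i hi => ?_).trans ?_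
        · rw [Real.norm_eq_abs, sq_abs]; exact hj i hi
        · simp
    _ = ∑ j, ∫⁻ x, ENNReal.ofReal (Real.exp (ν * b * Y x j ^ 2)) ∂P :=
        lintegral_finsetSum _ fun j _ => hm j
    _ ≤ ∑ _j : Fin ν, K := Finset.sum_le_sum fun j _ => h j
    _ = ν * K := by simp

/-! ### The covariance of the oscillator -/

section spectrum

variable {m a β : ℝ}

lemma eigenvalue_pos (hm : 0 < m) (ha : 0 < a) (k : ℤ) : 0 < eigenvalue m a β k := by
  unfold eigenvalue; positivity

lemma summable_inv_eigenvalue_mul_rpow (hm : 0 < m) (ha : 0 < a) (hβ : 0 < β) {s : ℝ}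
    (hs : s < 1 / 2) :
    Summable fun k : ℤ => (eigenvalue m a β k)⁻¹ * |(k : ℝ)| ^ (2 * s) := by
  have h1 : Summable fun k : ℤ => (m * (2 * Real.pi / β) ^ 2)⁻¹ * |(k : ℝ)| ^ (-(2 - 2 * s)) :=
    (Real.summable_abs_int_rpow (by linarith)).mul_left _
  refine Summable.of_norm_bounded_eventually h1 ?_
  filter_upwards [(Set.finite_singleton (0 : ℤ)).eventually_cofinite_notMem] with k hk
  have hk : k ≠ 0 := hk
  have hk' : 0 < |(k : ℝ)| := abs_pos.2 (by exact_mod_cast hk)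
  have hpos := eigenvalue_pos (β := β) hm ha k
  rw [Real.norm_of_nonneg (by positivity)]
  have hle : m * (2 * Real.pi / β) ^ 2 * |(k : ℝ)| ^ 2 ≤ eigenvalue m a β k := by
    have : m * (2 * Real.pi / β) ^ 2 * |(k : ℝ)| ^ 2 = m * (2 * Real.pi * k / β) ^ 2 := by
      rw [sq_abs]; ring
    unfold eigenvalue
    linarith
  calc _ ≤ (m * (2 * Real.pi / β) ^ 2 * |(k : ℝ)| ^ 2)⁻¹ * |(k : ℝ)| ^ (2 * s) := by gcongr
    _ = _ := by
      rw [show -(2 - 2 * s) = 2 * s - 2 by ring, Real.rpow_sub hk', Real.rpow_two, mul_inv]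
      ring

lemma summable_inv_eigenvalue (hm : 0 < m) (ha : 0 < a) (hβ : 0 < β) :
    Summable fun k : ℤ => (eigenvalue m a β k)⁻¹ := by
  simpa using summable_inv_eigenvalue_mul_rpow hm ha hβ (s := 0) (by norm_num)

lemma norm_fourier_apply (k : ℤ) (τ : AddCircle β) : ‖fourier k τ‖ = 1 := Circle.norm_coe _

lemma norm_fourier_sub_le [hβ : Fact (0 < β)] (k : ℤ) (τ τ' : AddCircle β) :
    ‖fourier k τ - fourier k τ'‖ ≤ 2 * Real.pi * |(k : ℝ)| / β * dist τ τ' := by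
  have hβ0 := hβ.out
  obtain ⟨t, t', rfl, rfl, hd⟩ := exists_real_of_circle τ τ'
  rw [← hd, fourier_coe_apply, fourier_coe_apply]
  have e : Complex.exp (2 * Real.pi * Complex.I * k * t / β) -
      Complex.exp (2 * Real.pi * Complex.I * k * t' / β) =
      Complex.exp ((2 * Real.pi * k * t' / β : ℝ) * Complex.I) *
      (Complex.exp (Complex.I * (2 * Real.pi * k / β * (t - t') : ℝ)) - 1) := by
    rw [mul_sub, ← Complex.exp_add, mul_one]
    congr 2
    · push_cast; ring
    · push_cast; ring
  rw [e, norm_mul, Complex.norm_exp_ofReal_mul_I, one_mul]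
  refine Real.norm_exp_I_mul_ofReal_sub_one_le.trans (le_of_eq ?_)
  rw [Real.norm_eq_abs, abs_mul, abs_div, abs_mul, abs_of_pos hβ0,
    abs_of_pos (by positivity : 0 < 2 * Real.pi)]

lemma norm_fourier_sub_sq_le [hβ : Fact (0 < β)] (k : ℤ) (τ τ' : AddCircle β) {s : ℝ}
    (hs0 : 0 ≤ s) (hs1 : s ≤ 1) :
    ‖fourier k τ - fourier k τ'‖ ^ 2 ≤
      4 * (2 * Real.pi / β) ^ (2 * s) * |(k : ℝ)| ^ (2 * s) * dist τ τ' ^ (2 * s) := by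
  have hβ0 := hβ.out
  set x := 2 * Real.pi * |(k : ℝ)| / β * dist τ τ' with hx
  have hx0 : 0 ≤ x := by positivity
  have h1 : ‖fourier k τ - fourier k τ'‖ ≤ 2 * x ^ s := by
    rcases le_total x 1 with h | h
    · refine (norm_fourier_sub_le k τ τ').trans ?_
      have : x ≤ x ^ s := by
        conv_lhs => rw [← Real.rpow_one x]
        exact Real.rpow_le_rpow_of_exponent_ge' hx0 h hs0 hs1
      linarith
    · have h2 : 1 ≤ x ^ s := Real.one_le_rpow h hs0
      have h3 := norm_sub_le (fourier k τ) (fourier k τ')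
      rw [norm_fourier_apply, norm_fourier_apply] at h3
      linarith
  calc _ ≤ (2 * x ^ s) ^ 2 := by gcongr
    _ = 4 * x ^ (2 * s) := by
      rw [mul_pow, ← Real.rpow_natCast (x ^ s), ← Real.rpow_mul hx0, mul_comm s]
      norm_num
    _ = _ := by
      have e : x = 2 * Real.pi / β * |(k : ℝ)| * dist τ τ' := by rw [hx]; ring
      rw [e, Real.mul_rpow (by positivity) (by positivity),
        Real.mul_rpow (by positivity) (by positivity)]
      ring

/-- The variance of `X_j(τ) - y X_j(τ')` for the loop `X` with covariance `A⁻¹`, restricted to the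
Fourier modes in `S`. -/
def pairVar (m a β : ℝ) (S : Set ℤ) (τ τ' : AddCircle β) (y : ℝ) : ℝ :=
  ∑' k : ℤ, S.indicator (fun k => (β * eigenvalue m a β k)⁻¹ *
    ‖fourier k τ - y * fourier k τ'‖ ^ 2) k

lemma pairVar_term_nonneg (hm : 0 < m) (ha : 0 < a) (hβ : 0 < β) (S : Set ℤ) (τ τ' : AddCircle β)
    (y : ℝ) (k : ℤ) : 0 ≤ S.indicator (fun k => (β * eigenvalue m a β k)⁻¹ *
      ‖fourier k τ - y * fourier k τ'‖ ^ 2) k := by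
  refine Set.indicator_nonneg (fun k _ => ?_) k
  have := eigenvalue_pos (β := β) hm ha k
  positivity

lemma summable_pairVar (hm : 0 < m) (ha : 0 < a) (hβ : 0 < β) (S : Set ℤ) (τ τ' : AddCircle β)
    (y : ℝ) : Summable (S.indicator (fun k => (β * eigenvalue m a β k)⁻¹ *
      ‖fourier k τ - y * fourier k τ'‖ ^ 2)) := by
  refine Summable.indicator ?_ S
  have h1 : Summable fun k : ℤ => (eigenvalue m a β k)⁻¹ * (β⁻¹ * (1 + |y|) ^ 2) :=
    (summable_inv_eigenvalue hm ha hβ).mul_right _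
  refine Summable.of_nonneg_of_le (fun k => ?_) (fun k => ?_) h1
  · have := eigenvalue_pos (β := β) hm ha k
    positivity
  · have := eigenvalue_pos (β := β) hm ha k
    have h2 : ‖fourier k τ - y * fourier k τ'‖ ≤ 1 + |y| := by
      refine (norm_sub_le _ _).trans ?_
      rw [norm_mul, norm_fourier_apply, norm_fourier_apply, mul_one, Complex.norm_real,
        Real.norm_eq_abs]
    calc _ ≤ (β * eigenvalue m a β k)⁻¹ * (1 + |y|) ^ 2 := by gcongr
      _ = _ := by rw [mul_inv]; ring

/-- The constant in the Hölder bound for the covariance of the modes in `S`. -/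
def modeConst (m a β s : ℝ) (S : Set ℤ) : ℝ :=
  4 * (2 * Real.pi / β) ^ (2 * s) * β⁻¹ * (∑' k : ℤ, S.indicator
    (fun k => (eigenvalue m a β k)⁻¹ * |(k : ℝ)| ^ (2 * s)) k) +
  β⁻¹ * ∑' k : ℤ, S.indicator (fun k => (eigenvalue m a β k)⁻¹) k

lemma modeConst_summands_nonneg (hm : 0 < m) (ha : 0 < a) (s : ℝ) (S : Set ℤ) (k : ℤ) :
    0 ≤ S.indicator (fun k => (eigenvalue m a β k)⁻¹ * |(k : ℝ)| ^ (2 * s)) k ∧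
    0 ≤ S.indicator (fun k => (eigenvalue m a β k)⁻¹) k := by
  constructor <;>
  · refine Set.indicator_nonneg (fun k _ => ?_) k
    have := eigenvalue_pos (β := β) hm ha k
    positivity

lemma modeConst_parts_nonneg (hm : 0 < m) (ha : 0 < a) (hβ : 0 < β) (s : ℝ) (S : Set ℤ) :
    0 ≤ 4 * (2 * Real.pi / β) ^ (2 * s) * β⁻¹ * (∑' k : ℤ, S.indicator
    (fun k => (eigenvalue m a β k)⁻¹ * |(k : ℝ)| ^ (2 * s)) k) ∧
    0 ≤ β⁻¹ * ∑' k : ℤ, S.indicator (fun k => (eigenvalue m a β k)⁻¹) k := by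
  constructor
  · exact mul_nonneg (by positivity)
      (tsum_nonneg fun k => (modeConst_summands_nonneg hm ha s S k).1)
  · exact mul_nonneg (by positivity)
      (tsum_nonneg fun k => (modeConst_summands_nonneg hm ha s S k).2)

lemma pairVar_one_le [hβ : Fact (0 < β)] (hm : 0 < m) (ha : 0 < a) {s : ℝ} (hs0 : 0 ≤ s)
    (hs1 : s < 1 / 2) (S : Set ℤ) (τ τ' : AddCircle β) :
    pairVar m a β S τ τ' 1 ≤ modeConst m a β s S * dist τ τ' ^ (2 * s) := by
  have hβ0 := hβ.out
  have h1 := (summable_inv_eigenvalue_mul_rpow hm ha hβ0 hs1).indicator S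
  calc pairVar m a β S τ τ' 1 ≤ ∑' k : ℤ, 4 * (2 * Real.pi / β) ^ (2 * s) * β⁻¹ *
        dist τ τ' ^ (2 * s) * S.indicator
          (fun k => (eigenvalue m a β k)⁻¹ * |(k : ℝ)| ^ (2 * s)) k := by
        refine (summable_pairVar hm ha hβ0 S τ τ' 1).tsum_le_tsum (fun k => ?_) (h1.mul_left _)
        by_cases hk : k ∈ S
        · simp only [Set.indicator_of_mem hk]
          have hpos := eigenvalue_pos (β := β) hm ha k
          have := norm_fourier_sub_sq_le k τ τ' hs0 (by linarith)
          rw [Complex.ofReal_one, one_mul]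
          calc _ ≤ (β * eigenvalue m a β k)⁻¹ * (4 * (2 * Real.pi / β) ^ (2 * s) *
                |(k : ℝ)| ^ (2 * s) * dist τ τ' ^ (2 * s)) := by gcongr
            _ = _ := by rw [mul_inv]; ring
        · simp [Set.indicator_of_notMem hk]
    _ = 4 * (2 * Real.pi / β) ^ (2 * s) * β⁻¹ * (∑' k : ℤ, S.indicator
          (fun k => (eigenvalue m a β k)⁻¹ * |(k : ℝ)| ^ (2 * s)) k) * dist τ τ' ^ (2 * s) := by
        rw [tsum_mul_left]; ring
    _ ≤ _ := by
        unfold modeConst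
        gcongr
        linarith [(modeConst_parts_nonneg hm ha hβ0 s S).2]

lemma pairVar_zero_le (hβ0 : 0 < β) (hm : 0 < m) (ha : 0 < a) (s : ℝ)
    (S : Set ℤ) (τ τ' : AddCircle β) :
    pairVar m a β S τ τ' 0 ≤ modeConst m a β s S := by
  have e : pairVar m a β S τ τ' 0 = β⁻¹ * ∑' k : ℤ, S.indicator
      (fun k => (eigenvalue m a β k)⁻¹) k := by
    rw [← tsum_mul_left]
    refine tsum_congr fun k => ?_
    by_cases hk : k ∈ S
    · simp only [Set.indicator_of_mem hk]
      rw [Complex.ofReal_zero, zero_mul, sub_zero, norm_fourier_apply, mul_inv]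
      ring
    · simp [Set.indicator_of_notMem hk]
  rw [e]
  unfold modeConst
  linarith [(modeConst_parts_nonneg hm ha hβ0 s S).1]

end spectrum

/-- The exponential moment of the Hölder norm of a random loop whose coordinate increments have
Gaussian bounds with variances `v ≤ V |τ - τ'|^{2s}`, and whose coordinates have Gaussian bounds
with variances `v ≤ V`. The constants do not depend on the random loop. The cases `y = 1` and
`y = 0` of the hypothesis are those of the increments and of the values. -/
theorem exists_lintegral_exp_holder_le_of_gaussian (β : ℝ) [hβ : Fact (0 < β)] {ν : ℕ} (hν : 0 < ν)
    {σ : ℝ≥0} (hσ : 0 < σ) {s : ℝ} (hσs : σ < s) {V : ℝ} (hV : 0 < V) :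
    ∃ c : ℝ, 0 < c ∧ ∃ K' : ℝ≥0∞, K' < ⊤ ∧ ∀ {Ω : Type} [MeasurableSpace Ω] (P : Measure Ω)
      [IsProbabilityMeasure P] (X : Ω → Loop β ν), Measurable X →
      (∀ τ τ' : AddCircle β, ∀ y : ℝ, ∀ j : Fin ν, ∃ v : ℝ,
        (y = 1 → v ≤ V * dist τ τ' ^ (2 * s)) ∧ (y = 0 → v ≤ V) ∧
        ∀ b : ℝ, 0 ≤ b → b * v ≤ 1 / 4 →
        ∫⁻ x, ENNReal.ofReal (Real.exp (b * (X x τ j - y * X x τ' j) ^ 2)) ∂P ≤ gaussConst) →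
      ∫⁻ x, EReal.exp ((ENNReal.ofReal c * holderENorm σ (X x) ^ 2 : ℝ≥0∞) : EReal) ∂P ≤ K' := by
  have hν' : (0 : ℝ) < ν := by exact_mod_cast hν
  have hK : (ν : ℝ≥0∞) * gaussConst < ⊤ :=
    ENNReal.mul_lt_top (by simp) lintegral_exp_sq_standard_lt_top
  obtain ⟨c, hc, K', hK', h⟩ := exists_lintegral_exp_holder_le β ν hσ hσs
    (θ := 1 / (4 * ν * V)) (by positivity) hK
  refine ⟨c, hc, K', hK', fun P _ X hX hG => h P X hX ?_ ?_⟩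
  · intro τ τ' b hb hbd
    have hm : Measurable fun x => X x τ - X x τ' := by
      have : Measurable fun ω : Loop β ν => ω τ - ω τ' := Continuous.measurable (by fun_prop)
      exact this.comp hX
    refine lintegral_exp_norm_sq_le hν hm hb fun j => ?_
    obtain ⟨v, hv1, -, hv⟩ := hG τ τ' 1 j
    have := hv (ν * b) (by positivity) ?_
    · simpa using this
    · calc ν * b * v ≤ ν * b * (V * dist τ τ' ^ (2 * s)) := by gcongr; exact hv1 rfl
        _ = ν * V * (b * dist τ τ' ^ (2 * s)) := by ring
        _ ≤ ν * V * (1 / (4 * ν * V)) := by gcongr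
        _ = 1 / 4 := by field_simp
  · have hm : Measurable fun x => X x 0 := by
      have : Measurable fun ω : Loop β ν => ω 0 := Continuous.measurable (by fun_prop)
      exact this.comp hX
    refine lintegral_exp_norm_sq_le hν hm (by positivity) fun j => ?_
    obtain ⟨v, -, hv0, hv⟩ := hG 0 0 0 j
    have := hv (ν * (1 / (4 * ν * V))) (by positivity) ?_
    · simpa using this
    · calc _ ≤ ν * (1 / (4 * ν * V)) * V := by gcongr; exact hv0 rfl
        _ = 1 / 4 := by field_simp

/-! ### Hölder regularity of the oscillator measure -/

section oscillator

variable {m a β : ℝ} [hβ : Fact (0 < β)] {ν : ℕ}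

lemma fourierCoeff_eq_volume (f : AddCircle β → ℂ) (n : ℤ) :
    fourierCoeff f n = β⁻¹ • ∫ t, fourier (-n) t • f t := by
  rw [fourierCoeff, AddCircle.integral_haarAddCircle]

lemma fourierCoeff_congr_ae {f g : AddCircle β → ℂ} (h : f =ᵐ[volume] g) (n : ℤ) :
    fourierCoeff f n = fourierCoeff g n := by
  rw [fourierCoeff_eq_volume, fourierCoeff_eq_volume]
  congr 1
  refine integral_congr_ae ?_
  filter_upwards [h] with t ht
  rw [ht]

lemma invForm_smul (t : ℝ) (φ : LoopL2 β ν) : invForm m a (t • φ) = t ^ 2 * invForm m a φ := by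
  have h : ∀ (k : ℤ) (j : Fin ν),
      ‖fourierCoeff (fun τ : AddCircle β => (((t • φ) τ j : ℝ) : ℂ)) k‖ ^ 2 =
      t ^ 2 * ‖fourierCoeff (fun τ : AddCircle β => ((φ τ j : ℝ) : ℂ)) k‖ ^ 2 := by
    intro k j
    have e : (fun τ : AddCircle β => (((t • φ) τ j : ℝ) : ℂ)) =ᵐ[volume]
        fun τ : AddCircle β => (t : ℂ) • ((φ τ j : ℝ) : ℂ) := by
      filter_upwards [Lp.coeFn_smul t φ] with τ hτ
      rw [hτ]
      simp
    have e' := fourierCoeff.const_smul (fun τ : AddCircle β => ((φ τ j : ℝ) : ℂ)) (t : ℂ) k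
    rw [fourierCoeff_congr_ae e]
    refine (congrArg (fun z : ℂ => ‖z‖ ^ 2) e').trans ?_
    rw [norm_smul, mul_pow, Complex.norm_real, Real.norm_eq_abs, sq_abs]
  unfold invForm
  simp_rw [h, ← Finset.mul_sum]
  rw [show t ^ 2 * (β * ∑' k : ℤ, (eigenvalue m a β k)⁻¹ * ∑ j : Fin ν,
      ‖fourierCoeff (fun τ : AddCircle β => ((φ τ j : ℝ) : ℂ)) k‖ ^ 2) =
    β * (t ^ 2 * ∑' k : ℤ, (eigenvalue m a β k)⁻¹ * ∑ j : Fin ν,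
      ‖fourierCoeff (fun τ : AddCircle β => ((φ τ j : ℝ) : ℂ)) k‖ ^ 2) by ring]
  congr 1
  rw [← tsum_mul_left]
  exact tsum_congr fun k => by ring

lemma invForm_nonneg (hm : 0 < m) (ha : 0 < a) (φ : LoopL2 β ν) : 0 ≤ invForm m a φ := by
  have := hβ.out
  refine mul_nonneg this.le (tsum_nonneg fun k => ?_)
  have := eigenvalue_pos (β := β) hm ha k
  positivity

lemma IsOscillatorMeasure.lintegral_exp_inner_sq_le (hm : 0 < m) (ha : 0 < a)
    {χ : Measure (Loop β ν)} (hχ : IsOscillatorMeasure m a χ) (φ : LoopL2 β ν) {b : ℝ}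
    (hb : b * invForm m a φ ≤ 1 / 4) :
    ∫⁻ υ, ENNReal.ofReal (Real.exp (b * (inner ℝ φ (toL2 υ)) ^ 2)) ∂χ ≤ gaussConst := by
  have := hχ.1
  refine lintegral_exp_sq_le_of_charFun (Y := fun υ => inner ℝ φ (toL2 υ)) ?_
    (invForm_nonneg hm ha φ) (fun t => ?_) hb
  · exact (continuous_const.inner toL2.continuous).measurable
  · have := hχ.2 (t • φ)
    rw [invForm_smul] at this
    rw [← this]
    simp only [inner_smul_left, RCLike.conj_to_real]

/-- The volume of a ball of radius `h` in the circle. -/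
def ballVol (β h : ℝ) [Fact (0 < β)] : ℝ :=
  (volume : Measure (AddCircle β)).real (Metric.closedBall 0 h)

lemma volume_real_closedBall (τ : AddCircle β) (h : ℝ) :
    (volume : Measure (AddCircle β)).real (Metric.closedBall τ h) = ballVol β h := by
  unfold ballVol Measure.real
  rw [AddCircle.volume_closedBall, AddCircle.volume_closedBall]

lemma ballVol_pos {h : ℝ} (hh : 0 < h) : 0 < ballVol β h := by
  have := hβ.out
  unfold ballVol Measure.real
  rw [AddCircle.volume_closedBall, ENNReal.toReal_ofReal (by positivity)]
  positivity

/-- The normalized indicator of the ball of radius `h` around `τ` in the `j`-th coordinate, an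
approximation of the evaluation `υ ↦ υ_j(τ)`. -/
def bump (τ : AddCircle β) (h : ℝ) (j : Fin ν) : LoopL2 β ν :=
  indicatorConstLp 2 (Metric.isClosed_closedBall (x := τ) (ε := h)).measurableSet
    (measure_ne_top _ _) ((ballVol β h)⁻¹ • EuclideanSpace.single j (1 : ℝ))

lemma inner_bump (τ : AddCircle β) (h : ℝ) (j : Fin ν) (υ : Loop β ν) :
    inner ℝ (bump τ h j) (toL2 υ) = (ballVol β h)⁻¹ * ∫ t in Metric.closedBall τ h, υ t j := by
  unfold bump
  rw [L2.inner_indicatorConstLp_eq_setIntegral_inner, ← integral_const_mul]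
  refine integral_congr_ae (ae_restrict_of_ae ?_)
  filter_upwards [ContinuousMap.coeFn_toLp (p := 2) (𝕜 := ℝ) (volume : Measure (AddCircle β)) υ]
    with t ht
  have ht' : (toL2 υ : LoopL2 β ν) t = υ t := ht
  rw [ht', inner_smul_left]
  simp [EuclideanSpace.inner_single_left]

lemma tendsto_ball_average (τ : AddCircle β) {f : AddCircle β → ℝ} (hf : Continuous f) :
    Tendsto (fun n : ℕ => (ballVol β (1 / (n + 1 : ℝ)))⁻¹ *
      ∫ t in Metric.closedBall τ (1 / (n + 1 : ℝ)), f t) atTop (𝓝 (f τ)) := by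
  rw [Metric.tendsto_atTop]
  intro ε hε
  obtain ⟨δ, hδ, hδ'⟩ := Metric.continuous_iff.1 hf τ (ε / 2) (by positivity)
  obtain ⟨N, hN⟩ := exists_nat_one_div_lt hδ
  refine ⟨N, fun n hn => ?_⟩
  have hh : 0 < 1 / (n + 1 : ℝ) := by positivity
  have hhδ : 1 / (n + 1 : ℝ) < δ := by
    refine lt_of_le_of_lt ?_ hN
    gcongr
  set h := 1 / (n + 1 : ℝ)
  have hv := ballVol_pos (β := β) hh
  have hint : IntegrableOn f (Metric.closedBall τ h) volume :=
    (hf.integrable_of_hasCompactSupport (HasCompactSupport.of_compactSpace f)).integrableOn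
  have e : (ballVol β h)⁻¹ * (∫ t in Metric.closedBall τ h, f t) - f τ =
      (ballVol β h)⁻¹ * ∫ t in Metric.closedBall τ h, (f t - f τ) := by
    rw [integral_sub hint (integrable_const _), setIntegral_const, volume_real_closedBall,
      smul_eq_mul, mul_sub, inv_mul_cancel_left₀ hv.ne']
  rw [Real.dist_eq, e, abs_mul, abs_of_pos (inv_pos.2 hv)]
  have hb := norm_setIntegral_le_of_norm_le_const (μ := (volume : Measure (AddCircle β)))
    (s := Metric.closedBall τ h) (f := fun t => f t - f τ) (C := ε / 2) (measure_lt_top _ _)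
    (fun t ht => (hδ' t (lt_of_le_of_lt ht hhδ)).le)
  rw [volume_real_closedBall, Real.norm_eq_abs] at hb
  calc _ ≤ (ballVol β h)⁻¹ * (ε / 2 * ballVol β h) := by gcongr
    _ = ε / 2 := by field_simp
    _ < ε := by linarith

lemma setIntegral_closedBall_fourier (k : ℤ) (τ : AddCircle β) (h : ℝ) :
    ∫ t in Metric.closedBall τ h, fourier k t =
      fourier k τ * ∫ t in Metric.closedBall (0 : AddCircle β) h, fourier k t := by
  rw [← integral_indicator measurableSet_closedBall, ← integral_indicator measurableSet_closedBall,
    ← integral_add_left_eq_self _ τ, ← integral_const_mul]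
  congr 1
  ext t
  have : τ + t ∈ Metric.closedBall τ h ↔ t ∈ Metric.closedBall 0 h := by
    simp [Metric.mem_closedBall, dist_eq_norm]
  by_cases ht : t ∈ Metric.closedBall 0 h
  · rw [Set.indicator_of_mem ht, Set.indicator_of_mem (this.2 ht)]
    simp [fourier_apply, smul_add, AddCircle.toCircle_add]
  · rw [Set.indicator_of_notMem ht, Set.indicator_of_notMem (fun h' => ht (this.1 h')), mul_zero]

lemma coeFn_bump_sub (τ τ' : AddCircle β) (y h : ℝ) (j i : Fin ν) :
    (fun t => (((bump τ h j - y • bump τ' h j : LoopL2 β ν) t i : ℝ) : ℂ)) =ᵐ[volume]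
    fun t => if i = j then ((ballVol β h)⁻¹ : ℂ) * ((Metric.closedBall τ h).indicator 1 t -
      y * (Metric.closedBall τ' h).indicator 1 t) else 0 := by
  have h1 : bump τ h j =ᵐ[volume] _ := indicatorConstLp_coeFn
  have h2 : bump τ' h j =ᵐ[volume] _ := indicatorConstLp_coeFn
  filter_upwards [Lp.coeFn_sub (bump τ h j) (y • bump τ' h j), Lp.coeFn_smul y (bump τ' h j), h1, h2]
    with t h3 h4 h5 h6
  rw [h3, Pi.sub_apply, h4, Pi.smul_apply, h5, h6]
  by_cases hij : i = j <;> by_cases hτ : t ∈ Metric.closedBall τ h <;>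
    by_cases hτ' : t ∈ Metric.closedBall τ' h <;>
    simp [Set.indicator, hij, hτ, hτ'] <;> ring

lemma norm_fourierCoeff_bump_le (τ τ' : AddCircle β) (y : ℝ) {h : ℝ} (hh : 0 < h) (j i : Fin ν)
    (k : ℤ) :
    ‖fourierCoeff (fun t : AddCircle β =>
      (((bump τ h j - y • bump τ' h j : LoopL2 β ν) t i : ℝ) : ℂ)) k‖ ≤
      if i = j then β⁻¹ * ‖fourier k τ - y * fourier k τ'‖ else 0 := by
  have hβ0 := hβ.out
  have hv := ballVol_pos (β := β) hh
  rw [fourierCoeff_congr_ae (coeFn_bump_sub τ τ' y h j i), fourierCoeff_eq_volume]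
  by_cases hij : i = j
  swap
  · simp [hij]
  simp only [hij, if_true]
  have hint : ∀ τ : AddCircle β, Integrable (fun t => (Metric.closedBall τ h).indicator
      (fun t => fourier (-k) t) t) (volume : Measure (AddCircle β)) := by
    intro τ
    refine Integrable.indicator ?_ measurableSet_closedBall
    exact (fourier (-k)).continuous.integrable_of_hasCompactSupport
      (HasCompactSupport.of_compactSpace _)
  have e : ∀ t : AddCircle β, fourier (-k) t • (((ballVol β h)⁻¹ : ℂ) *
      ((Metric.closedBall τ h).indicator 1 t - y * (Metric.closedBall τ' h).indicator 1 t)) =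
      ((ballVol β h)⁻¹ : ℂ) * ((Metric.closedBall τ h).indicator (fun t => fourier (-k) t) t -
      y * (Metric.closedBall τ' h).indicator (fun t => fourier (-k) t) t) := by
    intro t
    by_cases hτ : t ∈ Metric.closedBall τ h <;> by_cases hτ' : t ∈ Metric.closedBall τ' h <;>
    simp [Set.indicator, hτ, hτ'] <;> ring
  simp_rw [e]
  rw [integral_const_mul, integral_sub (hint τ) ((hint τ').const_mul _), integral_const_mul,
    integral_indicator measurableSet_closedBall, integral_indicator measurableSet_closedBall,
    setIntegral_closedBall_fourier, setIntegral_closedBall_fourier (τ := τ')]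
  set I := ∫ t in Metric.closedBall (0 : AddCircle β) h, fourier (-k) t with hI
  have hIle : ‖I‖ ≤ ballVol β h := by
    have := norm_setIntegral_le_of_norm_le_const (μ := (volume : Measure (AddCircle β)))
      (s := Metric.closedBall 0 h) (f := fun t => fourier (-k) t) (C := 1) (measure_lt_top _ _)
      (fun t _ => (norm_fourier_apply (-k) t).le)
    rwa [one_mul] at this
  have e2 : fourier (-k) τ * I - y * (fourier (-k) τ' * I) =
      (starRingEnd ℂ) (fourier k τ - y * fourier k τ') * I := by
    rw [fourier_neg, fourier_neg, map_sub, map_mul, Complex.conj_ofReal]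
    ring
  rw [e2, norm_smul, norm_mul, norm_mul, RCLike.norm_conj, norm_inv, norm_inv,
    Complex.norm_real, Real.norm_of_nonneg hv.le, Real.norm_of_nonneg hβ0.le]
  gcongr
  calc _ ≤ (ballVol β h)⁻¹ * (‖fourier k τ - y * fourier k τ'‖ * ballVol β h) := by gcongr
    _ = _ := by field_simp

lemma invForm_bump_le (hm : 0 < m) (ha : 0 < a) (τ τ' : AddCircle β) (y : ℝ) {h : ℝ} (hh : 0 < h)
    (j : Fin ν) :
    invForm m a (bump τ h j - y • bump τ' h j : LoopL2 β ν) ≤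
      pairVar m a β Set.univ τ τ' y := by
  have hβ0 := hβ.out
  have hterm : ∀ k : ℤ, β * ((eigenvalue m a β k)⁻¹ * ∑ i : Fin ν, ‖fourierCoeff
      (fun t : AddCircle β => (((bump τ h j - y • bump τ' h j : LoopL2 β ν) t i : ℝ) : ℂ)) k‖ ^ 2)
      ≤ Set.univ.indicator (fun k => (β * eigenvalue m a β k)⁻¹ *
      ‖fourier k τ - y * fourier k τ'‖ ^ 2) k := by
    intro k
    have hpos := eigenvalue_pos (β := β) hm ha k
    rw [Set.indicator_of_mem (Set.mem_univ k)]
    have : ∑ i : Fin ν, ‖fourierCoeff (fun t : AddCircle β =>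
        (((bump τ h j - y • bump τ' h j : LoopL2 β ν) t i : ℝ) : ℂ)) k‖ ^ 2 ≤
        ∑ i : Fin ν, if i = j then (β⁻¹ * ‖fourier k τ - y * fourier k τ'‖) ^ 2 else 0 := by
      refine Finset.sum_le_sum fun i _ => ?_
      have := norm_fourierCoeff_bump_le τ τ' y hh j i k
      split_ifs with hij
      · rw [if_pos hij] at this
        gcongr
      · rw [if_neg hij] at this
        rw [le_antisymm this (norm_nonneg _)]
        simp
    rw [Finset.sum_ite_eq' Finset.univ j, if_pos (Finset.mem_univ j)] at this
    calc _ ≤ β * ((eigenvalue m a β k)⁻¹ * (β⁻¹ * ‖fourier k τ - y * fourier k τ'‖) ^ 2) := by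
          gcongr
      _ = _ := by
          rw [mul_inv]
          field_simp
  unfold invForm pairVar
  rw [← tsum_mul_left]
  refine Summable.tsum_le_tsum hterm ?_ (summable_pairVar hm ha hβ0 _ τ τ' y)
  refine Summable.of_nonneg_of_le (fun k => ?_) hterm (summable_pairVar hm ha hβ0 _ τ τ' y)
  have hpos := eigenvalue_pos (β := β) hm ha k
  positivity

/-- The finite-dimensional Gaussian bounds of the oscillator measure, obtained from its Fourier
transform by mollifying point evaluations. -/
lemma IsOscillatorMeasure.lintegral_exp_pair_le (hm : 0 < m) (ha : 0 < a)
    {χ : Measure (Loop β ν)} (hχ : IsOscillatorMeasure m a χ) (τ τ' : AddCircle β) (y : ℝ)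
    (j : Fin ν) {b : ℝ} (hb0 : 0 ≤ b) (hb : b * pairVar m a β Set.univ τ τ' y ≤ 1 / 4) :
    ∫⁻ υ, ENNReal.ofReal (Real.exp (b * (υ τ j - y * υ τ' j) ^ 2)) ∂χ ≤ gaussConst := by
  set φ : ℕ → LoopL2 β ν := fun n =>
    bump τ (1 / (n + 1 : ℝ)) j - y • bump τ' (1 / (n + 1 : ℝ)) j with hφ
  have hlim : ∀ υ : Loop β ν, Tendsto (fun n => inner ℝ (φ n) (toL2 υ)) atTop
      (𝓝 (υ τ j - y * υ τ' j)) := by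
    intro υ
    have e : ∀ n, inner ℝ (φ n) (toL2 υ) = (ballVol β (1 / (n + 1 : ℝ)))⁻¹ *
      (∫ t in Metric.closedBall τ (1 / (n + 1 : ℝ)), υ t j) - y *
      ((ballVol β (1 / (n + 1 : ℝ)))⁻¹ * ∫ t in Metric.closedBall τ' (1 / (n + 1 : ℝ)), υ t j) := by
      intro n
      rw [hφ, inner_sub_left, inner_smul_left, inner_bump, inner_bump]
      simp
    simp_rw [e]
    have hc : Continuous fun t => υ t j := by fun_prop
    exact (tendsto_ball_average τ hc).sub ((tendsto_ball_average τ' hc).const_mul y)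
  have hle : ∀ n, ∫⁻ υ, ENNReal.ofReal (Real.exp (b * (inner ℝ (φ n) (toL2 υ)) ^ 2)) ∂χ ≤
      gaussConst := by
    intro n
    refine hχ.lintegral_exp_inner_sq_le hm ha _ (le_trans ?_ hb)
    gcongr
    exact invForm_bump_le hm ha τ τ' y (by positivity) j
  calc _ = ∫⁻ υ, liminf (fun n => ENNReal.ofReal (Real.exp (b * (inner ℝ (φ n) (toL2 υ)) ^ 2)))
        atTop ∂χ := by
        refine lintegral_congr fun υ => (Tendsto.liminf_eq ?_).symm
        exact ENNReal.tendsto_ofReal ((Real.continuous_exp.tendsto _).comp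
          (((hlim υ).pow 2).const_mul b))
    _ ≤ liminf (fun n => ∫⁻ υ, ENNReal.ofReal (Real.exp (b * (inner ℝ (φ n) (toL2 υ)) ^ 2)) ∂χ)
        atTop := by
        refine lintegral_liminf_le fun n => ENNReal.measurable_ofReal.comp ?_
        exact (Real.continuous_exp.comp (continuous_const.mul
          ((continuous_const.inner toL2.continuous).pow 2))).measurable
    _ ≤ gaussConst := by
        refine liminf_le_of_le (by isBoundedDefault) fun b hb => ?_
        obtain ⟨n, hn⟩ := hb.exists
        exact hn.trans (hle n)

/-- A measure with the Fourier transform of the oscillator measure has square-exponential moments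
of the `σ`-Hölder norm for every `σ < 1/2`. -/
theorem IsOscillatorMeasure.exists_exp_holder (hm : 0 < m) (ha : 0 < a) (hν : 0 < ν)
    {χ : Measure (Loop β ν)} (hχ : IsOscillatorMeasure m a χ) {σ : ℝ≥0} (hσ₀ : 0 < σ)
    (hσ : σ < 1 / 2) :
    ∃ c : ℝ, 0 < c ∧
      ∫⁻ υ, EReal.exp ((ENNReal.ofReal c * holderENorm σ υ ^ 2 : ℝ≥0∞) : EReal) ∂χ < ⊤ := by
  have hβ0 := hβ.out
  have hσ' : (σ : ℝ) < 1 / 2 := by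
    have : (σ : ℝ) < ((1 / 2 : ℝ≥0) : ℝ) := by exact_mod_cast hσ
    simpa using this
  obtain ⟨s, hs1, hs2⟩ := exists_between hσ'
  have hs0 : 0 ≤ s := le_trans σ.coe_nonneg hs1.le
  have hV0 : 0 ≤ modeConst m a β s Set.univ :=
    add_nonneg (modeConst_parts_nonneg hm ha hβ0 s _).1 (modeConst_parts_nonneg hm ha hβ0 s _).2
  obtain ⟨c, hc, K', hK', h⟩ := exists_lintegral_exp_holder_le_of_gaussian β hν hσ₀ hs1
    (V := modeConst m a β s Set.univ + 1) (by linarith)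
  have := hχ.1
  refine ⟨c, hc, lt_of_le_of_lt (h χ id measurable_id fun τ τ' y j =>
    ⟨pairVar m a β Set.univ τ τ' y, ?_, ?_, fun b hb hbv =>
      hχ.lintegral_exp_pair_le hm ha τ τ' y j hb hbv⟩) hK'⟩
  · rintro rfl
    refine (pairVar_one_le hm ha hs0 hs2 _ τ τ').trans ?_
    gcongr
    linarith
  · rintro rfl
    exact (pairVar_zero_le hβ0 hm ha s _ τ τ').trans (by linarith)

end oscillator

/-! ### Existence of the oscillator measure -/

section existence

/-- The real part (`true`) or the imaginary part (`false`) of a complex number. -/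
def reIm (b : Bool) : ℂ →L[ℝ] ℝ := if b then Complex.reCLM else Complex.imCLM

lemma sum_reIm_sq (z : ℂ) : ∑ b : Bool, reIm b z ^ 2 = ‖z‖ ^ 2 := by
  rw [Fintype.sum_bool, Complex.sq_norm, Complex.normSq_apply]
  simp [reIm]
  ring

variable {m a β : ℝ} [hβ : Fact (0 < β)] {ν : ℕ}

/-- The modes of the random Fourier series: the real and imaginary parts of the `k`-th character in
the `j`-th coordinate, scaled by `(β λ_k)^{-1/2}`. -/
def modeLoop (m a β : ℝ) [Fact (0 < β)] {ν : ℕ} (p : ℤ × Fin ν × Bool) : Loop β ν :=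
  ⟨fun τ => ((Real.sqrt (β * eigenvalue m a β p.1))⁻¹ * reIm p.2.2 (fourier p.1 τ)) •
    EuclideanSpace.single p.2.1 (1 : ℝ), by fun_prop⟩

lemma modeLoop_apply (p : ℤ × Fin ν × Bool) (τ : AddCircle β) (i : Fin ν) :
    modeLoop m a β p τ i = if i = p.2.1 then
      (Real.sqrt (β * eigenvalue m a β p.1))⁻¹ * reIm p.2.2 (fourier p.1 τ) else 0 := by
  simp [modeLoop]

/-- The law of a family of independent standard normal variables indexed by the modes. -/
def noise (ν : ℕ) : Measure (ℤ × Fin ν × Bool → ℝ) :=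
  Measure.infinitePi fun _ => ProbabilityTheory.gaussianReal 0 1

instance : IsProbabilityMeasure (noise ν) := by unfold noise; infer_instance

/-- The contribution of the wave number `k` to the random Fourier series. -/
def modeTerm (m a β : ℝ) [Fact (0 < β)] {ν : ℕ} (k : ℤ) (g : ℤ × Fin ν × Bool → ℝ) : Loop β ν :=
  ∑ i : Fin ν × Bool, g (k, i) • modeLoop m a β (k, i)

lemma measurable_modeTerm (k : ℤ) :
    Measurable (modeTerm m a β k : (ℤ × Fin ν × Bool → ℝ) → Loop β ν) :=
  Finset.measurable_sum _ fun i _ => (measurable_pi_apply (k, i)).smul_const _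

lemma measurable_sum_modeTerm (F : Finset ℤ) :
    Measurable fun g : ℤ × Fin ν × Bool → ℝ => ∑ k ∈ F, modeTerm m a β k g :=
  Finset.measurable_sum _ fun k _ => measurable_modeTerm k

/-- The characteristic function of a linear functional of a partial sum. -/
lemma integral_exp_sum_modeTerm (F : Finset ℤ) (L : Loop β ν →ₗ[ℝ] ℝ) (t : ℝ) :
    ∫ g, Complex.exp (Complex.I * ((t * L (∑ k ∈ F, modeTerm m a β k g) : ℝ) : ℂ)) ∂(noise ν) =
      Complex.exp (((-(1 / 2) * (t ^ 2 * ∑ k ∈ F, ∑ i : Fin ν × Bool,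
        L (modeLoop m a β (k, i)) ^ 2) : ℝ)) : ℂ) := by
  set T : Finset (ℤ × Fin ν × Bool) := F ×ˢ Finset.univ with hT
  set c : ℤ × Fin ν × Bool → ℝ := fun p => L (modeLoop m a β p) with hc
  have hL : ∀ g : ℤ × Fin ν × Bool → ℝ, L (∑ k ∈ F, modeTerm m a β k g) =
      ∑ p ∈ T, g p * c p := by
    intro g
    rw [hT, Finset.sum_product, map_sum]
    refine Finset.sum_congr rfl fun k _ => ?_
    rw [modeTerm, map_sum]
    refine Finset.sum_congr rfl fun i _ => ?_
    rw [map_smul, smul_eq_mul]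
  have hmeas : ∀ p, Measurable fun g : ℤ × Fin ν × Bool → ℝ => g p * c p := fun p =>
    (measurable_pi_apply p).mul_const _
  have hind : ProbabilityTheory.iIndepFun
      (fun p (g : ℤ × Fin ν × Bool → ℝ) => g p * c p) (noise ν) :=
    ProbabilityTheory.iIndepFun_infinitePi (X := fun p (x : ℝ) => x * c p)
      (fun p => measurable_id.mul_const _)
  have hmap : ∀ p, (noise ν).map (fun g => g p * c p) =
      ProbabilityTheory.gaussianReal 0 (NNReal.mk (c p ^ 2) (sq_nonneg _) * 1) := by
    intro p
    have h1 := Measure.map_map (μ := noise ν) (g := fun x : ℝ => x * c p)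
      (f := fun g : ℤ × Fin ν × Bool → ℝ => g p) (measurable_id.mul_const _) (measurable_pi_apply p)
    have h2 : (noise ν).map (fun g => g p) = ProbabilityTheory.gaussianReal 0 1 :=
      Measure.infinitePi_map_eval _ p
    rw [h2, ProbabilityTheory.gaussianReal_map_mul_const, mul_zero] at h1
    exact h1.symm
  have hind' : ProbabilityTheory.iIndepFun
      (T.restrict fun p (g : ℤ × Fin ν × Bool → ℝ) => g p * c p) (noise ν) :=
    hind.precomp (g := fun x : T => (x : ℤ × Fin ν × Bool)) Subtype.val_injective
  have key := hind'.charFun_map_fun_finsetSum_eq_prod (fun p _ => (hmeas p).aemeasurable)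
  have key' := congrFun key t
  rw [charFun_apply_real, integral_map
    (Finset.measurable_sum _ fun p _ => hmeas p).aemeasurable (by fun_prop)] at key'
  have e : ∀ g : ℤ × Fin ν × Bool → ℝ,
      Complex.exp (Complex.I * ((t * L (∑ k ∈ F, modeTerm m a β k g) : ℝ) : ℂ)) =
      Complex.exp (t * ((∑ p ∈ T, g p * c p : ℝ) : ℂ) * Complex.I) := by
    intro g
    rw [hL]
    congr 1
    push_cast
    ring
  simp_rw [e]
  rw [key', Finset.prod_apply]
  simp_rw [hmap, ProbabilityTheory.charFun_gaussianReal]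
  rw [← Complex.exp_sum, ← Finset.sum_product' F Finset.univ fun k i => c (k, i) ^ 2, ← hT]
  congr 1
  push_cast
  rw [Finset.mul_sum, Finset.mul_sum]
  refine Finset.sum_congr rfl fun p _ => ?_
  simp
  ring

/-- The increment functional `ω ↦ ω_j(τ) - y ω_j(τ')`. -/
def pairEval (τ τ' : AddCircle β) (y : ℝ) (j : Fin ν) : Loop β ν →ₗ[ℝ] ℝ where
  toFun ω := ω τ j - y * ω τ' j
  map_add' ω ω' := by simp; ring
  map_smul' c ω := by simp; ring

lemma sum_pairEval_modeLoop (hm : 0 < m) (ha : 0 < a) (F : Finset ℤ) (τ τ' : AddCircle β) (y : ℝ)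
    (j : Fin ν) : ∑ k ∈ F, ∑ i : Fin ν × Bool, pairEval τ τ' y j (modeLoop m a β (k, i)) ^ 2 =
      pairVar m a β F τ τ' y := by
  unfold pairVar
  rw [tsum_eq_sum (s := F) (fun k hk => Set.indicator_of_notMem (by simpa using hk) _)]
  refine Finset.sum_congr rfl fun k hk => ?_
  have hpos := eigenvalue_pos (β := β) hm ha k
  have hβ0 := hβ.out
  rw [Set.indicator_of_mem (by simpa using hk), Fintype.sum_prod_type, Finset.sum_eq_single j]
  · have e : ∀ b : Bool, pairEval τ τ' y j (modeLoop m a β (k, j, b)) =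
        (Real.sqrt (β * eigenvalue m a β k))⁻¹ * reIm b (fourier k τ - y * fourier k τ') := by
      intro b
      change modeLoop m a β (k, j, b) τ j - y * modeLoop m a β (k, j, b) τ' j = _
      rw [modeLoop_apply, modeLoop_apply, map_sub, ← Complex.real_smul, map_smul]
      simp only [if_true, smul_eq_mul]
      ring
    simp_rw [e, mul_pow, ← Finset.mul_sum, sum_reIm_sq]
    rw [inv_pow, Real.sq_sqrt (by positivity)]
  · intro i _ hi
    refine Finset.sum_eq_zero fun b _ => ?_
    change (modeLoop m a β (k, i, b) τ j - y * modeLoop m a β (k, i, b) τ' j) ^ 2 = _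
    rw [modeLoop_apply, modeLoop_apply]
    simp [hi.symm]
  · simp

lemma modeConst_nonneg (hm : 0 < m) (ha : 0 < a) (s : ℝ) (S : Set ℤ) :
    0 ≤ modeConst m a β s S :=
  add_nonneg (modeConst_parts_nonneg hm ha hβ.out s _).1 (modeConst_parts_nonneg hm ha hβ.out s _).2

/-- The expected supremum norm of a partial sum of the random Fourier series is controlled by the
covariance constant of its modes. As that constant is a convergent sum over the modes, this is the
Cauchy criterion for the series. -/
lemma exists_lintegral_sum_modeTerm_le (hm : 0 < m) (ha : 0 < a) (hν : 0 < ν) {s : ℝ} (hs0 : 0 < s)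
    (hs1 : s < 1 / 2) : ∃ C : ℝ, 0 < C ∧ ∀ (F : Finset ℤ) (V : ℝ), 0 < V →
      modeConst m a β s F ≤ V →
      ∫⁻ g, ‖∑ k ∈ F, (modeTerm m a β k g : Loop β ν)‖ₑ ∂(noise ν) ≤
        ENNReal.ofReal (Real.sqrt V * C) := by
  obtain ⟨σ, hσ0, hσs⟩ := exists_between hs0
  lift σ to ℝ≥0 using hσ0.le
  obtain ⟨c, hc, K', hK', h⟩ := exists_lintegral_exp_holder_le_of_gaussian β hν (σ := σ)
    (by exact_mod_cast hσ0) hσs (V := 1) one_pos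
  refine ⟨1 + c⁻¹ * K'.toReal, by positivity, fun F V hV hFV => ?_⟩
  set X : (ℤ × Fin ν × Bool → ℝ) → Loop β ν := fun g => ∑ k ∈ F, modeTerm m a β k g with hX
  have hXm : Measurable X := measurable_sum_modeTerm F
  set r := Real.sqrt V with hr
  have hr0 : 0 < r := Real.sqrt_pos.2 hV
  have hrV : r ^ 2 = V := Real.sq_sqrt hV.le
  -- The rescaled sum has increments of variance at most `|τ - τ'|^{2s}`, uniformly in `F`.
  have hb := h (noise ν) (fun g => r⁻¹ • X g)
    ((continuous_const_smul r⁻¹).measurable.comp hXm) fun τ τ' y j => by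
    refine ⟨V⁻¹ * pairVar m a β F τ τ' y, ?_, ?_, fun b hb hbv => ?_⟩
    · rintro rfl
      have h1 := pairVar_one_le hm ha hs0.le hs1 (F : Set ℤ) τ τ'
      calc _ ≤ V⁻¹ * (V * dist τ τ' ^ (2 * s)) := by
            refine mul_le_mul_of_nonneg_left (h1.trans ?_) (by positivity)
            gcongr
        _ = _ := by field_simp
    · rintro rfl
      have h1 := pairVar_zero_le hβ.out hm ha s (F : Set ℤ) τ τ'
      calc _ ≤ V⁻¹ * V := by gcongr; exact h1.trans hFV
        _ = _ := by field_simp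
    · have hm' : Measurable fun g => pairEval τ τ' y j (X g) := by
        have : Measurable fun ω : Loop β ν => ω τ j - y * ω τ' j :=
          Continuous.measurable (by fun_prop)
        exact this.comp hXm
      have h2 := lintegral_exp_sq_le_of_charFun (P := noise ν) (b := b * V⁻¹) hm'
        (v := pairVar m a β F τ τ' y) ?_ (fun t => ?_) (by rw [mul_assoc]; exact hbv)
      · refine le_trans (le_of_eq (lintegral_congr fun g => ?_)) h2
        congr 2
        change b * (r⁻¹ * X g τ j - y * (r⁻¹ * X g τ' j)) ^ 2 =
          b * V⁻¹ * (X g τ j - y * X g τ' j) ^ 2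
        rw [← hrV]
        ring
      · exact tsum_nonneg fun k => pairVar_term_nonneg hm ha hβ.out _ τ τ' y k
      · rw [integral_exp_sum_modeTerm, sum_pairEval_modeLoop hm ha]
  have hpt : ∀ g, ‖X g‖ₑ ≤ ENNReal.ofReal r * (1 + ENNReal.ofReal c⁻¹ *
      EReal.exp ((ENNReal.ofReal c * holderENorm σ (r⁻¹ • X g) ^ 2 : ℝ≥0∞) : EReal)) := by
    intro g
    set x := ‖r⁻¹ • X g‖ with hx
    have hx0 : 0 ≤ x := norm_nonneg _
    have e1 : ‖X g‖ₑ = ENNReal.ofReal r * ENNReal.ofReal x := by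
      rw [← ENNReal.ofReal_mul hr0.le, hx, norm_smul, ← ofReal_norm]
      congr 1
      rw [norm_inv, Real.norm_of_nonneg hr0.le, mul_inv_cancel_left₀ hr0.ne']
    have e2 : ENNReal.ofReal (Real.exp (c * x ^ 2)) ≤
        EReal.exp ((ENNReal.ofReal c * holderENorm σ (r⁻¹ • X g) ^ 2 : ℝ≥0∞) : EReal) := by
      rw [← exp_coe_ofReal (by positivity)]
      apply EReal.exp_monotone
      rw [EReal.coe_ennreal_le_coe_ennreal_iff, ENNReal.ofReal_mul hc.le, ENNReal.ofReal_pow hx0]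
      gcongr
      rw [hx, ofReal_norm]
      exact le_self_add
    rw [e1]
    gcongr
    refine le_trans ?_ (add_le_add_right (mul_le_mul_right e2 _) 1)
    rw [← ENNReal.ofReal_mul (by positivity), ← ENNReal.ofReal_one,
      ← ENNReal.ofReal_add zero_le_one (by positivity)]
    refine ENNReal.ofReal_le_ofReal ?_
    have h3 : c * x ^ 2 ≤ Real.exp (c * x ^ 2) := by
      linarith [Real.add_one_le_exp (c * x ^ 2)]
    have h4 : x ^ 2 ≤ c⁻¹ * Real.exp (c * x ^ 2) := by
      rw [inv_mul_eq_div, le_div_iff₀ hc]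
      linarith
    nlinarith [sq_nonneg (x - 1)]
  calc _ ≤ ∫⁻ g, ENNReal.ofReal r * (1 + ENNReal.ofReal c⁻¹ *
      EReal.exp ((ENNReal.ofReal c * holderENorm σ (r⁻¹ • X g) ^ 2 : ℝ≥0∞) : EReal)) ∂(noise ν) :=
        lintegral_mono hpt
    _ = ENNReal.ofReal r * (1 + ENNReal.ofReal c⁻¹ * ∫⁻ g,
      EReal.exp ((ENNReal.ofReal c * holderENorm σ (r⁻¹ • X g) ^ 2 : ℝ≥0∞) : EReal) ∂(noise ν)) := by
        rw [lintegral_const_mul' _ _ ENNReal.ofReal_ne_top, lintegral_add_left measurable_const,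
          lintegral_const_mul' _ _ ENNReal.ofReal_ne_top, lintegral_const, measure_univ, mul_one]
    _ ≤ ENNReal.ofReal r * (1 + ENNReal.ofReal c⁻¹ * K') := by gcongr
    _ = _ := by
        rw [ENNReal.ofReal_mul hr0.le, ENNReal.ofReal_add zero_le_one (by positivity),
          ENNReal.ofReal_one, ENNReal.ofReal_mul (by positivity), ENNReal.ofReal_toReal hK'.ne]

lemma modeConst_coe {m a β : ℝ} (s : ℝ) (F : Finset ℤ) :
    modeConst m a β s F = ∑ k ∈ F, (4 * (2 * Real.pi / β) ^ (2 * s) * β⁻¹ *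
      ((eigenvalue m a β k)⁻¹ * |(k : ℝ)| ^ (2 * s)) + β⁻¹ * (eigenvalue m a β k)⁻¹) := by
  have h : ∀ f : ℤ → ℝ, ∑' k : ℤ, (F : Set ℤ).indicator f k = ∑ k ∈ F, f k := by
    intro f
    rw [tsum_eq_sum (s := F) (fun k hk => Set.indicator_of_notMem (by simpa using hk) _)]
    exact Finset.sum_congr rfl fun k hk => Set.indicator_of_mem (by simpa using hk) _
  rw [modeConst, h, h, Finset.sum_add_distrib, Finset.mul_sum, Finset.mul_sum]

lemma integrable_modeTerm (hm : 0 < m) (ha : 0 < a) (hν : 0 < ν) (k : ℤ) :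
    Integrable (modeTerm m a β k : (ℤ × Fin ν × Bool → ℝ) → Loop β ν) (noise ν) := by
  obtain ⟨C, -, h⟩ := exists_lintegral_sum_modeTerm_le (β := β) hm ha hν (s := 1 / 4)
    (by norm_num) (by norm_num)
  refine ⟨(measurable_modeTerm k).aestronglyMeasurable, ?_⟩
  have := h {k} (modeConst m a β (1 / 4) (({k} : Finset ℤ) : Set ℤ) + 1)
    (by linarith [modeConst_nonneg (β := β) hm ha (1 / 4) (({k} : Finset ℤ) : Set ℤ)])
    (by linarith)
  simp only [Finset.sum_singleton] at this
  exact lt_of_le_of_lt this ENNReal.ofReal_lt_top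

lemma sum_toL1_modeTerm (hm : 0 < m) (ha : 0 < a) (hν : 0 < ν) (F : Finset ℤ) :
    (∑ k ∈ F, (integrable_modeTerm (β := β) hm ha hν k).toL1 _ :
      Lp (Loop β ν) 1 (noise ν)) =ᵐ[noise ν] fun g => ∑ k ∈ F, modeTerm m a β k g := by
  classical
  induction F using Finset.induction_on with
  | empty =>
    simp only [Finset.sum_empty]
    exact Lp.coeFn_zero _ _ _
  | insert k F hk ih =>
    rw [Finset.sum_insert hk]
    filter_upwards [Lp.coeFn_add ((integrable_modeTerm (β := β) hm ha hν k).toL1 _)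
      (∑ k ∈ F, (integrable_modeTerm (β := β) hm ha hν k).toL1 _), ih,
      (integrable_modeTerm (β := β) hm ha hν k).coeFn_toL1] with g h1 h2 h3
    rw [h1, Pi.add_apply, h2, h3, Finset.sum_insert hk]

lemma norm_sum_toL1_modeTerm (hm : 0 < m) (ha : 0 < a) (hν : 0 < ν) (F : Finset ℤ) :
    ENNReal.ofReal ‖(∑ k ∈ F, (integrable_modeTerm (β := β) hm ha hν k).toL1 _ :
      Lp (Loop β ν) 1 (noise ν))‖ =
      ∫⁻ g, ‖∑ k ∈ F, (modeTerm m a β k g : Loop β ν)‖ₑ ∂(noise ν) := by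
  rw [ofReal_norm, Lp.enorm_def, eLpNorm_one_eq_lintegral_enorm]
  refine lintegral_congr_ae ?_
  filter_upwards [sum_toL1_modeTerm (β := β) hm ha hν F] with g hg
  rw [hg]

/-- The random Fourier series converges in mean, uniformly on the circle. -/
lemma summable_toL1_modeTerm (hm : 0 < m) (ha : 0 < a) (hν : 0 < ν) :
    Summable fun k : ℤ => ((integrable_modeTerm (β := β) hm ha hν k).toL1 _ :
      Lp (Loop β ν) 1 (noise ν)) := by
  obtain ⟨C, hC, h⟩ := exists_lintegral_sum_modeTerm_le (β := β) hm ha hν (s := 1 / 4)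
    (by norm_num) (by norm_num)
  rw [summable_iff_vanishing_norm]
  intro ε hε
  have hsum := ((summable_inv_eigenvalue_mul_rpow hm ha hβ.out (s := 1 / 4) (by norm_num)).mul_left
    (4 * (2 * Real.pi / β) ^ (2 * (1 / 4 : ℝ)) * β⁻¹)).add
    ((summable_inv_eigenvalue hm ha hβ.out).mul_left β⁻¹)
  obtain ⟨F₀, hF₀⟩ := summable_iff_vanishing_norm.1 hsum ((ε / (2 * C)) ^ 2) (by positivity)
  refine ⟨F₀, fun F hF => ?_⟩
  have h1 : modeConst m a β (1 / 4) (F : Set ℤ) ≤ (ε / (2 * C)) ^ 2 := by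
    rw [modeConst_coe]
    exact (le_abs_self _).trans (hF₀ F hF).le
  have h2 := h F _ (by positivity) h1
  rw [← norm_sum_toL1_modeTerm hm ha hν, Real.sqrt_sq (by positivity),
    ENNReal.ofReal_le_ofReal_iff (by positivity)] at h2
  refine lt_of_le_of_lt h2 ?_
  rw [div_mul_eq_mul_div, div_lt_iff₀ (by positivity)]
  nlinarith [mul_pos hε hC]

lemma inner_toL2_modeLoop (φ : LoopL2 β ν) (k : ℤ) (j : Fin ν) (b : Bool) :
    inner ℝ φ (toL2 (modeLoop m a β (k, j, b))) =
      (Real.sqrt (β * eigenvalue m a β k))⁻¹ *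
        ∫ t : AddCircle β, φ t j * reIm b (fourier k t) := by
  rw [L2.inner_def, ← integral_const_mul]
  refine integral_congr_ae ?_
  filter_upwards [ContinuousMap.coeFn_toLp (p := 2) (𝕜 := ℝ) (volume : Measure (AddCircle β))
    (modeLoop m a β (k, j, b))] with t ht
  have ht' : (toL2 (modeLoop m a β (k, j, b)) : LoopL2 β ν) t = modeLoop m a β (k, j, b) t := ht
  rw [ht']
  change inner ℝ (φ t) (((Real.sqrt (β * eigenvalue m a β k))⁻¹ * reIm b (fourier k t)) •
    EuclideanSpace.single j (1 : ℝ)) = _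
  rw [inner_smul_right, EuclideanSpace.inner_single_right]
  simp
  ring

lemma integrable_coord (φ : LoopL2 β ν) (j : Fin ν) :
    Integrable (fun t => φ t j) (volume : Measure (AddCircle β)) := by
  have h : Integrable (fun t => φ t) (volume : Measure (AddCircle β)) :=
    (Lp.memLp φ).integrable (by norm_num)
  exact (EuclideanSpace.proj (𝕜 := ℝ) j).integrable_comp h

lemma sum_integral_reIm_sq (φ : LoopL2 β ν) (k : ℤ) (j : Fin ν) :
    ∑ b : Bool, (∫ t : AddCircle β, φ t j * reIm b (fourier k t)) ^ 2 =
      β ^ 2 * ‖fourierCoeff (fun t : AddCircle β => ((φ t j : ℝ) : ℂ)) k‖ ^ 2 := by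
  have hint : Integrable (fun t => ((φ t j : ℝ) : ℂ) * fourier k t)
      (volume : Measure (AddCircle β)) := by
    refine (integrable_coord φ j).ofReal.mul_bdd (c := 1)
      (fourier k).continuous.aestronglyMeasurable
      (Eventually.of_forall fun t => (norm_fourier_apply k t).le)
  have h1 : ∀ b : Bool, ∫ t : AddCircle β, φ t j * reIm b (fourier k t) =
      reIm b (∫ t, ((φ t j : ℝ) : ℂ) * fourier k t) := by
    intro b
    rw [← (reIm b).integral_comp_comm hint]
    refine integral_congr_ae (Eventually.of_forall fun t => ?_)
    change _ = reIm b (((φ t j : ℝ) : ℂ) * fourier k t)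
    rw [← Complex.real_smul, map_smul, smul_eq_mul]
  simp_rw [h1]
  rw [sum_reIm_sq, fourierCoeff_eq_volume, norm_smul, mul_pow, Real.norm_eq_abs, sq_abs,
    ← mul_assoc, ← mul_pow, mul_inv_cancel₀ hβ.out.ne', one_pow, one_mul, ← RCLike.norm_conj,
    ← integral_conj]
  congr 3
  ext t
  rw [map_mul, Complex.conj_ofReal, fourier_neg, smul_eq_mul, mul_comm]

/-- Parseval's identity: `(A⁻¹ φ, φ)` is the variance of the random Fourier series tested against
`φ`. -/
lemma hasSum_inner_modeLoop (hm : 0 < m) (ha : 0 < a) (φ : LoopL2 β ν) :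
    HasSum (fun k : ℤ => ∑ i : Fin ν × Bool, (inner ℝ φ (toL2 (modeLoop m a β (k, i)))) ^ 2)
      (invForm m a φ) := by
  have hβ0 := hβ.out
  have e : ∀ k : ℤ, ∑ i : Fin ν × Bool, (inner ℝ φ (toL2 (modeLoop m a β (k, i)))) ^ 2 =
      β * ((eigenvalue m a β k)⁻¹ * ∑ j : Fin ν,
        ‖fourierCoeff (fun τ : AddCircle β => ((φ τ j : ℝ) : ℂ)) k‖ ^ 2) := by
    intro k
    have hpos := eigenvalue_pos (β := β) hm ha k
    rw [Fintype.sum_prod_type, Finset.mul_sum, Finset.mul_sum]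
    refine Finset.sum_congr rfl fun j _ => ?_
    simp_rw [inner_toL2_modeLoop, mul_pow, ← Finset.mul_sum, sum_integral_reIm_sq]
    rw [inv_pow, Real.sq_sqrt (by positivity)]
    field_simp
  simp_rw [e]
  refine HasSum.mul_left β (Summable.hasSum ?_)
  have hb : ∀ j : Fin ν, ∀ k : ℤ, ‖fourierCoeff (fun τ : AddCircle β => ((φ τ j : ℝ) : ℂ)) k‖ ≤
      β⁻¹ * ∫ t : AddCircle β, ‖φ t j‖ := by
    intro j k
    rw [fourierCoeff_eq_volume, norm_smul, Real.norm_of_nonneg (inv_pos.2 hβ0).le]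
    gcongr
    refine (norm_integral_le_integral_norm _).trans (le_of_eq ?_)
    refine integral_congr_ae (Eventually.of_forall fun t => ?_)
    change ‖fourier (-k) t • ((φ t j : ℝ) : ℂ)‖ = ‖φ t j‖
    rw [norm_smul, norm_fourier_apply, one_mul, Complex.norm_real]
  refine Summable.of_nonneg_of_le (fun k => ?_) (fun k => ?_)
    ((summable_inv_eigenvalue hm ha hβ0).mul_right
      (∑ j : Fin ν, (β⁻¹ * ∫ t : AddCircle β, ‖φ t j‖) ^ 2))
  · have hpos := eigenvalue_pos (β := β) hm ha k
    positivity
  · have hpos := eigenvalue_pos (β := β) hm ha k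
    gcongr
    exact hb _ k

/-- The measure `χ` exists: it is the law of the sum of the random Fourier series. -/
theorem exists_isOscillatorMeasure (hm : 0 < m) (ha : 0 < a) (hν : 0 < ν) :
    ∃ χ : Measure (Loop β ν), IsOscillatorMeasure m a χ := by
  obtain ⟨S, hS⟩ := summable_toL1_modeTerm (β := β) hm ha hν
  have hSm : Measurable S := (Lp.stronglyMeasurable S).measurable
  refine ⟨(noise ν).map S, Measure.isProbabilityMeasure_map hSm.aemeasurable, fun φ => ?_⟩
  set L : Loop β ν →L[ℝ] ℝ := (innerSL ℝ φ).comp toL2 with hL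
  have hLapp : ∀ ω, L ω = inner ℝ φ (toL2 ω) := fun ω => rfl
  rw [integral_map hSm.aemeasurable (by
    refine Continuous.aestronglyMeasurable ?_
    exact Complex.continuous_exp.comp (continuous_const.mul
      (Complex.continuous_ofReal.comp L.continuous)))]
  have hlim1 : Tendsto (fun F : Finset ℤ => ∫ g, Complex.exp (Complex.I *
      ((1 * L (∑ k ∈ F, modeTerm m a β k g) : ℝ) : ℂ)) ∂(noise ν)) atTop
      (𝓝 (Complex.exp (((-(1 / 2) * invForm m a φ : ℝ)) : ℂ))) := by
    have h1 : ∀ F : Finset ℤ, ∫ g, Complex.exp (Complex.I *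
        ((1 * L (∑ k ∈ F, modeTerm m a β k g) : ℝ) : ℂ)) ∂(noise ν) = _ := fun F =>
      integral_exp_sum_modeTerm F (L : Loop β ν →ₗ[ℝ] ℝ) 1
    simp_rw [h1]
    refine (Complex.continuous_exp.tendsto _).comp ((Complex.continuous_ofReal.tendsto _).comp ?_)
    refine Tendsto.const_mul _ ?_
    simp only [one_pow, one_mul]
    exact hasSum_inner_modeLoop hm ha φ
  refine tendsto_nhds_unique ?_ hlim1
  rw [tendsto_iff_norm_sub_tendsto_zero]
  have hexp : ∀ x y : ℝ, ‖Complex.exp (Complex.I * (x : ℂ)) - Complex.exp (Complex.I * (y : ℂ))‖ ≤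
      |x - y| := by
    intro x y
    have e : Complex.exp (Complex.I * (x : ℂ)) - Complex.exp (Complex.I * (y : ℂ)) =
        Complex.exp ((y : ℂ) * Complex.I) * (Complex.exp (Complex.I * ((x - y : ℝ) : ℂ)) - 1) := by
      rw [mul_sub, ← Complex.exp_add, mul_one]
      congr 2
      · push_cast; ring
      · ring
    rw [e, norm_mul, Complex.norm_exp_ofReal_mul_I, one_mul]
    exact Real.norm_exp_I_mul_ofReal_sub_one_le
  have hbd : ∀ F : Finset ℤ, ‖(∫ g, Complex.exp (Complex.I *
      ((1 * L (∑ k ∈ F, modeTerm m a β k g) : ℝ) : ℂ)) ∂(noise ν)) -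
      ∫ g, Complex.exp (Complex.I * ((inner ℝ φ (toL2 (S g)) : ℝ) : ℂ)) ∂(noise ν)‖ ≤
      ‖L‖ * ‖(∑ k ∈ F, (integrable_modeTerm (β := β) hm ha hν k).toL1 _ :
        Lp (Loop β ν) 1 (noise ν)) - S‖ := by
    intro F
    have hint : ∀ Y : (ℤ × Fin ν × Bool → ℝ) → Loop β ν, Measurable Y →
        Integrable (fun g => Complex.exp (Complex.I * ((L (Y g) : ℝ) : ℂ))) (noise ν) := by
      intro Y hY
      refine (integrable_const (1 : ℝ)).mono' ?_ (Eventually.of_forall fun g => ?_)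
      · have : Continuous fun ω : Loop β ν => Complex.exp (Complex.I * ((L ω : ℝ) : ℂ)) :=
          Complex.continuous_exp.comp (continuous_const.mul
            (Complex.continuous_ofReal.comp L.continuous))
        exact (this.measurable.comp hY).aestronglyMeasurable
      · rw [mul_comm, Complex.norm_exp_ofReal_mul_I]
    simp only [one_mul, ← hLapp]
    rw [← integral_sub (hint _ (measurable_sum_modeTerm F)) (hint _ hSm),
      L1.norm_eq_integral_norm, ← integral_const_mul]
    refine (norm_integral_le_integral_norm _).trans (integral_mono_of_nonneg
      (Eventually.of_forall fun g => norm_nonneg _) ((L1.integrable_coeFn _).norm.const_mul _) ?_)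
    filter_upwards [Lp.coeFn_sub (∑ k ∈ F, (integrable_modeTerm (β := β) hm ha hν k).toL1 _ :
        Lp (Loop β ν) 1 (noise ν)) S, sum_toL1_modeTerm (β := β) hm ha hν F] with g h1 h2
    rw [h1, Pi.sub_apply, h2]
    refine (hexp _ _).trans ?_
    rw [← map_sub, ← Real.norm_eq_abs]
    exact L.le_opNorm _
  have hz : Tendsto (fun F : Finset ℤ => ‖L‖ *
      ‖(∑ k ∈ F, (integrable_modeTerm (β := β) hm ha hν k).toL1 _ :
        Lp (Loop β ν) 1 (noise ν)) - S‖) atTop (𝓝 0) := by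
    have := (tendsto_iff_norm_sub_tendsto_zero.1 hS).const_mul ‖L‖
    simpa using this
  exact squeeze_zero (fun _ => norm_nonneg _) hbd hz

lemma isOscillatorMeasure_oscillatorMeasure (hm : 0 < m) (ha : 0 < a) (hν : 0 < ν) :
    IsOscillatorMeasure m a (oscillatorMeasure m a β ν) := by
  have h := exists_isOscillatorMeasure (β := β) hm ha hν
  rw [oscillatorMeasure, dif_pos h]
  exact h.choose_spec

end existence

/-! ### Interaction and weights -/

lemma siteDist_eq_dist {d : ℕ} (ℓ ℓ' : Site d) :
    siteDist ℓ ℓ' = dist (WithLp.toLp 2 (fun i => (ℓ i : ℝ)) : EuclideanSpace ℝ (Fin d))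
      (WithLp.toLp 2 (fun i => (ℓ' i : ℝ))) := by
  rw [EuclideanSpace.dist_eq]
  simp [siteDist, Real.dist_eq, sq_abs]

lemma siteDist_nonneg {d : ℕ} (ℓ ℓ' : Site d) : 0 ≤ siteDist ℓ ℓ' := Real.sqrt_nonneg _

lemma siteDist_triangle {d : ℕ} (ℓ k ℓ' : Site d) :
    siteDist ℓ ℓ' ≤ siteDist ℓ k + siteDist k ℓ' := by
  simp only [siteDist_eq_dist]
  exact dist_triangle _ _ _

lemma exists_sum_le_of_iSup_tsum_lt_top {X : Type*} {f : X → X → ℝ} (hf : ∀ x y, 0 ≤ f x y)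
    (h : (⨆ x, ∑' y, ENNReal.ofReal (f x y)) < ⊤) :
    ∃ C : ℝ, 0 ≤ C ∧ ∀ (x : X) (T : Finset X), ∑ y ∈ T, f x y ≤ C := by
  refine ⟨(⨆ x, ∑' y, ENNReal.ofReal (f x y)).toReal, ENNReal.toReal_nonneg, fun x T => ?_⟩
  rw [← ENNReal.ofReal_le_iff_le_toReal h.ne, ENNReal.ofReal_sum_of_nonneg fun y _ => hf x y]
  exact (ENNReal.sum_le_tsum T).trans (le_iSup (fun x => ∑' y, ENNReal.ofReal (f x y)) x)

namespace Model

variable {d ν : ℕ} (M : Model d ν)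

lemma weight_pos {ε : ℝ} (hε : 0 < ε) (α : ℝ) (ℓ ℓ' : Site d) : 0 < M.weight ε α ℓ ℓ' := by
  have := siteDist_nonneg ℓ ℓ'
  unfold weight
  split_ifs <;> positivity

/-- The weights are supermultiplicative along paths, by the triangle inequality. -/
lemma weight_mul_weight_le {ε α : ℝ} (hε : 0 < ε) (hα : 0 < α) (ℓ k ℓ' : Site d) :
    M.weight ε α ℓ k * M.weight ε α k ℓ' ≤ M.weight ε α ℓ ℓ' := by
  have h1 := siteDist_nonneg ℓ k
  have h2 := siteDist_nonneg k ℓ'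
  have h3 := siteDist_nonneg ℓ ℓ'
  have h := siteDist_triangle ℓ k ℓ'
  unfold weight
  split_ifs
  · rw [← Real.exp_add]
    refine Real.exp_le_exp.2 ?_
    nlinarith
  · rw [← Real.mul_rpow (by positivity) (by positivity)]
    refine Real.rpow_le_rpow_of_nonpos (by positivity) ?_ (by
      have : 0 ≤ α * d := by positivity
      linarith)
    nlinarith [mul_le_mul_of_nonneg_left h hε.le,
      mul_nonneg (mul_nonneg hε.le h1) (mul_nonneg hε.le h2)]

/-- There is an admissible exponent `α ∈ 𝓘` for which the interaction is bounded with respect to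
the weight `w_α`. -/
lemma exists_mem_index {ε : ℝ} (hε : 0 < ε) :
    ∃ α ∈ M.index, 0 < α ∧ ∃ C : ℝ, 0 ≤ C ∧ ∀ (ℓ : Site d) (T : Finset (Site d)),
      ∑ k ∈ T, |M.J ℓ k| * (M.weight ε α ℓ k)⁻¹ ≤ C := by
  by_cases hexp : ∃ α > 0, ExpDecay M.J α
  · obtain ⟨α₀, hα₀, h⟩ := id hexp
    have hmem : α₀ / 2 ∈ M.index := by
      rw [index, if_pos hexp]
      refine ⟨by positivity, lt_of_lt_of_le ?_ (le_sSup ⟨α₀, h, rfl⟩)⟩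
      exact EReal.coe_lt_coe_iff.2 (by linarith)
    -- `α₀` itself may be the supremum, which `𝓘` excludes.
    refine ⟨α₀ / 2, hmem, by positivity, ?_⟩
    obtain ⟨C, hC, hle⟩ := exists_sum_le_of_iSup_tsum_lt_top
      (f := fun ℓ ℓ' => |M.J ℓ ℓ'| * Real.exp (α₀ * siteDist ℓ ℓ')) (fun _ _ => by positivity) h
    refine ⟨C, hC, fun ℓ T => le_trans (Finset.sum_le_sum fun k _ => ?_) (hle ℓ T)⟩
    rw [weight, if_pos hexp, ← Real.exp_neg, neg_neg]
    have := siteDist_nonneg ℓ k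
    gcongr
    linarith
  · obtain ⟨α₀, hα₀, h⟩ := M.J_decay.resolve_left hexp
    have hmem : (1 + α₀) / 2 ∈ M.index := by
      rw [index, if_neg hexp]
      refine ⟨by linarith, lt_of_lt_of_le ?_ (le_sSup ⟨α₀, h, rfl⟩)⟩
      exact EReal.coe_lt_coe_iff.2 (by linarith)
    refine ⟨(1 + α₀) / 2, hmem, by linarith, ?_⟩
    set α := (1 + α₀) / 2 with hα
    have hα0 : 0 ≤ α * d := mul_nonneg (by linarith) (Nat.cast_nonneg d)
    obtain ⟨C, hC, hle⟩ := exists_sum_le_of_iSup_tsum_lt_top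
      (f := fun ℓ ℓ' => |M.J ℓ ℓ'| * (1 + siteDist ℓ ℓ') ^ (α₀ * d))
      (fun ℓ ℓ' => by have := siteDist_nonneg ℓ ℓ'; positivity) h
    refine ⟨(1 + ε) ^ (α * d) * C, by positivity, fun ℓ T => le_trans
      (Finset.sum_le_sum (g := fun k => (1 + ε) ^ (α * d) *
        (|M.J ℓ k| * (1 + siteDist ℓ k) ^ (α₀ * d))) fun k _ => ?_) ?_⟩
    · have h1 := siteDist_nonneg ℓ k
      rw [weight, if_neg hexp, ← Real.rpow_neg (by positivity), neg_neg]
      have h2 : (1 + ε * siteDist ℓ k) ^ (α * d) ≤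
          ((1 + ε) * (1 + siteDist ℓ k)) ^ (α * d) := by
        refine Real.rpow_le_rpow (by positivity) ?_ hα0
        nlinarith
      have h3 : (1 + siteDist ℓ k) ^ (α * d) ≤ (1 + siteDist ℓ k) ^ (α₀ * d) := by
        refine Real.rpow_le_rpow_of_exponent_le (by linarith) ?_
        gcongr
        linarith
      rw [Real.mul_rpow (by positivity) (by positivity)] at h2
      calc |M.J ℓ k| * (1 + ε * siteDist ℓ k) ^ (α * d)
          ≤ |M.J ℓ k| * ((1 + ε) ^ (α * d) * (1 + siteDist ℓ k) ^ (α₀ * d)) := by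
            gcongr
            exact h2.trans (by gcongr)
        _ = _ := by ring
    · rw [← Finset.mul_sum]
      gcongr
      exact hle ℓ T

/-- The properties of the weight kernel that the argument uses: a kernel that is stable under the
interaction, dominates it, and against which tempered configurations are summable. -/
structure IsAdmissible (β ε : ℝ) [Fact (0 < β)] (w : Site d → Site d → ℝ) (C : ℝ) : Prop where
  nonneg : ∀ ℓ ℓ', 0 ≤ w ℓ ℓ'
  const_nonneg : 0 ≤ C
  sum_J_mul_le : ∀ (ℓ ℓ' : Site d) (T : Finset (Site d)), ∑ k ∈ T, |M.J ℓ k| * w k ℓ' ≤ C * w ℓ ℓ'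
  abs_J_le : ∀ ℓ ℓ', |M.J ℓ ℓ'| ≤ C * w ℓ ℓ'
  sum_J_le : ∀ (ℓ : Site d) (T : Finset (Site d)), ∑ k ∈ T, |M.J ℓ k| ≤ C
  summable : ∀ ω ∈ M.tempered β ε, ∀ ℓ, Summable fun ℓ' => w ℓ ℓ' * ‖toL2 (ω ℓ')‖ ^ 2

/-- A weight `w_α` with `α ∈ 𝓘` is admissible: the convolution bound follows from its behaviour under
the triangle inequality, and summability at `0` carries over to every site. -/
lemma exists_isAdmissible (β : ℝ) [Fact (0 < β)] {ε : ℝ} (hε : 0 < ε) :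
    ∃ (w : Site d → Site d → ℝ) (C : ℝ), M.IsAdmissible β ε w C := by
  obtain ⟨α, hα, hα0, C, hC, hle⟩ := M.exists_mem_index hε
  obtain ⟨C', hC', hle'⟩ := exists_sum_le_of_iSup_tsum_lt_top
    (f := fun ℓ ℓ' => |M.J ℓ ℓ'|) (fun _ _ => abs_nonneg _) M.J_bdd
  have hpos := M.weight_pos hε α
  refine ⟨M.weight ε α, max C C', fun ℓ ℓ' => (hpos ℓ ℓ').le, le_max_of_le_left hC, ?_, ?_,
    fun ℓ T => (hle' ℓ T).trans (le_max_right _ _), ?_⟩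
  · intro ℓ ℓ' T
    calc ∑ k ∈ T, |M.J ℓ k| * M.weight ε α k ℓ'
        ≤ ∑ k ∈ T, |M.J ℓ k| * (M.weight ε α ℓ k)⁻¹ * M.weight ε α ℓ ℓ' := by
          refine Finset.sum_le_sum fun k _ => ?_
          rw [mul_assoc]
          gcongr
          rw [inv_mul_eq_div, le_div_iff₀ (hpos ℓ k), mul_comm]
          exact M.weight_mul_weight_le hε hα0 ℓ k ℓ'
      _ = (∑ k ∈ T, |M.J ℓ k| * (M.weight ε α ℓ k)⁻¹) * M.weight ε α ℓ ℓ' := by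
          rw [Finset.sum_mul]
      _ ≤ max C C' * M.weight ε α ℓ ℓ' := by
          have := (hpos ℓ ℓ').le
          gcongr
          exact (hle ℓ T).trans (le_max_left _ _)
  · intro ℓ ℓ'
    have h := hle ℓ {ℓ'}
    rw [Finset.sum_singleton, ← div_eq_mul_inv, div_le_iff₀ (hpos ℓ ℓ')] at h
    refine h.trans ?_
    have := (hpos ℓ ℓ').le
    gcongr
    exact le_max_left _ _
  · intro ω hω ℓ
    have h := hω α hα
    refine Summable.of_nonneg_of_le (fun ℓ' => ?_) (fun ℓ' => ?_)
      (h.mul_left (M.weight ε α 0 ℓ)⁻¹)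
    · have := (hpos ℓ ℓ').le
      positivity
    · have h1 := M.weight_mul_weight_le hε hα0 0 ℓ ℓ'
      rw [mul_comm (‖_‖ ^ 2), ← mul_assoc]
      gcongr
      rw [inv_mul_eq_div, le_div_iff₀ (hpos 0 ℓ), mul_comm]
      exact h1

variable {M}

lemma IsAdmissible.summable_J {β ε : ℝ} [Fact (0 < β)] {w : Site d → Site d → ℝ} {C : ℝ}
    (h : M.IsAdmissible β ε w C) (ℓ : Site d) : Summable fun k => |M.J ℓ k| :=
  summable_of_sum_le (fun _ => abs_nonneg _) (h.sum_J_le ℓ)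

lemma IsAdmissible.tsum_J_le {β ε : ℝ} [Fact (0 < β)] {w : Site d → Site d → ℝ} {C : ℝ}
    (h : M.IsAdmissible β ε w C) (ℓ : Site d) : ∑' k, |M.J ℓ k| ≤ C :=
  Real.tsum_le_of_sum_le (fun _ => abs_nonneg _) (h.sum_J_le ℓ)

lemma IsAdmissible.summable_J_sq {β ε : ℝ} [Fact (0 < β)] {w : Site d → Site d → ℝ} {C : ℝ}
    (h : M.IsAdmissible β ε w C) {ω : Config d ν β} (hω : ω ∈ M.tempered β ε) (ℓ : Site d) :
    Summable fun k => |M.J ℓ k| * ‖toL2 (ω k)‖ ^ 2 := by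
  refine Summable.of_nonneg_of_le (fun k => by positivity) (fun k => ?_)
    ((h.summable ω hω ℓ).mul_left C)
  rw [← mul_assoc]
  gcongr
  exact h.abs_J_le ℓ k

end Model

/-! ### The one-site Dobrushin-Lanford-Ruelle equation -/

/-- A sum of real measurable functions is measurable also where it does not converge, since there
`tsum` takes the value `0`. -/
lemma measurable_real_tsum {α ι : Type*} [MeasurableSpace α] [Countable ι] {f : ι → α → ℝ}
    (hf : ∀ i, Measurable (f i)) : Measurable fun x => ∑' i, f i x := by
  classical
  have hS : MeasurableSet {x | ∑' i, ENNReal.ofReal |f i x| ≠ ⊤} :=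
    (Measurable.tsum fun i => ENNReal.measurable_ofReal.comp
      (measurable_norm.comp (hf i))) (measurableSet_singleton ⊤).compl
  have hp : Measurable fun x => (∑' i, ENNReal.ofReal (f i x)).toReal :=
    (Measurable.tsum fun i => ENNReal.measurable_ofReal.comp (hf i)).ennreal_toReal
  have hn : Measurable fun x => (∑' i, ENNReal.ofReal (-f i x)).toReal :=
    (Measurable.tsum fun i => ENNReal.measurable_ofReal.comp (hf i).neg).ennreal_toReal
  have e : (fun x => ∑' i, f i x) = fun x => if ∑' i, ENNReal.ofReal |f i x| ≠ ⊤ then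
      (∑' i, ENNReal.ofReal (f i x)).toReal - (∑' i, ENNReal.ofReal (-f i x)).toReal else 0 := by
    ext x
    split_ifs with h
    · have hs : Summable fun i => |f i x| := by
        have := ENNReal.summable_toReal h
        simpa [ENNReal.toReal_ofReal] using this
      have h1 : Summable fun i => max (f i x) 0 :=
        hs.of_nonneg_of_le (fun i => le_max_right _ _)
          fun i => max_le (le_abs_self _) (abs_nonneg _)
      have h2 : Summable fun i => max (-f i x) 0 :=
        hs.of_nonneg_of_le (fun i => le_max_right _ _)
          fun i => max_le (neg_le_abs _) (abs_nonneg _)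
      rw [ENNReal.tsum_toReal_eq fun _ => ENNReal.ofReal_ne_top,
        ENNReal.tsum_toReal_eq fun _ => ENNReal.ofReal_ne_top]
      simp only [ENNReal.toReal_ofReal']
      rw [← h1.tsum_sub h2]
      refine tsum_congr fun i => ?_
      rcases le_total (f i x) 0 with hi | hi <;> simp [hi]
    · refine tsum_eq_zero_of_not_summable fun hs => h ?_
      exact hs.abs.tsum_ofReal_lt_top.ne
  rw [e]
  exact Measurable.ite hS (hp.sub hn) measurable_const

namespace Model

variable {d ν : ℕ} (M : Model d ν) {β : ℝ} [hβ : Fact (0 < β)]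

/-- The energy of the loop `x` at the site `ℓ` in the configuration `ξ`. -/
def siteEnergy (ℓ : Site d) (x : Loop β ν) (ξ : Config d ν β) : ℝ :=
  (∫ τ : AddCircle β, M.V ℓ (x τ)) - ∑' k, M.J ℓ k * inner ℝ (toL2 x) (toL2 (ξ k))

/-- The one-site Boltzmann factor. -/
def siteDensity (ℓ : Site d) (x : Loop β ν) (ξ : Config d ν β) : ℝ≥0∞ :=
  ENNReal.ofReal (Real.exp (-M.siteEnergy ℓ x ξ))

lemma continuous_integral_V (ℓ : Site d) :
    Continuous fun x : Loop β ν => ∫ τ : AddCircle β, M.V ℓ (x τ) := by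
  have h1 : Continuous fun x : Loop β ν =>
      (⟨M.V ℓ, M.V_cont ℓ⟩ : C(EuclideanSpace ℝ (Fin ν), ℝ)).comp x :=
    ContinuousMap.continuous_postcomp _
  have h2 : Continuous fun f : C(AddCircle β, ℝ) => ∫ τ, f τ := by
    have e : (fun f : C(AddCircle β, ℝ) => ∫ τ, f τ) = fun f =>
        ∫ τ, (ContinuousMap.toLp (E := ℝ) 1 (volume : Measure (AddCircle β)) ℝ f) τ := by
      ext f
      exact integral_congr_ae (ContinuousMap.coeFn_toLp _ f).symm
    rw [e]
    exact continuous_integral.comp (ContinuousMap.toLp 1 _ ℝ).continuous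
  exact h2.comp h1

lemma measurable_siteEnergy (ℓ : Site d) :
    Measurable fun p : Config d ν β × Loop β ν => M.siteEnergy ℓ p.2 p.1 := by
  have h : Measurable fun q : Loop β ν × Loop β ν => (inner ℝ (toL2 q.1) (toL2 q.2) : ℝ) :=
    ((toL2.continuous.comp continuous_fst).inner (toL2.continuous.comp continuous_snd)).measurable
  have h1 : ∀ k, Measurable fun p : Config d ν β × Loop β ν =>
      M.J ℓ k * (inner ℝ (toL2 p.2) (toL2 (p.1 k)) : ℝ) := by
    intro k
    have h2 : Measurable fun p : Config d ν β × Loop β ν => (p.2, p.1 k) :=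
      measurable_snd.prodMk ((measurable_pi_apply k).comp measurable_fst)
    exact (h.comp h2).const_mul _
  have h3 : Measurable fun p : Config d ν β × Loop β ν => ∫ τ : AddCircle β, M.V ℓ (p.2 τ) :=
    (M.continuous_integral_V ℓ).measurable.comp measurable_snd
  exact h3.sub (measurable_real_tsum h1)

lemma measurable_siteDensity (ℓ : Site d) :
    Measurable fun p : Config d ν β × Loop β ν => M.siteDensity ℓ p.2 p.1 :=
  ENNReal.measurable_ofReal.comp (Real.measurable_exp.comp (M.measurable_siteEnergy ℓ).neg)

lemma measurable_update_site {β : ℝ} (ℓ : Site d) :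
    Measurable fun p : Config d ν β × Loop β ν => Function.update p.1 ℓ p.2 := by
  refine measurable_pi_iff.2 fun k => ?_
  by_cases hk : k = ℓ
  · subst hk
    simpa using measurable_snd
  · simp only [Function.update_of_ne hk]
    exact (measurable_pi_apply k).comp measurable_fst

lemma glue_singleton {β : ℝ} (ℓ : Site d) (ω : ({ℓ} : Finset (Site d)) → Loop β ν)
    (ξ : Config d ν β) :
    glue {ℓ} ω ξ = Function.update ξ ℓ (ω default) := by
  ext1 k
  by_cases hk : k = ℓ
  · subst hk
    simp only [glue, Finset.mem_singleton, dif_pos, Function.update_self]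
    congr 1
  · simp [glue, hk]

lemma boltzmann_singleton (ℓ : Site d) (ω : ({ℓ} : Finset (Site d)) → Loop β ν)
    (ξ : Config d ν β) : M.boltzmann {ℓ} ω ξ = M.siteDensity ℓ (ω default) ξ := by
  rw [boltzmann, siteDensity, energy, siteEnergy, glue_singleton]
  simp only [Finset.sum_singleton, Function.update_self, M.J_diag, zero_mul, mul_zero, zero_add]
  congr 4
  refine tsum_subtype_eq_of_support_subset
    (f := fun k => M.J ℓ k * inner ℝ (toL2 (ω default)) (toL2 (ξ k))) fun k hk => ?_
  have : k ≠ ℓ := by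
    rintro rfl
    simp [M.J_diag] at hk
  change k ∉ ({ℓ} : Finset (Site d))
  simpa using this

lemma lintegral_freeMeasure_singleton [SigmaFinite (oscillatorMeasure M.m M.a β ν)] (ℓ : Site d)
    (f : Loop β ν → ℝ≥0∞) :
    ∫⁻ ω, f (ω default) ∂(M.freeMeasure {ℓ} : Measure (({ℓ} : Finset (Site d)) → Loop β ν)) =
      ∫⁻ x, f x ∂(oscillatorMeasure M.m M.a β ν) :=
  (measurePreserving_funUnique (oscillatorMeasure M.m M.a β ν)
    ({ℓ} : Finset (Site d))).lintegral_comp_emb (MeasurableEquiv.measurableEmbedding _) f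

/-- The one-site partition function. -/
def sitePartition (ℓ : Site d) (ξ : Config d ν β) : ℝ≥0∞ :=
  ∫⁻ x, M.siteDensity ℓ x ξ ∂(oscillatorMeasure M.m M.a β ν)

lemma spec_singleton [SigmaFinite (oscillatorMeasure M.m M.a β ν)] {ε : ℝ} (ℓ : Site d)
    (B : Set (Config d ν β)) {ξ : Config d ν β} (hξ : ξ ∈ M.tempered β ε) :
    M.spec ε {ℓ} B ξ = (M.sitePartition ℓ ξ)⁻¹ *
      ∫⁻ x, M.siteDensity ℓ x ξ * B.indicator 1 (Function.update ξ ℓ x)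
        ∂(oscillatorMeasure M.m M.a β ν) := by
  rw [spec, if_pos hξ, partition, sitePartition]
  simp only [boltzmann_singleton, glue_singleton]
  rw [M.lintegral_freeMeasure_singleton ℓ (fun x => M.siteDensity ℓ x ξ),
    M.lintegral_freeMeasure_singleton ℓ (fun x => M.siteDensity ℓ x ξ *
      B.indicator 1 (Function.update ξ ℓ x))]

lemma spec_le_one (ε : ℝ) (Λ : Finset (Site d)) (B : Set (Config d ν β)) (ξ : Config d ν β) :
    M.spec ε Λ B ξ ≤ 1 := by
  unfold spec
  split_ifs
  · refine le_trans ?_ (ENNReal.inv_mul_le_one (M.partition Λ ξ))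
    gcongr
    refine lintegral_mono fun ω => ?_
    refine mul_le_of_le_one_right' ?_
    exact Set.indicator_le_self' (by simp) _
  · exact zero_le_one

/-- Every Gibbs measure is carried by the tempered configurations: the kernel is at most `1`, vanishes
at the other configurations, and has integral `μ(Ω) = 1`. -/
lemma ae_mem_tempered {ε : ℝ} {μ : Measure (Config d ν β)} (hμ : μ ∈ M.gibbs β ε) :
    ∀ᵐ ξ ∂μ, ξ ∈ M.tempered β ε := by
  have := hμ.1
  -- A measurable minorant with the same integral makes the measurability of the kernel superfluous.
  obtain ⟨g, hg, hgle, hgeq⟩ := exists_measurable_le_lintegral_eq μ (M.spec ε {0} Set.univ)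
  have h1 : ∫⁻ ξ, g ξ ∂μ = 1 := by
    rw [← hgeq, hμ.2 {0} (Finset.singleton_nonempty _) _ MeasurableSet.univ, measure_univ]
  have hg1 : ∀ ξ, g ξ ≤ 1 := fun ξ => (hgle ξ).trans (M.spec_le_one _ _ _ _)
  have h2 : ∀ᵐ ξ ∂μ, g ξ = 1 := by
    have h3 : ∫⁻ ξ, (1 - g ξ) ∂μ = 0 := by
      rw [lintegral_sub hg (by rw [h1]; exact ENNReal.one_ne_top) (Eventually.of_forall hg1), h1]
      simp
    have hm : Measurable fun ξ => 1 - g ξ := measurable_const.sub hg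
    rw [lintegral_eq_zero_iff hm] at h3
    filter_upwards [h3] with ξ hξ
    exact le_antisymm (hg1 ξ) (tsub_eq_zero_iff_le.1 hξ)
  filter_upwards [h2] with ξ hξ
  by_contra hn
  have := hgle ξ
  rw [hξ, spec, if_neg hn] at this
  simp at this

/-- The Dobrushin-Lanford-Ruelle equation of one site, for functions. The right-hand side is the
integral with respect to a measure that agrees with `μ` on measurable sets. -/
lemma lintegral_eq_of_mem_gibbs [IsProbabilityMeasure (oscillatorMeasure M.m M.a β ν)] {ε : ℝ}
    {μ : Measure (Config d ν β)} (hμ : μ ∈ M.gibbs β ε) (ℓ : Site d) {F : Config d ν β → ℝ≥0∞}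
    (hF : Measurable F) :
    ∫⁻ ω, F ω ∂μ = ∫⁻ ξ, (M.sitePartition ℓ ξ)⁻¹ *
      ∫⁻ x, M.siteDensity ℓ x ξ * F (Function.update ξ ℓ x)
        ∂(oscillatorMeasure M.m M.a β ν) ∂μ := by
  have := hμ.1
  set χ := oscillatorMeasure M.m M.a β ν with hχ
  have hZ : Measurable fun ξ : Config d ν β => (M.sitePartition ℓ ξ)⁻¹ :=
    (Measurable.lintegral_prod_right' (M.measurable_siteDensity ℓ)).inv
  have hρ := M.measurable_siteDensity (β := β) ℓ
  have hu := measurable_update_site (d := d) (ν := ν) (β := β) ℓ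
  have hD : Measurable fun p : Config d ν β × Loop β ν =>
      (M.sitePartition ℓ p.1)⁻¹ * M.siteDensity ℓ p.2 p.1 := (hZ.comp measurable_fst).mul hρ
  set P : Measure (Config d ν β) := ((μ.prod χ).withDensity fun p =>
    (M.sitePartition ℓ p.1)⁻¹ * M.siteDensity ℓ p.2 p.1).map
      (fun p => Function.update p.1 ℓ p.2) with hP
  have hPF : ∀ G : Config d ν β → ℝ≥0∞, Measurable G → ∫⁻ ω, G ω ∂P =
      ∫⁻ ξ, (M.sitePartition ℓ ξ)⁻¹ *
        ∫⁻ x, M.siteDensity ℓ x ξ * G (Function.update ξ ℓ x) ∂χ ∂μ := by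
    intro G hG
    have hGu : Measurable fun p : Config d ν β × Loop β ν => G (Function.update p.1 ℓ p.2) :=
      hG.comp hu
    rw [hP, lintegral_map hG hu, lintegral_withDensity_eq_lintegral_mul _ hD hGu,
      lintegral_prod _ (hD.mul hGu).aemeasurable]
    refine lintegral_congr fun ξ => ?_
    have hm : Measurable fun x => M.siteDensity ℓ x ξ * G (Function.update ξ ℓ x) :=
      (hρ.mul hGu).comp measurable_prodMk_left
    rw [← lintegral_const_mul _ hm]
    refine lintegral_congr fun x => ?_
    simp only [Pi.mul_apply, mul_assoc]
  have hPμ : P = μ := by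
    refine Measure.ext fun B hB => ?_
    rw [← hμ.2 {ℓ} (Finset.singleton_nonempty _) B hB, ← lintegral_indicator_one hB,
      hPF _ (measurable_one.indicator hB)]
    refine lintegral_congr_ae ?_
    filter_upwards [M.ae_mem_tempered hμ] with ξ hξ
    rw [M.spec_singleton ℓ B hξ]
  rw [← hPF F hF, hPμ]

end Model

/-! ### The one-site estimate -/

section loops

variable {β : ℝ} [hβ : Fact (0 < β)] {ν : ℕ}

lemma measurable_holderENorm (σ : ℝ≥0) :
    Measurable (holderENorm σ : Loop β ν → ℝ≥0∞) := by
  have h : Measurable fun ω : Loop β ν =>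
      eHolderNorm σ (ω : AddCircle β → EuclideanSpace ℝ (Fin ν)) := by
    refine measurable_of_Iic fun t => ?_
    induction t using ENNReal.recTopCoe with
    | top => simp
    | coe C =>
      have e : (fun ω : Loop β ν => eHolderNorm σ (ω : AddCircle β → EuclideanSpace ℝ (Fin ν))) ⁻¹'
          Set.Iic (C : ℝ≥0∞) = ⋂ τ, ⋂ τ', {ω | edist (ω τ) (ω τ') ≤ C * edist τ τ' ^ (σ : ℝ)} := by
        ext ω
        simp only [Set.mem_preimage, Set.mem_Iic, Set.mem_iInter, Set.mem_ofPred_eq]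
        refine ⟨fun h τ τ' => ?_, fun h => HolderWith.eHolderNorm_le h⟩
        have hm : MemHolder σ (ω : AddCircle β → EuclideanSpace ℝ (Fin ν)) :=
          eHolderNorm_lt_top.1 (lt_of_le_of_lt h ENNReal.coe_lt_top)
        refine (hm.holderWith τ τ').trans ?_
        rw [hm.coe_nnHolderNorm_eq_eHolderNorm]
        gcongr
      rw [e]
      refine IsClosed.measurableSet (isClosed_iInter fun τ => isClosed_iInter fun τ' => ?_)
      have h1 : Continuous fun ω : Loop β ν => edist (ω τ) (ω τ') := by fun_prop
      exact isClosed_le h1 continuous_const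
  exact measurable_enorm.add h

/-- `exp (c |x|²)` for the Hölder norm. -/
def expHolder (σ : ℝ≥0) (c : ℝ) (x : Loop β ν) : ℝ≥0∞ :=
  EReal.exp ((ENNReal.ofReal c * holderENorm σ x ^ 2 : ℝ≥0∞) : EReal)

/-- `exp (κ |x|²)` for the `L²` norm. -/
def expL2 (κ : ℝ) (x : Loop β ν) : ℝ≥0∞ := ENNReal.ofReal (Real.exp (κ * ‖toL2 x‖ ^ 2))

lemma measurable_expHolder (σ : ℝ≥0) (c : ℝ) : Measurable (expHolder σ c : Loop β ν → ℝ≥0∞) :=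
  EReal.exp_strictMono.monotone.measurable.comp (measurable_coe_ennreal_ereal.comp
    (((measurable_holderENorm σ).pow_const 2).const_mul _))

lemma continuous_norm_toL2 : Continuous fun x : Loop β ν => ‖toL2 x‖ := toL2.continuous.norm

lemma measurable_expL2 (κ : ℝ) : Measurable (expL2 κ : Loop β ν → ℝ≥0∞) :=
  ENNReal.measurable_ofReal.comp (Real.continuous_exp.comp
    (continuous_const.mul (continuous_norm_toL2.pow 2))).measurable

lemma one_le_expHolder (σ : ℝ≥0) (c : ℝ) (x : Loop β ν) : 1 ≤ expHolder σ c x :=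
  EReal.one_le_exp_iff.2 (EReal.coe_ennreal_nonneg _)

lemma exp_add_eq_expHolder_mul_expL2 (σ : ℝ≥0) (c : ℝ) {κ : ℝ} (hκ : 0 ≤ κ) (x : Loop β ν) :
    EReal.exp ((ENNReal.ofReal c * holderENorm σ x ^ 2 + ENNReal.ofReal κ * ‖toL2 x‖ₑ ^ 2 :
      ℝ≥0∞) : EReal) = expHolder σ c x * expL2 κ x := by
  rw [EReal.coe_ennreal_add, EReal.exp_add, expHolder, expL2, ← exp_coe_ofReal (by positivity),
    ENNReal.ofReal_mul hκ, ENNReal.ofReal_pow (norm_nonneg _), ofReal_norm]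

lemma norm_toL2_sq (x : Loop β ν) : ‖toL2 x‖ ^ 2 = ∫ τ : AddCircle β, ‖x τ‖ ^ 2 := by
  rw [← real_inner_self_eq_norm_sq, L2.inner_def]
  refine integral_congr_ae ?_
  filter_upwards [ContinuousMap.coeFn_toLp (p := 2) (𝕜 := ℝ) (volume : Measure (AddCircle β)) x]
    with t ht
  have ht' : (toL2 x : LoopL2 β ν) t = x t := ht
  rw [ht', real_inner_self_eq_norm_sq]

lemma volume_real_univ_circle : (volume : Measure (AddCircle β)).real Set.univ = β := by
  rw [Measure.real, AddCircle.measure_univ, ENNReal.toReal_ofReal hβ.out.le]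

lemma integral_circle_le {f : AddCircle β → ℝ} (hf : Continuous f) {C : ℝ} (h : ∀ τ, f τ ≤ C) :
    ∫ τ, f τ ≤ β * C := by
  calc ∫ τ, f τ ≤ ∫ _τ : AddCircle β, C := integral_mono
        (hf.integrable_of_hasCompactSupport (HasCompactSupport.of_compactSpace f))
        (integrable_const C) h
    _ = β * C := by rw [integral_const, volume_real_univ_circle, smul_eq_mul]

lemma norm_toL2_sq_le {x : Loop β ν} {R : ℝ} (hx : ‖x‖ ≤ R) : ‖toL2 x‖ ^ 2 ≤ β * R ^ 2 := by
  rw [norm_toL2_sq]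
  refine integral_circle_le (by fun_prop) fun τ => ?_
  have := (x.norm_coe_le_norm τ).trans hx
  gcongr

end loops

/-- A superquadratic power absorbs a quadratic term. -/
lemma exists_quadratic_sub_rpow_le {r A : ℝ} (hr : 1 < r) (hA : 0 < A) {b : ℝ} (hb : 0 ≤ b) :
    ∃ C : ℝ, ∀ u : ℝ, 0 ≤ u → b * u ^ 2 - A * u ^ (2 * r) ≤ C := by
  refine ⟨b * (b / A) ^ (1 / (r - 1)), fun u hu => ?_⟩
  have hr' : 0 < r - 1 := by linarith
  rcases eq_or_lt_of_le hu with rfl | hu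
  · rw [Real.zero_rpow (by linarith)]
    simp only [ne_eq, OfNat.ofNat_ne_zero, not_false_eq_true, zero_pow, mul_zero, sub_zero]
    positivity
  have e : u ^ (2 * r) = u ^ 2 * (u ^ 2) ^ (r - 1) := by
    rw [← Real.rpow_two, ← Real.rpow_mul hu.le, ← Real.rpow_add hu]
    ring_nf
  rw [e]
  rcases le_total (u ^ 2) ((b / A) ^ (1 / (r - 1))) with h | h
  · have h1 : b * u ^ 2 ≤ b * (b / A) ^ (1 / (r - 1)) := by gcongr
    have h2 : 0 ≤ A * (u ^ 2 * (u ^ 2) ^ (r - 1)) := by positivity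
    linarith
  · have h1 : b / A ≤ (u ^ 2) ^ (r - 1) := by
      have := Real.rpow_le_rpow (by positivity) h hr'.le
      rwa [← Real.rpow_mul (by positivity), one_div, inv_mul_cancel₀ hr'.ne', Real.rpow_one] at this
    rw [div_le_iff₀ hA] at h1
    have h2 : u ^ 2 * b ≤ u ^ 2 * ((u ^ 2) ^ (r - 1) * A) := by gcongr
    have h3 : 0 ≤ b * (b / A) ^ (1 / (r - 1)) := by positivity
    nlinarith

namespace Model

variable {d ν : ℕ} {M : Model d ν} {β : ℝ} [hβ : Fact (0 < β)]

variable (M β) in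
/-- The potential energy absorbs any multiple of the squared `L²` norm, uniformly in the site. -/
lemma exists_quadratic_sub_integral_V_le {b : ℝ} (hb : 0 ≤ b) :
    ∃ C : ℝ, ∀ (ℓ : Site d) (x : Loop β ν),
      b * ‖toL2 x‖ ^ 2 - ∫ τ : AddCircle β, M.V ℓ (x τ) ≤ C := by
  obtain ⟨r, hr, A, hA, B, hV⟩ := M.V_lower
  obtain ⟨C, hC⟩ := exists_quadratic_sub_rpow_le hr hA hb
  refine ⟨β * (C - B), fun ℓ x => ?_⟩
  have hVc : Continuous fun τ => M.V ℓ (x τ) := (M.V_cont ℓ).comp x.continuous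
  have h1 : Continuous fun τ => b * ‖x τ‖ ^ 2 := by fun_prop
  rw [norm_toL2_sq, ← integral_const_mul, ← integral_sub
    (h1.integrable_of_hasCompactSupport (HasCompactSupport.of_compactSpace _))
    (hVc.integrable_of_hasCompactSupport (HasCompactSupport.of_compactSpace _))]
  refine integral_circle_le (h1.sub hVc) fun τ => ?_
  have h2 := hC ‖x τ‖ (norm_nonneg _)
  have h3 := hV ℓ (x τ)
  change b * ‖x τ‖ ^ 2 - M.V ℓ (x τ) ≤ C - B
  linarith

variable (M β) in
lemma exists_integral_V_le (R : ℝ) :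
    ∃ C : ℝ, ∀ (ℓ : Site d) (x : Loop β ν), ‖x‖ ≤ R → ∫ τ : AddCircle β, M.V ℓ (x τ) ≤ C := by
  obtain ⟨U, hU, -, hle⟩ := M.V_upper
  obtain ⟨C, hC⟩ := (isCompact_closedBall (0 : EuclideanSpace ℝ (Fin ν)) R).bddAbove_image
    hU.continuousOn
  refine ⟨β * C, fun ℓ x hx => integral_circle_le ((M.V_cont ℓ).comp x.continuous) fun τ => ?_⟩
  refine (hle ℓ (x τ)).trans (hC ⟨x τ, ?_, rfl⟩)
  rw [mem_closedBall_zero_iff]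
  exact (x.norm_coe_le_norm τ).trans hx

/-- The strength `∑_k |J_ℓk| |ξ_k|²` of the boundary condition `ξ` at the site `ℓ`. -/
def boundary (M : Model d ν) (ℓ : Site d) (ξ : Config d ν β) : ℝ :=
  ∑' k, |M.J ℓ k| * ‖toL2 (ξ k)‖ ^ 2

/-- Young's inequality for the interaction of a loop with a tempered boundary condition. -/
lemma IsAdmissible.abs_interaction_le {ε : ℝ} {w : Site d → Site d → ℝ} {C : ℝ}
    (h : M.IsAdmissible β ε w C) {ϑ : ℝ} (hϑ : 0 < ϑ) (ℓ : Site d) (x : Loop β ν)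
    {ξ : Config d ν β} (hξ : ξ ∈ M.tempered β ε) :
    |∑' k, M.J ℓ k * inner ℝ (toL2 x) (toL2 (ξ k))| ≤
      ϑ * M.boundary ℓ ξ + C / (4 * ϑ) * ‖toL2 x‖ ^ 2 := by
  have hs1 := (h.summable_J_sq hξ ℓ).mul_left ϑ
  have hs2 := (h.summable_J ℓ).mul_right (‖toL2 x‖ ^ 2 / (4 * ϑ))
  have hle : ∀ k, ‖M.J ℓ k * inner ℝ (toL2 x) (toL2 (ξ k))‖ ≤
      ϑ * (|M.J ℓ k| * ‖toL2 (ξ k)‖ ^ 2) + |M.J ℓ k| * (‖toL2 x‖ ^ 2 / (4 * ϑ)) := by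
    intro k
    rw [norm_mul, Real.norm_eq_abs]
    have h1 := norm_inner_le_norm (𝕜 := ℝ) (toL2 x) (toL2 (ξ k))
    have h2 : ‖toL2 x‖ * ‖toL2 (ξ k)‖ ≤ ϑ * ‖toL2 (ξ k)‖ ^ 2 + ‖toL2 x‖ ^ 2 / (4 * ϑ) := by
      have e : ϑ * ‖toL2 (ξ k)‖ ^ 2 + ‖toL2 x‖ ^ 2 / (4 * ϑ) - ‖toL2 x‖ * ‖toL2 (ξ k)‖ =
          (2 * ϑ * ‖toL2 (ξ k)‖ - ‖toL2 x‖) ^ 2 / (4 * ϑ) := by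
        field_simp
        ring
      have : 0 ≤ (2 * ϑ * ‖toL2 (ξ k)‖ - ‖toL2 x‖) ^ 2 / (4 * ϑ) := by positivity
      linarith
    calc _ ≤ |M.J ℓ k| * (ϑ * ‖toL2 (ξ k)‖ ^ 2 + ‖toL2 x‖ ^ 2 / (4 * ϑ)) := by
          gcongr
          exact h1.trans h2
      _ = _ := by ring
  have h3 := tsum_of_norm_bounded (hs1.add hs2).hasSum hle
  rw [Real.norm_eq_abs] at h3
  refine h3.trans ?_
  rw [hs1.tsum_add hs2, tsum_mul_left, tsum_mul_right, boundary]
  have h4 : (∑' k, |M.J ℓ k|) * (‖toL2 x‖ ^ 2 / (4 * ϑ)) ≤ C * (‖toL2 x‖ ^ 2 / (4 * ϑ)) := by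
    gcongr
    exact h.tsum_J_le ℓ
  calc _ ≤ _ := add_le_add_right h4 _
    _ = _ := by ring

/-- **One-site estimate.** Under the one-site Gibbs distribution, conditioned on an `L²` ball, the
exponential moments are bounded in terms of an arbitrarily small multiple of the boundary strength.
The restriction to a ball is harmless since a fixed ball of loops already bounds the partition
function from below. -/
lemma IsAdmissible.exists_site_estimate {ε : ℝ} {w : Site d → Site d → ℝ} {C : ℝ}
    (h : M.IsAdmissible β ε w C) [IsProbabilityMeasure (oscillatorMeasure M.m M.a β ν)]
    {σ : ℝ≥0} {c : ℝ} (hc : HasHolderExpMoment M.m M.a β ν σ c) {κ θ : ℝ} (hκ : 0 < κ)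
    (hθ : 0 < θ) :
    ∃ D N₀ : ℝ, ∀ N, N₀ ≤ N → ∀ (ℓ : Site d), ∀ ξ ∈ M.tempered β ε,
      ∫⁻ x, M.siteDensity ℓ x ξ * ({x : Loop β ν | ‖toL2 x‖ ≤ N}.indicator
          (fun x => expHolder σ c x * expL2 κ x) x) ∂(oscillatorMeasure M.m M.a β ν) ≤
        ENNReal.ofReal (Real.exp (D + θ * M.boundary ℓ ξ)) *
          ∫⁻ x, M.siteDensity ℓ x ξ * ({x : Loop β ν | ‖toL2 x‖ ≤ N}.indicator 1 x)
            ∂(oscillatorMeasure M.m M.a β ν) := by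
  set χ := oscillatorMeasure M.m M.a β ν with hχ
  have hβ0 := hβ.out
  -- A ball of loops of positive mass, for the lower bound of the denominator.
  obtain ⟨R, hR⟩ : ∃ R : ℕ, 0 < χ (Metric.closedBall 0 R) := by
    by_contra! hn
    have h0 : χ (⋃ n : ℕ, Metric.closedBall 0 (n : ℝ)) = 0 :=
      measure_iUnion_null fun n => le_antisymm (hn n) zero_le
    rw [Metric.iUnion_closedBall_nat, measure_univ] at h0
    exact one_ne_zero h0
  -- The interaction enters both bounds, hence `θ / 2` in each.
  have hϑ : 0 < θ / 2 := by positivity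
  have hC := h.const_nonneg
  set b := C / (4 * (θ / 2)) with hb
  have hb0 : 0 ≤ b := by positivity
  obtain ⟨C₁, hC₁⟩ := M.exists_quadratic_sub_integral_V_le β (b := κ + b) (by positivity)
  obtain ⟨C₂, hC₂⟩ := M.exists_integral_V_le β R
  set C₃ := C₁ + C₂ + b * (β * (R : ℝ) ^ 2) with hC₃
  set Q : ℝ≥0∞ := ∫⁻ x, expHolder σ c x ∂χ with hQ
  have hQtop : Q < ⊤ := hc
  set p := χ (Metric.closedBall 0 (R : ℝ)) with hp
  have hptop : p ≠ ⊤ := measure_ne_top _ _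
  set q : ℝ := (Q / p).toReal with hq
  have hqe : Q / p = ENNReal.ofReal q := by
    rw [hq, ENNReal.ofReal_toReal]
    exact (ENNReal.div_lt_top hQtop.ne hR.ne').ne
  have hq0 : 0 ≤ q := ENNReal.toReal_nonneg
  refine ⟨C₃ + Real.log (q + 1), Real.sqrt (β * (R : ℝ) ^ 2), fun N hN ℓ ξ hξ => ?_⟩
  set S := M.boundary ℓ ξ with hS
  have hint := fun x => h.abs_interaction_le hϑ ℓ x hξ
  have hupper : ∀ x : Loop β ν, M.siteDensity ℓ x ξ * expL2 κ x ≤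
      ENNReal.ofReal (Real.exp (C₁ + θ / 2 * S)) := by
    intro x
    rw [siteDensity, expL2, ← ENNReal.ofReal_mul (Real.exp_nonneg _), ← Real.exp_add]
    refine ENNReal.ofReal_le_ofReal (Real.exp_le_exp.2 ?_)
    have h1 := (abs_le.1 (hint x)).2
    have h2 := hC₁ ℓ x
    rw [siteEnergy]
    linarith
  have hlower : ∀ x : Loop β ν, ‖x‖ ≤ R →
      ENNReal.ofReal (Real.exp (-(C₂ + b * (β * (R : ℝ) ^ 2) + θ / 2 * S))) ≤
        M.siteDensity ℓ x ξ := by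
    intro x hx
    rw [siteDensity]
    refine ENNReal.ofReal_le_ofReal (Real.exp_le_exp.2 ?_)
    have h1 := (abs_le.1 (hint x)).1
    have h2 := hC₂ ℓ x hx
    have h3 : b * ‖toL2 x‖ ^ 2 ≤ b * (β * (R : ℝ) ^ 2) := by
      gcongr
      exact norm_toL2_sq_le hx
    rw [siteEnergy]
    linarith
  have hnum : ∫⁻ x, M.siteDensity ℓ x ξ * ({x : Loop β ν | ‖toL2 x‖ ≤ N}.indicator
      (fun x => expHolder σ c x * expL2 κ x) x) ∂χ ≤
      ENNReal.ofReal (Real.exp (C₁ + θ / 2 * S)) * Q := by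
    rw [hQ, ← lintegral_const_mul _ (measurable_expHolder σ c)]
    refine lintegral_mono fun x => ?_
    calc _ ≤ M.siteDensity ℓ x ξ * (expHolder σ c x * expL2 κ x) := by
          gcongr
          exact Set.indicator_le_self' (fun _ _ => zero_le) x
      _ = M.siteDensity ℓ x ξ * expL2 κ x * expHolder σ c x := by ring
      _ ≤ _ := by gcongr; exact hupper x
  have hden : ENNReal.ofReal (Real.exp (-(C₂ + b * (β * (R : ℝ) ^ 2) + θ / 2 * S))) * p ≤
      ∫⁻ x, M.siteDensity ℓ x ξ * ({x : Loop β ν | ‖toL2 x‖ ≤ N}.indicator 1 x) ∂χ := by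
    have hm : MeasurableSet (Metric.closedBall (0 : Loop β ν) R) := measurableSet_closedBall
    rw [hp, ← setLIntegral_const, ← lintegral_indicator hm]
    refine lintegral_mono fun x => ?_
    by_cases hx : x ∈ Metric.closedBall (0 : Loop β ν) R
    · have hx' : ‖x‖ ≤ R := mem_closedBall_zero_iff.1 hx
      have hxN : x ∈ {x : Loop β ν | ‖toL2 x‖ ≤ N} :=
        (Real.le_sqrt (norm_nonneg _) (by positivity)).2 (norm_toL2_sq_le hx') |>.trans hN
      rw [Set.indicator_of_mem hx, Set.indicator_of_mem hxN, Pi.one_apply, mul_one]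
      exact hlower x hx'
    · rw [Set.indicator_of_notMem hx]
      exact zero_le
  refine hnum.trans (le_trans ?_ (mul_le_mul_right hden _))
  rw [← mul_assoc, ← ENNReal.ofReal_mul (Real.exp_nonneg _), ← Real.exp_add]
  have hQ' : Q = ENNReal.ofReal q * p := by
    rw [← hqe, ENNReal.div_mul_cancel hR.ne' hptop]
  rw [hQ', ← mul_assoc, ← ENNReal.ofReal_mul (Real.exp_nonneg _)]
  gcongr
  rw [show C₃ + Real.log (q + 1) + θ * S + -(C₂ + b * (β * (R : ℝ) ^ 2) + θ / 2 * S) =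
    (C₁ + θ / 2 * S) + Real.log (q + 1) by rw [hC₃]; ring, Real.exp_add _ (Real.log _),
    Real.exp_log (by positivity)]
  gcongr
  linarith

end Model

/-! ### Uniform bounds for tempered Gibbs measures -/

/-- Jensen's inequality for the exponential with weights of total mass at most one, the missing
mass being placed at `0`. -/
lemma exp_sum_mul_le {ι : Type*} (T : Finset ι) {q u : ι → ℝ} (hq : ∀ k ∈ T, 0 ≤ q k)
    (hsum : ∑ k ∈ T, q k ≤ 1) :
    Real.exp (∑ k ∈ T, q k * u k) ≤ 1 + ∑ k ∈ T, q k * Real.exp (u k) := by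
  set s := ∑ k ∈ T, q k * u k with hs
  set Q := ∑ k ∈ T, q k with hQ
  have h1 : ∀ k ∈ T, q k * (Real.exp s * (1 + (u k - s))) ≤ q k * Real.exp (u k) := by
    intro k hk
    refine mul_le_mul_of_nonneg_left ?_ (hq k hk)
    have := Real.add_one_le_exp (u k - s)
    calc _ ≤ Real.exp s * Real.exp (u k - s) := by gcongr; linarith
      _ = _ := by rw [← Real.exp_add]; ring_nf
  have h2 := Finset.sum_le_sum h1
  have e : ∑ k ∈ T, q k * (Real.exp s * (1 + (u k - s))) = Real.exp s * (Q + (s - Q * s)) := by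
    rw [hQ, hs, Finset.sum_mul, ← Finset.sum_sub_distrib, ← Finset.sum_add_distrib, Finset.mul_sum]
    exact Finset.sum_congr rfl fun k _ => by ring
  rw [e] at h2
  have h3 : Real.exp s * (1 - s) ≤ 1 := by
    have := Real.add_one_le_exp (-s)
    calc _ ≤ Real.exp s * Real.exp (-s) := by gcongr; linarith
      _ = 1 := by rw [← Real.exp_add]; simp
  have hQ0 : 0 ≤ Q := Finset.sum_nonneg hq
  nlinarith [mul_nonneg (sub_nonneg.2 hsum) (sub_nonneg.2 h3)]

section cutoff

variable {d ν : ℕ} {β : ℝ} [hβ : Fact (0 < β)]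

/-- The indicator of the loops of `L²` norm at most `N`. -/
def ballInd (N : ℝ) (x : Loop β ν) : ℝ≥0∞ := {x : Loop β ν | ‖toL2 x‖ ≤ N}.indicator 1 x

lemma measurable_ballInd (N : ℝ) : Measurable (ballInd N : Loop β ν → ℝ≥0∞) :=
  measurable_one.indicator (isClosed_le continuous_norm_toL2 continuous_const).measurableSet

lemma ballInd_le_one (N : ℝ) (x : Loop β ν) : ballInd N x ≤ 1 :=
  Set.indicator_le_self' (fun _ _ => zero_le) x

lemma indicator_eq_ballInd_mul (N : ℝ) (f : Loop β ν → ℝ≥0∞) (x : Loop β ν) :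
    {x : Loop β ν | ‖toL2 x‖ ≤ N}.indicator f x = ballInd N x * f x := by
  by_cases hx : x ∈ {x : Loop β ν | ‖toL2 x‖ ≤ N} <;> simp [ballInd, hx]

/-- The indicator of the configurations all of whose loops in `Λ` have `L²` norm at most `N`. -/
def cutoff (Λ : Finset (Site d)) (N : ℝ) (ω : Config d ν β) : ℝ≥0∞ := ∏ k ∈ Λ, ballInd N (ω k)

lemma measurable_cutoff (Λ : Finset (Site d)) (N : ℝ) :
    Measurable (cutoff Λ N : Config d ν β → ℝ≥0∞) :=
  Finset.measurable_prod _ fun k _ => (measurable_ballInd N).comp (measurable_pi_apply k)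

lemma cutoff_le_one (Λ : Finset (Site d)) (N : ℝ) (ω : Config d ν β) : cutoff Λ N ω ≤ 1 :=
  Finset.prod_le_one' fun k _ => ballInd_le_one N (ω k)

lemma cutoff_mul_exp_le (Λ : Finset (Site d)) {N : ℝ} (ω : Config d ν β) {k : Site d}
    (hk : k ∈ Λ) {κ : ℝ} (hκ : 0 ≤ κ) :
    cutoff Λ N ω * ENNReal.ofReal (Real.exp (κ * ‖toL2 (ω k)‖ ^ 2)) ≤
      ENNReal.ofReal (Real.exp (κ * N ^ 2)) := by
  by_cases h : ‖toL2 (ω k)‖ ≤ N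
  · refine (mul_le_of_le_one_left' (cutoff_le_one Λ N ω)).trans ?_
    gcongr
  · have : cutoff Λ N ω = 0 := by
      refine Finset.prod_eq_zero hk ?_
      simp [ballInd, h]
    simp [this]

lemma eventually_cutoff_eq_one (Λ : Finset (Site d)) (ω : Config d ν β) :
    ∀ᶠ n : ℕ in atTop, cutoff Λ n ω = 1 := by
  have h : ∀ k ∈ Λ, ∀ᶠ n : ℕ in atTop, ‖toL2 (ω k)‖ ≤ n := fun k _ =>
    tendsto_natCast_atTop_atTop.eventually_ge_atTop _
  filter_upwards [(Finset.eventually_all Λ).2 h] with n hn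
  refine Finset.prod_eq_one fun k hk => ?_
  simp [ballInd, hn k hk]

end cutoff

namespace Model

variable {d ν : ℕ} {M : Model d ν} {β : ℝ} [hβ : Fact (0 < β)]

lemma boundary_update (ℓ : Site d) (ξ : Config d ν β) (x : Loop β ν) :
    M.boundary ℓ (Function.update ξ ℓ x) = M.boundary ℓ ξ := by
  refine tsum_congr fun k => ?_
  by_cases hk : k = ℓ
  · subst hk
    simp [M.J_diag]
  · rw [Function.update_of_ne hk]

lemma measurable_norm_toL2_site (k : Site d) :
    Measurable fun ω : Config d ν β => ‖toL2 (ω k)‖ ^ 2 :=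
  (continuous_norm_toL2.pow 2).measurable.comp (measurable_pi_apply k)

lemma measurable_boundary (ℓ : Site d) :
    Measurable fun ξ : Config d ν β => M.boundary ℓ ξ :=
  measurable_real_tsum fun k => (measurable_norm_toL2_site k).const_mul _

/-- The one-site estimate averaged over a Gibbs measure, in the presence of a factor `G` that does
not depend on the loop at `ℓ`. -/
lemma lintegral_mul_le_of_site_estimate [IsProbabilityMeasure (oscillatorMeasure M.m M.a β ν)]
    {ε : ℝ} {μ : Measure (Config d ν β)} (hμ : μ ∈ M.gibbs β ε) {σ : ℝ≥0} {c κ θ D N : ℝ}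
    (ℓ : Site d)
    (hsite : ∀ ξ ∈ M.tempered β ε,
      ∫⁻ x, M.siteDensity ℓ x ξ * ({x : Loop β ν | ‖toL2 x‖ ≤ N}.indicator
          (fun x => expHolder σ c x * expL2 κ x) x) ∂(oscillatorMeasure M.m M.a β ν) ≤
        ENNReal.ofReal (Real.exp (D + θ * M.boundary ℓ ξ)) *
          ∫⁻ x, M.siteDensity ℓ x ξ * ({x : Loop β ν | ‖toL2 x‖ ≤ N}.indicator 1 x)
            ∂(oscillatorMeasure M.m M.a β ν))
    {G : Config d ν β → ℝ≥0∞} (hG : Measurable G)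
    (hGu : ∀ ξ x, G (Function.update ξ ℓ x) = G ξ) :
    ∫⁻ ω, G ω * (ballInd N (ω ℓ) * (expHolder σ c (ω ℓ) * expL2 κ (ω ℓ))) ∂μ ≤
      ∫⁻ ω, G ω * (ballInd N (ω ℓ) *
        ENNReal.ofReal (Real.exp (D + θ * M.boundary ℓ ω))) ∂μ := by
  have hev : Measurable fun ω : Config d ν β => ω ℓ := measurable_pi_apply ℓ
  have hF1 : Measurable fun x : Loop β ν => ballInd N x * (expHolder σ c x * expL2 κ x) :=
    (measurable_ballInd N).mul ((measurable_expHolder σ c).mul (measurable_expL2 κ))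
  have hF2 : Measurable fun ω : Config d ν β => ENNReal.ofReal
      (Real.exp (D + θ * M.boundary ℓ ω)) :=
    ENNReal.measurable_ofReal.comp (Real.measurable_exp.comp
      (((measurable_boundary ℓ).const_mul θ).const_add D))
  have hm1 : Measurable fun ω : Config d ν β =>
      G ω * (ballInd N (ω ℓ) * (expHolder σ c (ω ℓ) * expL2 κ (ω ℓ))) := hG.mul (hF1.comp hev)
  have hm2 : Measurable fun ω : Config d ν β => G ω * (ballInd N (ω ℓ) *
        ENNReal.ofReal (Real.exp (D + θ * M.boundary ℓ ω))) :=
    hG.mul (((measurable_ballInd N).comp hev).mul hF2)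
  rw [M.lintegral_eq_of_mem_gibbs hμ ℓ hm1, M.lintegral_eq_of_mem_gibbs hμ ℓ hm2]
  refine lintegral_mono_ae ?_
  filter_upwards [M.ae_mem_tempered hμ] with ξ hξ
  have hρ : Measurable fun x : Loop β ν => M.siteDensity ℓ x ξ :=
    (M.measurable_siteDensity ℓ).comp measurable_prodMk_left
  have hm3 : Measurable fun x : Loop β ν => M.siteDensity ℓ x ξ *
      (ballInd N x * (expHolder σ c x * expL2 κ x)) := hρ.mul hF1
  have hm4 : Measurable fun x : Loop β ν => M.siteDensity ℓ x ξ * ballInd N x :=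
    hρ.mul (measurable_ballInd N)
  have h1 := hsite ξ hξ
  simp only [indicator_eq_ballInd_mul, Pi.one_apply, mul_one] at h1
  simp only [hGu, Function.update_self, boundary_update]
  gcongr (M.sitePartition ℓ ξ)⁻¹ * ?_
  calc ∫⁻ x, M.siteDensity ℓ x ξ * (G ξ * (ballInd N x * (expHolder σ c x * expL2 κ x)))
        ∂(oscillatorMeasure M.m M.a β ν)
      = G ξ * ∫⁻ x, M.siteDensity ℓ x ξ * (ballInd N x * (expHolder σ c x * expL2 κ x))
        ∂(oscillatorMeasure M.m M.a β ν) := by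
        rw [← lintegral_const_mul _ hm3]
        exact lintegral_congr fun x => by ring
    _ ≤ G ξ * (ENNReal.ofReal (Real.exp (D + θ * M.boundary ℓ ξ)) *
          ∫⁻ x, M.siteDensity ℓ x ξ * ballInd N x ∂(oscillatorMeasure M.m M.a β ν)) := by gcongr
    _ = _ := by
        rw [← mul_assoc, ← lintegral_const_mul _ hm4]
        exact lintegral_congr fun x => by ring

/-- The weighted strength `κ ∑_{k ∉ Λ} w(ℓ, k) |ω_k|²` of the configuration outside `Λ`. -/
def tail (w : Site d → Site d → ℝ) (κ : ℝ) (Λ : Finset (Site d)) (ℓ : Site d)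
    (ω : Config d ν β) : ℝ :=
  κ * ∑' k : {k // k ∉ Λ}, w ℓ k * ‖toL2 (ω k)‖ ^ 2

lemma tail_update (w : Site d → Site d → ℝ) (κ : ℝ) {Λ : Finset (Site d)} {ℓ : Site d}
    (hℓ : ℓ ∈ Λ) (ω : Config d ν β) (x : Loop β ν) :
    tail w κ Λ ℓ (Function.update ω ℓ x) = tail w κ Λ ℓ ω := by
  unfold tail
  congr 1
  refine tsum_congr fun k => ?_
  rw [Function.update_of_ne]
  intro h
  exact k.2 (h ▸ hℓ)

lemma measurable_tail (w : Site d → Site d → ℝ) (κ : ℝ) (Λ : Finset (Site d)) (ℓ : Site d) :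
    Measurable fun ω : Config d ν β => tail w κ Λ ℓ ω :=
  (measurable_real_tsum fun k : {k // k ∉ Λ} =>
    (measurable_norm_toL2_site (k : Site d)).const_mul _).const_mul κ

lemma IsAdmissible.tail_nonneg {ε : ℝ} {w : Site d → Site d → ℝ} {C : ℝ}
    (h : M.IsAdmissible β ε w C) {κ : ℝ} (hκ : 0 ≤ κ) (Λ : Finset (Site d)) (ℓ : Site d)
    (ω : Config d ν β) : 0 ≤ tail w κ Λ ℓ ω :=
  mul_nonneg hκ (tsum_nonneg fun _ => mul_nonneg (h.nonneg _ _) (sq_nonneg _))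

/-- The weighted tail is a supersolution: it compensates the influence of the configuration outside
`Λ`, both direct and through the tails at the other sites of `Λ`. -/
lemma IsAdmissible.boundary_sub_tail_le {ε : ℝ} {w : Site d → Site d → ℝ} {C : ℝ}
    (h : M.IsAdmissible β ε w C) {κ θ : ℝ} (hκ : 0 < κ) (hθ : 0 < θ) (hθκ : 2 * θ * C ≤ κ)
    (Λ : Finset (Site d)) (ℓ : Site d) {ω : Config d ν β} (hω : ω ∈ M.tempered β ε) :
    θ * M.boundary ℓ ω - tail w κ Λ ℓ ω ≤
      ∑ k ∈ Λ, θ * |M.J ℓ k| / κ * (κ * ‖toL2 (ω k)‖ ^ 2 - tail w κ Λ k ω) := by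
  have hsJ := h.summable_J_sq hω ℓ
  have hsw := h.summable ω hω
  have hsub : ∀ k, Summable fun j : {j // j ∉ Λ} => w k j * ‖toL2 (ω j)‖ ^ 2 := fun k =>
    (hsw k).subtype _
  have hsJsub : Summable fun j : {j // j ∉ Λ} => |M.J ℓ j| * ‖toL2 (ω j)‖ ^ 2 := hsJ.subtype _
  have hsplit : M.boundary ℓ ω = ∑ k ∈ Λ, |M.J ℓ k| * ‖toL2 (ω k)‖ ^ 2 +
      ∑' j : {j // j ∉ Λ}, |M.J ℓ j| * ‖toL2 (ω j)‖ ^ 2 :=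
    (hsJ.sum_add_tsum_subtype_compl Λ).symm
  have hR : ∑ k ∈ Λ, θ * |M.J ℓ k| / κ * (κ * ‖toL2 (ω k)‖ ^ 2 - tail w κ Λ k ω) =
      θ * ∑ k ∈ Λ, |M.J ℓ k| * ‖toL2 (ω k)‖ ^ 2 -
      θ * ∑ k ∈ Λ, |M.J ℓ k| * ∑' j : {j // j ∉ Λ}, w k j * ‖toL2 (ω j)‖ ^ 2 := by
    rw [Finset.mul_sum, Finset.mul_sum, ← Finset.sum_sub_distrib]
    refine Finset.sum_congr rfl fun k _ => ?_
    unfold tail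
    field_simp
  have hswap : ∑ k ∈ Λ, |M.J ℓ k| * ∑' j : {j // j ∉ Λ}, w k j * ‖toL2 (ω j)‖ ^ 2 =
      ∑' j : {j // j ∉ Λ}, (∑ k ∈ Λ, |M.J ℓ k| * w k j) * ‖toL2 (ω j)‖ ^ 2 := by
    simp_rw [← tsum_mul_left]
    rw [← Summable.tsum_finsetSum fun k _ => (hsub k).mul_left _]
    refine tsum_congr fun j => ?_
    rw [Finset.sum_mul]
    exact Finset.sum_congr rfl fun k _ => by ring
  have hsC : Summable fun j : {j // j ∉ Λ} => C * (w ℓ j * ‖toL2 (ω j)‖ ^ 2) :=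
    (hsub ℓ).mul_left C
  have h1 : ∑' j : {j // j ∉ Λ}, |M.J ℓ j| * ‖toL2 (ω j)‖ ^ 2 ≤
      C * ∑' j : {j // j ∉ Λ}, w ℓ j * ‖toL2 (ω j)‖ ^ 2 := by
    rw [← tsum_mul_left]
    refine hsJsub.tsum_le_tsum (fun j => ?_) hsC
    rw [← mul_assoc]
    gcongr
    exact h.abs_J_le ℓ j
  have hle : ∀ j : {j // j ∉ Λ}, (∑ k ∈ Λ, |M.J ℓ k| * w k j) * ‖toL2 (ω j)‖ ^ 2 ≤
      C * (w ℓ j * ‖toL2 (ω j)‖ ^ 2) := by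
    intro j
    rw [← mul_assoc]
    gcongr
    exact h.sum_J_mul_le ℓ j Λ
  have h2 : ∑' j : {j // j ∉ Λ}, (∑ k ∈ Λ, |M.J ℓ k| * w k j) * ‖toL2 (ω j)‖ ^ 2 ≤
      C * ∑' j : {j // j ∉ Λ}, w ℓ j * ‖toL2 (ω j)‖ ^ 2 := by
    rw [← tsum_mul_left]
    refine Summable.tsum_le_tsum hle (Summable.of_nonneg_of_le (fun j => ?_) hle hsC) hsC
    exact mul_nonneg (Finset.sum_nonneg fun k _ => mul_nonneg (abs_nonneg _) (h.nonneg _ _))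
      (sq_nonneg _)
  rw [hR, hswap, hsplit]
  have h3 : 0 ≤ ∑' j : {j // j ∉ Λ}, w ℓ j * ‖toL2 (ω j)‖ ^ 2 :=
    tsum_nonneg fun k => mul_nonneg (h.nonneg _ _) (sq_nonneg _)
  unfold tail
  nlinarith [mul_le_mul_of_nonneg_left h1 hθ.le, mul_le_mul_of_nonneg_left h2 hθ.le,
    mul_le_mul_of_nonneg_right hθκ h3]

/-- The moments in a finite volume `Λ`, cut off at level `N` and damped by the tail outside `Λ`,
are bounded uniformly in `Λ` and `N`: the largest of them is at most a constant plus half of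
itself. -/
lemma IsAdmissible.lintegral_cutoff_le {ε : ℝ} {w : Site d → Site d → ℝ} {C : ℝ}
    (h : M.IsAdmissible β ε w C) [IsProbabilityMeasure (oscillatorMeasure M.m M.a β ν)]
    {μ : Measure (Config d ν β)} (hμ : μ ∈ M.gibbs β ε) {σ : ℝ≥0} {c κ θ D N : ℝ}
    (hκ : 0 < κ) (hθ : 0 < θ) (hθκ : 2 * θ * C ≤ κ)
    (hsite : ∀ ℓ : Site d, ∀ ξ ∈ M.tempered β ε,
      ∫⁻ x, M.siteDensity ℓ x ξ * ({x : Loop β ν | ‖toL2 x‖ ≤ N}.indicator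
          (fun x => expHolder σ c x * expL2 κ x) x) ∂(oscillatorMeasure M.m M.a β ν) ≤
        ENNReal.ofReal (Real.exp (D + θ * M.boundary ℓ ξ)) *
          ∫⁻ x, M.siteDensity ℓ x ξ * ({x : Loop β ν | ‖toL2 x‖ ≤ N}.indicator 1 x)
            ∂(oscillatorMeasure M.m M.a β ν))
    {Λ : Finset (Site d)} {ℓ : Site d} (hℓ : ℓ ∈ Λ) :
    ∫⁻ ω, cutoff Λ N ω * (ENNReal.ofReal (Real.exp (-tail w κ Λ ℓ ω)) *
        (expHolder σ c (ω ℓ) * expL2 κ (ω ℓ))) ∂μ ≤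
      ENNReal.ofReal (Real.exp (2 * D) + 1) := by
  have := hμ.1
  set u : Site d → Config d ν β → ℝ := fun k ω => κ * ‖toL2 (ω k)‖ ^ 2 - tail w κ Λ k ω with hu
  set A : Site d → ℝ≥0∞ := fun k => ∫⁻ ω, cutoff Λ N ω * ENNReal.ofReal (Real.exp (u k ω)) ∂μ
    with hA
  set B : ℝ := (Real.exp (2 * D) + 1) / 2 with hB
  have hB0 : 0 ≤ B := by positivity
  have hum : ∀ k, Measurable (u k) := fun k =>
    ((measurable_norm_toL2_site k).const_mul κ).sub (measurable_tail w κ Λ k)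
  have hum' : ∀ k, Measurable fun ω : Config d ν β =>
      cutoff Λ N ω * ENNReal.ofReal (Real.exp (u k ω)) := fun k =>
    (measurable_cutoff Λ N).mul (ENNReal.measurable_ofReal.comp (Real.measurable_exp.comp (hum k)))
  have hAtop : ∀ k ∈ Λ, A k ≠ ⊤ := by
    intro k hk
    refine (lt_of_le_of_lt (lintegral_mono fun ω => (?_ : _ ≤
      ENNReal.ofReal (Real.exp (κ * N ^ 2)))) ?_).ne
    · refine le_trans ?_ (cutoff_mul_exp_le Λ ω hk hκ.le)
      gcongr
      have := h.tail_nonneg hκ.le Λ k ω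
      simp only [hu]
      linarith
    · rw [lintegral_const, measure_univ, mul_one]
      exact ENNReal.ofReal_lt_top
  -- The coefficients of the recursion have total mass at most `1/2`.
  have hp : ∀ j, ∑ k ∈ Λ, θ * |M.J j k| / κ ≤ 1 / 2 := by
    intro j
    rw [← Finset.sum_div, ← Finset.mul_sum, div_le_iff₀ hκ]
    have := mul_le_mul_of_nonneg_left (h.sum_J_le j Λ) hθ.le
    linarith
  have hp0 : ∀ j k, 0 ≤ θ * |M.J j k| / κ := fun j k => by positivity
  -- The recursion: the one-site estimate at `j`, followed by the supersolution property of the tail.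
  have hmain : ∀ j ∈ Λ, ∫⁻ ω, cutoff Λ N ω * (ENNReal.ofReal (Real.exp (-tail w κ Λ j ω)) *
        (expHolder σ c (ω j) * expL2 κ (ω j))) ∂μ ≤
      ENNReal.ofReal B + ∑ k ∈ Λ, ENNReal.ofReal (θ * |M.J j k| / κ) * A k := by
    intro j hj
    set G : Config d ν β → ℝ≥0∞ := fun ω => cutoff (Λ.erase j) N ω *
      ENNReal.ofReal (Real.exp (-tail w κ Λ j ω)) with hG
    have hGm : Measurable G := (measurable_cutoff _ N).mul (ENNReal.measurable_ofReal.comp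
      (Real.measurable_exp.comp (measurable_tail w κ Λ j).neg))
    have hGu : ∀ ξ x, G (Function.update ξ j x) = G ξ := by
      intro ξ x
      simp only [hG, tail_update w κ hj, cutoff]
      congr 1
      refine Finset.prod_congr rfl fun k hk => ?_
      rw [Function.update_of_ne (Finset.ne_of_mem_erase hk)]
    have hcut : ∀ ω : Config d ν β, ballInd N (ω j) * cutoff (Λ.erase j) N ω = cutoff Λ N ω :=
      fun ω => Finset.mul_prod_erase Λ (fun k => ballInd N (ω k)) hj
    have hstep := lintegral_mul_le_of_site_estimate hμ j (hsite j) hGm hGu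
    calc _ = ∫⁻ ω, G ω * (ballInd N (ω j) * (expHolder σ c (ω j) * expL2 κ (ω j))) ∂μ := by
          refine lintegral_congr fun ω => ?_
          rw [← hcut ω]
          simp only [hG]
          ring
      _ ≤ _ := hstep
      _ ≤ ∫⁻ ω, (ENNReal.ofReal B + ∑ k ∈ Λ, ENNReal.ofReal (θ * |M.J j k| / κ) *
            (cutoff Λ N ω * ENNReal.ofReal (Real.exp (u k ω)))) ∂μ := by
          refine lintegral_mono_ae ?_
          filter_upwards [M.ae_mem_tempered hμ] with ω hω
          have h1 := h.boundary_sub_tail_le hκ hθ hθκ Λ j hω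
          set s := ∑ k ∈ Λ, θ * |M.J j k| / κ * u k ω with hs
          -- From `xy ≤ (x² + y²) / 2` with `x = exp D`, `y = exp s`, and Jensen's inequality for
          -- `exp (2s)`, whose weights have total mass at most one.
          have h2 : Real.exp (D + θ * M.boundary j ω) * Real.exp (-tail w κ Λ j ω) ≤
              B + ∑ k ∈ Λ, θ * |M.J j k| / κ * Real.exp (u k ω) := by
            rw [← Real.exp_add]
            have h3 : Real.exp (D + θ * M.boundary j ω + -tail w κ Λ j ω) ≤
                Real.exp D * Real.exp s := by
              rw [← Real.exp_add]
              exact Real.exp_le_exp.2 (by linarith)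
            have h4 := exp_sum_mul_le Λ (q := fun k => 2 * (θ * |M.J j k| / κ))
              (u := fun k => u k ω) (fun k _ => by have := hp0 j k; positivity) (by
                rw [← Finset.mul_sum]
                linarith [hp j])
            have h5 : ∑ k ∈ Λ, 2 * (θ * |M.J j k| / κ) * u k ω = 2 * s := by
              rw [hs, Finset.mul_sum]
              exact Finset.sum_congr rfl fun k _ => by ring
            have h6 : ∑ k ∈ Λ, 2 * (θ * |M.J j k| / κ) * Real.exp (u k ω) =
                2 * ∑ k ∈ Λ, θ * |M.J j k| / κ * Real.exp (u k ω) := by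
              rw [Finset.mul_sum]
              exact Finset.sum_congr rfl fun k _ => by ring
            rw [h5, h6, two_mul s, Real.exp_add] at h4
            have h7 : Real.exp (2 * D) = Real.exp D * Real.exp D := by
              rw [← Real.exp_add]; ring_nf
            rw [hB, h7]
            nlinarith [sq_nonneg (Real.exp D - Real.exp s)]
          calc _ = cutoff Λ N ω * ENNReal.ofReal (Real.exp (D + θ * M.boundary j ω) *
                Real.exp (-tail w κ Λ j ω)) := by
                rw [ENNReal.ofReal_mul (Real.exp_nonneg _), ← hcut ω]
                simp only [hG]
                ring
            _ ≤ cutoff Λ N ω * ENNReal.ofReal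
                (B + ∑ k ∈ Λ, θ * |M.J j k| / κ * Real.exp (u k ω)) := by gcongr
            _ = cutoff Λ N ω * ENNReal.ofReal B + ∑ k ∈ Λ, ENNReal.ofReal (θ * |M.J j k| / κ) *
                (cutoff Λ N ω * ENNReal.ofReal (Real.exp (u k ω))) := by
                rw [ENNReal.ofReal_add hB0 (Finset.sum_nonneg fun k _ =>
                  mul_nonneg (hp0 j k) (Real.exp_nonneg _)), ENNReal.ofReal_sum_of_nonneg
                  (fun k _ => mul_nonneg (hp0 j k) (Real.exp_nonneg _)), mul_add, Finset.mul_sum]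
                congr 1
                refine Finset.sum_congr rfl fun k _ => ?_
                rw [ENNReal.ofReal_mul (hp0 j k)]
                ring
            _ ≤ _ := by
                gcongr
                exact mul_le_of_le_one_left' (cutoff_le_one Λ N ω)
      _ = _ := by
          rw [lintegral_add_left measurable_const, lintegral_const, measure_univ, mul_one,
            lintegral_finsetSum _ fun k _ => (hum' k).const_mul _]
          congr 1
          exact Finset.sum_congr rfl fun k _ => lintegral_const_mul _ (hum' k)
  have hAle : ∀ j, A j ≤ ∫⁻ ω, cutoff Λ N ω * (ENNReal.ofReal (Real.exp (-tail w κ Λ j ω)) *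
        (expHolder σ c (ω j) * expL2 κ (ω j))) ∂μ := by
    intro j
    refine lintegral_mono fun ω => ?_
    simp only [hu]
    gcongr
    calc _ = ENNReal.ofReal (Real.exp (-tail w κ Λ j ω)) * (1 * expL2 κ (ω j)) := by
          rw [expL2, one_mul, ← ENNReal.ofReal_mul (Real.exp_nonneg _), ← Real.exp_add]
          ring_nf
      _ ≤ _ := by
          gcongr
          exact one_le_expHolder σ c (ω j)
  -- The largest moment absorbs the sum on the right-hand side of its own recursion.
  obtain ⟨i, hi, hmax⟩ := Finset.exists_max_image Λ A ⟨ℓ, hℓ⟩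
  have hsumle : ∀ j, ∑ k ∈ Λ, ENNReal.ofReal (θ * |M.J j k| / κ) * A k ≤
      ENNReal.ofReal (1 / 2) * A i := by
    intro j
    calc _ ≤ ∑ k ∈ Λ, ENNReal.ofReal (θ * |M.J j k| / κ) * A i :=
          Finset.sum_le_sum fun k hk => by gcongr; exact hmax k hk
      _ = ENNReal.ofReal (∑ k ∈ Λ, θ * |M.J j k| / κ) * A i := by
          rw [← Finset.sum_mul, ENNReal.ofReal_sum_of_nonneg fun k _ => hp0 j k]
      _ ≤ _ := by gcongr; exact hp j
  obtain ⟨S, hS0, hS⟩ : ∃ S : ℝ, 0 ≤ S ∧ A i = ENNReal.ofReal S :=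
    ⟨_, ENNReal.toReal_nonneg, (ENNReal.ofReal_toReal (hAtop i hi)).symm⟩
  have hSle : S ≤ B + 1 / 2 * S := by
    have := (hAle i).trans ((hmain i hi).trans (add_le_add_right (hsumle i) _))
    rw [hS, ← ENNReal.ofReal_mul (by norm_num), ← ENNReal.ofReal_add hB0 (by positivity),
      ENNReal.ofReal_le_ofReal_iff (by positivity)] at this
    exact this
  refine (hmain ℓ hℓ).trans ((add_le_add_right (hsumle ℓ) _).trans ?_)
  rw [hS, ← ENNReal.ofReal_mul (by norm_num), ← ENNReal.ofReal_add hB0 (by positivity)]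
  refine ENNReal.ofReal_le_ofReal ?_
  rw [hB] at hSle ⊢
  linarith

/-- The tail vanishes as `Λ ↑ 𝕃`. No summability is needed: where the series diverges, so do the series
over the complements of finite sets, and `tsum` takes the value `0` there. -/
lemma tendsto_tail (w : Site d → Site d → ℝ) (κ : ℝ) (ℓ : Site d) (ω : Config d ν β) :
    Tendsto (fun Λ : Finset (Site d) => tail w κ Λ ℓ ω) atTop (𝓝 0) := by
  have := (tendsto_tsum_compl_atTop_zero fun k => w ℓ k * ‖toL2 (ω k)‖ ^ 2).const_mul κ
  simpa [tail] using this

/-- Removal of the cutoff and of the finite volume, by Fatou's lemma. -/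
lemma IsAdmissible.lintegral_le {ε : ℝ} {w : Site d → Site d → ℝ} {C : ℝ}
    (h : M.IsAdmissible β ε w C) [IsProbabilityMeasure (oscillatorMeasure M.m M.a β ν)]
    {σ : ℝ≥0} {c : ℝ} (hc : HasHolderExpMoment M.m M.a β ν σ c) {κ : ℝ} (hκ : 0 < κ) :
    ∃ B : ℝ, 0 < B ∧ ∀ (ℓ : Site d), ∀ μ ∈ M.gibbs β ε,
      ∫⁻ ω : Config d ν β, expHolder σ c (ω ℓ) * expL2 κ (ω ℓ) ∂μ ≤ ENNReal.ofReal B := by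
  have hC := h.const_nonneg
  obtain ⟨θ, hθ, hθκ⟩ : ∃ θ : ℝ, 0 < θ ∧ 2 * θ * C ≤ κ := by
    refine ⟨κ / (2 * (C + 1)), by positivity, ?_⟩
    rw [show 2 * (κ / (2 * (C + 1))) * C = κ * (C / (C + 1)) by field_simp]
    exact mul_le_of_le_one_right hκ.le ((div_le_one (by positivity)).2 (by linarith))
  obtain ⟨D, N₀, hsite⟩ := h.exists_site_estimate hc hκ hθ
  refine ⟨Real.exp (2 * D) + 1, by positivity, fun ℓ μ hμ => ?_⟩
  have hev : Measurable fun ω : Config d ν β => ω ℓ := measurable_pi_apply ℓ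
  have hFm : Measurable fun ω : Config d ν β => expHolder σ c (ω ℓ) * expL2 κ (ω ℓ) :=
    ((measurable_expHolder σ c).mul (measurable_expL2 κ)).comp hev
  have htm : ∀ Λ, Measurable fun ω : Config d ν β =>
      ENNReal.ofReal (Real.exp (-tail w κ Λ ℓ ω)) * (expHolder σ c (ω ℓ) * expL2 κ (ω ℓ)) :=
    fun Λ => (ENNReal.measurable_ofReal.comp (Real.measurable_exp.comp
      (measurable_tail w κ Λ ℓ).neg)).mul hFm
  have hΛ : ∀ Λ : Finset (Site d), ℓ ∈ Λ → ∫⁻ ω, ENNReal.ofReal (Real.exp (-tail w κ Λ ℓ ω)) *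
      (expHolder σ c (ω ℓ) * expL2 κ (ω ℓ)) ∂μ ≤ ENNReal.ofReal (Real.exp (2 * D) + 1) := by
    intro Λ hℓ
    calc _ = ∫⁻ ω, liminf (fun n : ℕ => cutoff Λ n ω * (ENNReal.ofReal
          (Real.exp (-tail w κ Λ ℓ ω)) * (expHolder σ c (ω ℓ) * expL2 κ (ω ℓ)))) atTop ∂μ := by
          refine lintegral_congr fun ω => (Tendsto.liminf_eq ?_).symm
          refine tendsto_const_nhds.congr' ?_
          filter_upwards [eventually_cutoff_eq_one Λ ω] with n hn
          rw [hn, one_mul]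
      _ ≤ liminf (fun n : ℕ => ∫⁻ ω, cutoff Λ n ω * (ENNReal.ofReal
          (Real.exp (-tail w κ Λ ℓ ω)) * (expHolder σ c (ω ℓ) * expL2 κ (ω ℓ))) ∂μ) atTop :=
          lintegral_liminf_le fun n => (measurable_cutoff Λ n).mul (htm Λ)
      _ ≤ _ := by
          refine liminf_le_of_le (by isBoundedDefault) fun b hb => ?_
          obtain ⟨n, hn, hnN⟩ := (hb.and
            (tendsto_natCast_atTop_atTop.eventually_ge_atTop N₀)).exists
          exact hn.trans (h.lintegral_cutoff_le hμ hκ hθ hθκ (hsite n hnN) hℓ)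
  calc _ = ∫⁻ ω, liminf (fun Λ : Finset (Site d) => ENNReal.ofReal (Real.exp (-tail w κ Λ ℓ ω)) *
        (expHolder σ c (ω ℓ) * expL2 κ (ω ℓ))) atTop ∂μ := by
        refine lintegral_congr fun ω => (Tendsto.liminf_eq ?_).symm
        have h1 : Tendsto (fun Λ : Finset (Site d) =>
            ENNReal.ofReal (Real.exp (-tail w κ Λ ℓ ω))) atTop (𝓝 1) := by
          have := (Real.continuous_exp.tendsto _).comp (tendsto_tail w κ ℓ ω).neg
          simpa using ENNReal.tendsto_ofReal this
        have h2 := ENNReal.Tendsto.mul_const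
          (b := expHolder σ c (ω ℓ) * expL2 κ (ω ℓ)) h1 (Or.inl one_ne_zero)
        simpa using h2
    _ ≤ liminf (fun Λ : Finset (Site d) => ∫⁻ ω, ENNReal.ofReal (Real.exp (-tail w κ Λ ℓ ω)) *
        (expHolder σ c (ω ℓ) * expL2 κ (ω ℓ)) ∂μ) atTop := lintegral_liminf_le htm
    _ ≤ _ := by
        refine liminf_le_of_le (by isBoundedDefault) fun b hb => ?_
        obtain ⟨Λ, hn, hℓ⟩ := (hb.and (eventually_ge_atTop ({ℓ} : Finset (Site d)))).exists
        exact hn.trans (hΛ Λ (hℓ (Finset.mem_singleton_self ℓ)))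

end Model

end QuantumCrystal

theorem theorem3p2 {d ν : ℕ} (hd : 0 < d) (hν : 0 < ν) (M : QuantumCrystal.Model d ν)
    (β : ℝ) [Fact (0 < β)] (ε : ℝ) (hε : 0 < ε) (σ : ℝ≥0) (hσ₀ : 0 < σ) (hσ : σ < 1 / 2) :
    (∃ c : ℝ, 0 < c ∧ QuantumCrystal.HasHolderExpMoment M.m M.a β ν σ c) ∧
    ∀ c : ℝ, 0 < c → QuantumCrystal.HasHolderExpMoment M.m M.a β ν σ c →
      ∀ κ : ℝ, 0 < κ → ∃ C : ℝ, 0 < C ∧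
        ∀ (ℓ : QuantumCrystal.Site d), ∀ μ ∈ M.gibbs β ε,
          ∫⁻ ω : QuantumCrystal.Config d ν β,
            EReal.exp ((ENNReal.ofReal c * QuantumCrystal.holderENorm σ (ω ℓ) ^ 2
              + ENNReal.ofReal κ * ‖QuantumCrystal.toL2 (ω ℓ)‖ₑ ^ 2 : ℝ≥0∞) : EReal) ∂μ
            ≤ ENNReal.ofReal C := by
  have hχ := QuantumCrystal.isOscillatorMeasure_oscillatorMeasure (β := β) M.m_pos M.a_pos hν
  have := hχ.1
  refine ⟨hχ.exists_exp_holder M.m_pos M.a_pos hν hσ₀ hσ, fun c _ hc κ hκ => ?_⟩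
  obtain ⟨w, C, h⟩ := M.exists_isAdmissible β hε
  obtain ⟨B, hB, hle⟩ := h.lintegral_le hc hκ
  refine ⟨B, hB, fun ℓ μ hμ => ?_⟩
  simp only [QuantumCrystal.exp_add_eq_expHolder_mul_expL2 σ c hκ.le]
  exact hle ℓ μ hμ

end
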